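/- Let $\omega_0>0$, $\pi/2<\alpha<\pi$, $\mathbf n=(\cos(\pi+\alpha),\sin(\pi+\alpha))$, and let $f\in L^1_{loc}(\mathbb R)$ be a (complex-valued) function with $f(s)=0$ for $s<0$, $\sup_s(1+|s|)^p|f(s)|<\infty$ for some $p\in\mathbb R$, and $\lim_{s\to+\infty}f(s)=1$. Let $u_i(x,t)=e^{-i\omega_0(t-\mathbf n\cdot x)}f(t-\mathbf n\cdot x)$, $x\in\mathbb R^2$, $t\in\mathbb R$, be the incident plane wave, $W^0=\{x\in\mathbb R^2:x_2=0,\ x_1>0\}$ and $Q=\mathbb R^2\setminus\overline{W^0}$. For a tempered distribution $u$ on $\mathbb R^2\times\mathbb R$ supported in $\{t\ge 0\}$ and $\omega\in\mathbb C^+=\{\mathrm{Im}\,\omega>0\}$, let the Fourier–Laplace transform $\hat u(\cdot,\omega)\in\mathcal S'(\mathbb R^2)$ be defined by $\langle\hat u(\cdot,\omega),\varphi\rangle=\langle u,\varphi(x)e^{i\omega t}\rangle$ (with $e^{i\omega t}$ cut off smoothly to the left of $t=0$); for functions $h$ of $t$, $\hat h(\omega)=\int_0^\infty e^{i\omega t}h(t)\,dt$.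 Let $\mathcal M$ be the set of those $u$ for which $\hat u(\cdot,\omega)$ is given by a function on $Q$ for every $\omega\in\mathbb C^+$ (the set $\overline{W^0}$ being null), such that $\omega\mapsto\hat u(\cdot,\omega)$ is holomorphic on $\mathbb C^+$ with values in $C^2(Q)$ (topology of locally uniform convergence of the derivatives of order $\le 2$), and $\hat u(\cdot,\omega)\in H^1(Q)$ for every $\omega\in\mathbb C^+$. **Theorem.** There is exactly one $u_s\in\mathcal M$ that solves the mixed problem $$(\partial_t^2-\Delta)u_s=0\ \text{ in }Q\times\mathbb R,\qquad u_s=0\ \text{ for }x\in Q,\ t<0,\qquad u_s=-u_i\ \text{ for }x\in W^0,\ t>0 .$$ Here the first two equations hold in the sense of distributions, and the boundary condition means that, for every $\omega\in\mathbb C^+$, the traces of $\hat u_s(\cdot,\omega)$ on $W^0$ from both sides $x_2>0$ and $x_2<0$ equal $-\hat u_i(\cdot,\omega)|_{W^0}$, that is, $\hat u_s(\cdot,\pm\varepsilon,\omega)\to-\hat u_i(\cdot,0,\omega)$ in $L^2(0,\infty)$ as $\varepsilon\to0+$. -/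

import Mathlib

open MeasureTheory Set Filter Topology Distribution
open scoped SchwartzMap LineDeriv

namespace HalfPlaneDiffraction

noncomputable section

/-! ### Geometry -/

/-- The plane `ℝ²` with coordinates `(x₁, x₂)`. -/
abbrev Plane : Type := ℝ × ℝ

/-- Space-time `ℝ² × ℝ` with coordinates `(x, t)`. -/
abbrev SpaceTime : Type := Plane × ℝ

/-- The domain `Q`: the plane slit along the half-line `x₂ = 0`, `x₁ ≥ 0` (edge included, so that
`Q` is open). -/
def Q : Set Plane := {x | ¬ (x.2 = 0 ∧ 0 ≤ x.1)}

/-! ### The incident wave -/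

/-- `n · x` for the direction `n = (cos (π + α), sin (π + α))` of the incident wave. -/
def phase (α : ℝ) (x : Plane) : ℝ :=
  Real.cos (Real.pi + α) * x.1 + Real.sin (Real.pi + α) * x.2

/-- The incident plane wave `u_i(x, t) = e^{-i ω₀ (t - n·x)} f (t - n·x)`. -/
def incidentWave (ω₀ α : ℝ) (f : ℝ → ℂ) (x : Plane) (t : ℝ) : ℂ :=
  Complex.exp (-Complex.I * ω₀ * ((t - phase α x : ℝ) : ℂ)) * f (t - phase α x)

/-- Admissible profile functions `f`. -/
structure IsProfile (f : ℝ → ℂ) : Prop where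
  locallyIntegrable : LocallyIntegrable f volume
  eq_zero : ∀ s < 0, f s = 0
  bounded : ∃ p C : ℝ, ∀ s, (1 + |s|) ^ p * ‖f s‖ ≤ C
  tendsto_one : Tendsto f atTop (𝓝 1)

/-! ### The Fourier–Laplace transform in time -/

/-- The Fourier–Laplace transform `∫₀^∞ e^{iωt} h(t) dt` of a function of time. -/
def fourierLaplaceFun (h : ℝ → ℂ) (ω : ℂ) : ℂ :=
  ∫ t in Ioi (0 : ℝ), Complex.exp (Complex.I * ω * t) * h t

/-- `e^{iωt}` times a smooth cut-off which is `1` for `t ≥ -1` and `0` for `t ≤ -2`. -/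
def expCutoff (ω : ℂ) (t : ℝ) : ℂ :=
  (Real.smoothTransition (t + 2) : ℂ) * Complex.exp (Complex.I * ω * t)

theorem contDiff_expCutoff (ω : ℂ) : ContDiff ℝ (⊤ : ℕ∞) (expCutoff ω) := by
  unfold expCutoff
  have h1 : ContDiff ℝ (⊤ : ℕ∞) fun t : ℝ => Real.smoothTransition (t + 2) :=
    Real.smoothTransition.contDiff.comp (contDiff_id.add contDiff_const)
  have h2 : ContDiff ℝ (⊤ : ℕ∞) fun t : ℝ => (Real.smoothTransition (t + 2) : ℂ) :=
    Complex.ofRealCLM.contDiff.comp h1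
  have h3 : ContDiff ℝ (⊤ : ℕ∞) fun t : ℝ => (t : ℂ) := Complex.ofRealCLM.contDiff
  exact h2.mul ((contDiff_const.mul h3).cexp)

theorem expCutoff_eq_exp (ω : ℂ) {t : ℝ} (ht : -1 ≤ t) :
    expCutoff ω t = Complex.exp (Complex.I * ω * t) := by
  rw [expCutoff, Real.smoothTransition.one_of_one_le (by linarith)]; simp

theorem expCutoff_eq_zero (ω : ℂ) {t : ℝ} (ht : t ≤ -2) : expCutoff ω t = 0 := by
  rw [expCutoff, Real.smoothTransition.zero_of_nonpos (by linarith)]; simp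

theorem iteratedDeriv_exp_mul (ω : ℂ) (n : ℕ) :
    iteratedDeriv n (fun t : ℝ => Complex.exp (Complex.I * ω * t)) =
      fun t : ℝ => (Complex.I * ω) ^ n * Complex.exp (Complex.I * ω * t) := by
  induction n with
  | zero => simp
  | succ n ih =>
    rw [iteratedDeriv_succ, ih]
    funext t
    have h1 : HasDerivAt (fun t : ℝ => Complex.I * ω * (t : ℂ)) (Complex.I * ω) t := by
      simpa using (Complex.ofRealCLM.hasDerivAt (x := t)).const_mul (Complex.I * ω)
    rw [(h1.cexp.const_mul ((Complex.I * ω) ^ n)).deriv]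
    ring

theorem expCutoff_decay (ω : ℂ) (hω : 0 < ω.im) (k n : ℕ) :
    ∃ C, ∀ t : ℝ, ‖t‖ ^ k * ‖iteratedFDeriv ℝ n (expCutoff ω) t‖ ≤ C := by
  simp only [norm_iteratedFDeriv_eq_norm_iteratedDeriv]
  have hcont : Continuous fun t : ℝ => ‖t‖ ^ k * ‖iteratedDeriv n (expCutoff ω) t‖ :=
    (continuous_norm.pow k).mul
      (((contDiff_expCutoff ω).continuous_iteratedDeriv n (by exact_mod_cast le_top)).norm)
  have hright : Tendsto (fun t : ℝ => ‖t‖ ^ k * ‖iteratedDeriv n (expCutoff ω) t‖)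
      atTop (𝓝 0) := by
    have h := (tendsto_rpow_mul_exp_neg_mul_atTop_nhds_zero (k : ℝ) ω.im hω).const_mul
      (‖(Complex.I * ω) ^ n‖)
    simp only [mul_zero, Real.rpow_natCast] at h
    refine h.congr' ?_
    filter_upwards [eventually_gt_atTop (0 : ℝ)] with t ht
    have hev : expCutoff ω =ᶠ[𝓝 t] fun t : ℝ => Complex.exp (Complex.I * ω * t) := by
      filter_upwards [lt_mem_nhds ht] with s hs
      exact expCutoff_eq_exp ω (by linarith)
    rw [hev.iteratedDeriv_eq n, iteratedDeriv_exp_mul, norm_mul, Complex.norm_exp,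
      Real.norm_of_nonneg ht.le]
    have : (Complex.I * ω * (t : ℂ)).re = -ω.im * t := by simp
    rw [this]; ring
  obtain ⟨T, hT⟩ := eventually_atTop.1 (hright.eventually (gt_mem_nhds one_pos))
  obtain ⟨M, hM⟩ := (isCompact_Icc (a := (-3 : ℝ)) (b := T)).bddAbove_image hcont.continuousOn
  refine ⟨max M 1, fun t => ?_⟩
  rcases lt_or_ge t (-3) with h | h
  · have hev : expCutoff ω =ᶠ[𝓝 t] fun _ => (0 : ℂ) := by
      filter_upwards [gt_mem_nhds h] with s hs
      exact expCutoff_eq_zero ω (by linarith)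
    rw [hev.iteratedDeriv_eq n]
    simp
  · rcases le_or_gt t T with h' | h'
    · exact (hM (mem_image_of_mem _ ⟨h, h'⟩)).trans (le_max_left _ _)
    · exact (hT t h'.le).le.trans (le_max_right _ _)

/-- For `Im ω > 0`, a Schwartz function of time which equals `e^{iωt}` near `[0, ∞)`. -/
def timeKernel (ω : ℂ) (hω : 0 < ω.im) : 𝓢(ℝ, ℂ) where
  toFun := expCutoff ω
  smooth' := contDiff_expCutoff ω
  decay' := expCutoff_decay ω hω

theorem tensor_decay (φ : 𝓢(Plane, ℂ)) (η : 𝓢(ℝ, ℂ)) (k n : ℕ) :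
    ∃ C, ∀ p : SpaceTime,
      ‖p‖ ^ k * ‖iteratedFDeriv ℝ n (fun p : SpaceTime => φ p.1 * η p.2) p‖ ≤ C := by
  let A : ℕ → ℕ → ℝ := fun k i => SchwartzMap.seminorm ℝ k i φ
  let B : ℕ → ℕ → ℝ := fun k i => SchwartzMap.seminorm ℝ k i η
  have hA : ∀ k i, 0 ≤ A k i := fun k i => apply_nonneg _ _
  have hB : ∀ k i, 0 ≤ B k i := fun k i => apply_nonneg _ _
  refine ⟨∑ i ∈ Finset.range (n + 1),
    (n.choose i : ℝ) * (A k i * B 0 (n - i) + A 0 i * B k (n - i)), fun p => ?_⟩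
  have hφ : ContDiff ℝ (⊤ : ℕ∞) fun p : SpaceTime => φ p.1 := (φ.smooth ⊤).comp contDiff_fst
  have hη : ContDiff ℝ (⊤ : ℕ∞) fun p : SpaceTime => η p.2 := (η.smooth ⊤).comp contDiff_snd
  have h1 : ∀ i, ‖iteratedFDeriv ℝ i (fun p : SpaceTime => φ p.1) p‖
      ≤ ‖iteratedFDeriv ℝ i φ p.1‖ := fun i => by
    have h := (ContinuousLinearMap.fst ℝ Plane ℝ).iteratedFDeriv_comp_right
      (φ.smooth ⊤) p (i := i) (by exact_mod_cast le_top)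
    have h' := (iteratedFDeriv ℝ i φ p.1).norm_compContinuousLinearMap_le
      (fun _ => ContinuousLinearMap.fst ℝ Plane ℝ)
    refine (le_of_eq (congrArg norm h)).trans (h'.trans ?_)
    refine mul_le_of_le_one_right (norm_nonneg _) (Finset.prod_le_one (fun _ _ => norm_nonneg _)
      fun _ _ => ContinuousLinearMap.norm_fst_le _ _ _)
  have h2 : ∀ i, ‖iteratedFDeriv ℝ i (fun p : SpaceTime => η p.2) p‖
      ≤ ‖iteratedFDeriv ℝ i η p.2‖ := fun i => by
    have h := (ContinuousLinearMap.snd ℝ Plane ℝ).iteratedFDeriv_comp_right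
      (η.smooth ⊤) p (i := i) (by exact_mod_cast le_top)
    have h' := (iteratedFDeriv ℝ i η p.2).norm_compContinuousLinearMap_le
      (fun _ => ContinuousLinearMap.snd ℝ Plane ℝ)
    refine (le_of_eq (congrArg norm h)).trans (h'.trans ?_)
    refine mul_le_of_le_one_right (norm_nonneg _) (Finset.prod_le_one (fun _ _ => norm_nonneg _)
      fun _ _ => ContinuousLinearMap.norm_snd_le _ _ _)
  have hp : ‖p‖ ^ k ≤ ‖p.1‖ ^ k + ‖p.2‖ ^ k := by
    rcases le_total ‖p.1‖ ‖p.2‖ with h | h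
    · rw [Prod.norm_def, max_eq_right h]; exact le_add_of_nonneg_left (by positivity)
    · rw [Prod.norm_def, max_eq_left h]; exact le_add_of_nonneg_right (by positivity)
  refine (mul_le_mul_of_nonneg_left (norm_iteratedFDeriv_mul_le hφ hη p
    (n := n) (by exact_mod_cast le_top)) (by positivity)).trans ?_
  rw [Finset.mul_sum]
  refine Finset.sum_le_sum fun i _ => ?_
  have a0 := SchwartzMap.le_seminorm ℝ 0 i φ p.1
  have ak := SchwartzMap.le_seminorm ℝ k i φ p.1
  have b0 := SchwartzMap.le_seminorm ℝ 0 (n - i) η p.2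
  have bk := SchwartzMap.le_seminorm ℝ k (n - i) η p.2
  rw [pow_zero, one_mul] at a0 b0
  calc ‖p‖ ^ k * ((n.choose i : ℝ) * ‖iteratedFDeriv ℝ i (fun p : SpaceTime => φ p.1) p‖ *
        ‖iteratedFDeriv ℝ (n - i) (fun p : SpaceTime => η p.2) p‖)
      ≤ (‖p.1‖ ^ k + ‖p.2‖ ^ k) * ((n.choose i : ℝ) * ‖iteratedFDeriv ℝ i φ p.1‖ *
        ‖iteratedFDeriv ℝ (n - i) η p.2‖) := by
        gcongr
        · exact h1 i
        · exact h2 (n - i)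
    _ = (n.choose i : ℝ) * ((‖p.1‖ ^ k * ‖iteratedFDeriv ℝ i φ p.1‖) *
          ‖iteratedFDeriv ℝ (n - i) η p.2‖ + ‖iteratedFDeriv ℝ i φ p.1‖ *
          (‖p.2‖ ^ k * ‖iteratedFDeriv ℝ (n - i) η p.2‖)) := by ring
    _ ≤ _ := by
        refine mul_le_mul_of_nonneg_left (add_le_add ?_ ?_) (by positivity)
        · exact mul_le_mul ak b0 (norm_nonneg _) (hA _ _)
        · exact mul_le_mul a0 bk (by positivity) (hA _ _)

/-- The tensor product `(x, t) ↦ φ(x) η(t)` of two Schwartz functions. -/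
def tensor (φ : 𝓢(Plane, ℂ)) (η : 𝓢(ℝ, ℂ)) : 𝓢(SpaceTime, ℂ) where
  toFun p := φ p.1 * η p.2
  smooth' := ((φ.smooth ⊤).comp contDiff_fst).mul ((η.smooth ⊤).comp contDiff_snd)
  decay' := tensor_decay φ η

/-- The value on `φ` of the Fourier–Laplace transform at `ω` of a tempered distribution `u`
supported in `t ≥ 0`: formally `⟨u, φ(x) e^{iωt}⟩`. (Since `u` is supported in `t ≥ 0`, the values
of the test function for `t < 0` play no role.) -/
def fourierLaplace (u : 𝓢'(SpaceTime, ℂ)) (ω : ℂ) (hω : 0 < ω.im) (φ : 𝓢(Plane, ℂ)) : ℂ :=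
  u (tensor φ (timeKernel ω hω))

/-- The Fourier–Laplace transform of `u` is the function `U ω x`, `x ∈ Q` (the slit is a null
set). -/
def HasFourierLaplaceTransform (u : 𝓢'(SpaceTime, ℂ)) (U : ℂ → Plane → ℂ) : Prop :=
  ∀ (ω : ℂ) (hω : 0 < ω.im) (φ : 𝓢(Plane, ℂ)),
    IntegrableOn (fun x => U ω x * φ x) Q volume ∧
      fourierLaplace u ω hω φ = ∫ x in Q, U ω x * φ x

/-! ### The function spaces -/

/-- `U` is a holomorphic function of `ω`, `Im ω > 0`, with values in `C²(Q)`, the latter with the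
topology of uniform convergence of the derivatives of order `≤ 2` on compact subsets of `Q`. -/
def IsHolomorphicC2 (U : ℂ → Plane → ℂ) : Prop :=
  ∀ ω : ℂ, 0 < ω.im → ContDiffOn ℝ 2 (U ω) Q ∧
    ∃ V : Plane → ℂ, ContDiffOn ℝ 2 V Q ∧
      ∀ k ≤ 2, ∀ K ⊆ Q, IsCompact K →
        TendstoUniformlyOn
          (fun z => iteratedFDeriv ℝ k (fun x => (z - ω)⁻¹ * (U z x - U ω x)))
          (iteratedFDeriv ℝ k V) (𝓝[≠] ω) K

/-- `g` is the weak derivative of `v` on `Q` in the direction `e`. -/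
def IsWeakDeriv (e : Plane) (v g : Plane → ℂ) : Prop :=
  ∀ φ : Plane → ℂ, ContDiff ℝ (⊤ : ℕ∞) φ → HasCompactSupport φ → tsupport φ ⊆ Q →
    ∫ x in Q, v x * fderiv ℝ φ x e = -∫ x in Q, g x * φ x

/-- The Sobolev space `H¹(Q)`. -/
def MemH1 (v : Plane → ℂ) : Prop :=
  MemLp v 2 (volume.restrict Q) ∧
    ∀ e ∈ ({(1, 0), (0, 1)} : Set Plane),
      ∃ g : Plane → ℂ, MemLp g 2 (volume.restrict Q) ∧ IsWeakDeriv e v g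

/-- The class `𝓜`: tempered distributions supported in `ℝ² × [0, ∞)` whose Fourier–Laplace
transform in `t` is a holomorphic function of `ω`, `Im ω > 0`, with values in `C²(Q)`, which lies
in `H¹(Q)` for every such `ω`. -/
def ClassM (u : 𝓢'(SpaceTime, ℂ)) : Prop :=
  IsVanishingOn u {p : SpaceTime | p.2 < 0} ∧
    ∃ U : ℂ → Plane → ℂ, HasFourierLaplaceTransform u U ∧ IsHolomorphicC2 U ∧
      ∀ ω : ℂ, 0 < ω.im → MemH1 (U ω)

/-! ### The mixed problem -/

/-- The D'Alembert operator `∂_t² - ∂₁² - ∂₂²` on tempered distributions. -/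
def dAlembert (u : 𝓢'(SpaceTime, ℂ)) : 𝓢'(SpaceTime, ℂ) :=
  ∂_{(((0, 0), 1) : SpaceTime)} (∂_{(((0, 0), 1) : SpaceTime)} u)
    - ∂_{(((1, 0), 0) : SpaceTime)} (∂_{(((1, 0), 0) : SpaceTime)} u)
    - ∂_{(((0, 1), 0) : SpaceTime)} (∂_{(((0, 1), 0) : SpaceTime)} u)

/-- `v` has the Dirichlet trace `g` on both sides of the half-line `x₂ = 0`, `x₁ > 0`:
`v(·, ±ε) → g` in `L²(0, ∞)` as `ε → 0+`. -/
def HasDirichletTrace (v : Plane → ℂ) (g : ℝ → ℂ) : Prop :=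
  Tendsto (fun ε : ℝ => eLpNorm (fun s => v (s, ε) - g s) 2 (volume.restrict (Ioi (0 : ℝ))))
      (𝓝[>] 0) (𝓝 0) ∧
    Tendsto (fun ε : ℝ => eLpNorm (fun s => v (s, -ε) - g s) 2 (volume.restrict (Ioi (0 : ℝ))))
      (𝓝[>] 0) (𝓝 0)

/-- `u` has the Dirichlet data `h s t` at the point `(s, 0)`, `s > 0`, of the half-line and time
`t > 0`: for every `ω` the trace of the Fourier–Laplace transform of `u` is that of `h`. -/
def HasDirichletData (u : 𝓢'(SpaceTime, ℂ)) (h : ℝ → ℝ → ℂ) : Prop :=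
  ∃ U : ℂ → Plane → ℂ, HasFourierLaplaceTransform u U ∧
    ∀ ω : ℂ, 0 < ω.im → ContDiffOn ℝ 2 (U ω) Q ∧
      HasDirichletTrace (U ω) (fun s => fourierLaplaceFun (h s) ω)

/-- The mixed problem for the scattered wave: D'Alembert equation in `Q × ℝ` (in the sense of
distributions), `u = 0` in `Q` for `t < 0`, and `u = -u_i` on the half-line for `t > 0`. -/
structure SolvesScattering (ω₀ α : ℝ) (f : ℝ → ℂ) (u : 𝓢'(SpaceTime, ℂ)) : Prop where
  wave : IsVanishingOn (dAlembert u) (Q ×ˢ univ)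
  initial : IsVanishingOn u (Q ×ˢ Iio 0)
  boundary : HasDirichletData u (fun s t => -incidentWave ω₀ α f (s, 0) t)

end

end HalfPlaneDiffraction

namespace HalfPlaneDiffraction

noncomputable section

/-! ### Schwartz functions: multiplication and superposition -/

section Multiplication

variable {D W : Type*} [NormedAddCommGroup D] [NormedSpace ℝ D] [NormedAddCommGroup W]
  [NormedSpace ℝ W]

/-! The Fourier–Laplace transform in time turns the mixed problem into a family of Dirichlet
problems for the Helmholtz equation `ΔU + ω²U = 0` in the slit plane, one for each `ω` with `Im ω >
0`. Uniqueness is proved by an energy argument for each `ω`, existence by an explicit solution of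
Sommerfeld type.

Uniqueness. The transform `v` of the difference of two solutions lies in `H¹(Q)`, solves the
Helmholtz equation and has zero trace on both sides of the slit. Testing with `conj v` times a
cut-off supported in `Q` and removing the cut-off gives `∫|∇v|² = ω² ∫|v|²`; as `ω²` is not in `[0,
∞)`, this forces `v = 0` (`eqOn_zero_of_helmholtz`). The cut-off has gradient of size `n` in a strip
of width `1/n` around the slit, edge included. The inequality `∫_strip |v|² ≤ 8ε² ∫_strip |∇v|²`
(`lintegral_slitStrip_le`), which follows from the vanishing `L²` traces, pays for this factor, so
no knowledge of the behaviour at the edge is needed. It remains to see that a distribution supported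
in `t ≥ 0` with vanishing transform is zero (`isVanishingOn_of_fourierLaplace_eq_zero`): by Fourier
inversion every relevant test function is a superposition of products `φ(x) e^{iωt}` with `Im ω =
1`, and a continuous functional vanishes on a superposition if it vanishes on the pieces.

Existence. Put `z = -(x₁ + i x₂)`, so that the slit becomes the cut of the principal root, and for
`|μ| = 1` let `N = -Re(μ² z)`, `ℓ = Re(μ √z)`, so that `N + 2ℓ² = |x|`. The function `D_μ = e^{iωN}
erfc(√(-2iω) ℓ)` solves the Helmholtz equation in `Q` (`planeLaplacian_diffracted`). With `μ² =
e^{-i(π+α)}` one has `N = n·x`, and the conjugate of `μ` belongs to the reflected wave. On the slit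
`√z` is imaginary, hence the two values of `ℓ` are opposite, and `erfc ζ + erfc(-ζ) = 2` shows that
`-(F/2)(D_μ + D_{conj μ})` has the required trace, where `F` is the transform of the profile.

The identity `e^{Aq²} erfc(√A q) = π⁻¹ ∫ e^{-Aq²v²}/(1+v²) dv` (`integral_exp_mul_cauchy`) does the
rest. It bounds `D_μ` by `3 e^{-c Im ω |x|}` with `c = cos(π+α) > 0`; together with a gradient bound
of the same kind, singular only like `|x|^{-1/2}` at the edge, this gives `H¹(Q)`. It also writes
`D_μ` as an average of the delay factors `e^{iω(|x| + 2ℓ²v²)}`, plus `2e^{iωN}` with a sign change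
where `ℓ < 0`. Hence `F · D_μ` is the transform of a bounded function of space-time vanishing for `t
< 0`, and the scattered wave is a tempered distribution. Holomorphy with values in `C²(Q)` follows
from joint smoothness and the symmetry of second derivatives. -/

theorem exists_seminorm_smulLeftCLM_le (Ψ : 𝓢(D, ℂ)) (k n : ℕ) :
    ∃ C, 0 ≤ C ∧ ∀ g : D → ℂ, g.HasTemperateGrowth → ∀ A, 0 ≤ A →
      (∀ j ≤ n, ∀ x, ‖iteratedFDeriv ℝ j g x‖ ≤ A * (1 + ‖x‖)) →
      SchwartzMap.seminorm ℂ k n (SchwartzMap.smulLeftCLM ℂ g Ψ) ≤ C * A := by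
  -- Leibniz' rule; the two seminorms come from splitting `‖x‖^k (1 + ‖x‖)`. The linear weight on
  -- the multiplier is what allows it to be of the form `h(Lx) - 1`.
  refine ⟨∑ i ∈ Finset.range (n + 1), (n.choose i : ℝ) *
    (SchwartzMap.seminorm ℂ k (n - i) Ψ + SchwartzMap.seminorm ℂ (k + 1) (n - i) Ψ),
    Finset.sum_nonneg fun i _ => by positivity, fun g hg A hA hgA => ?_⟩
  refine SchwartzMap.seminorm_le_bound ℂ k n _ (mul_nonneg
    (Finset.sum_nonneg fun i _ => by positivity) hA) fun x => ?_
  rw [SchwartzMap.smulLeftCLM_apply hg]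
  have h := norm_iteratedFDeriv_smul_le (𝕜 := ℝ) (N := (⊤ : ℕ∞)) hg.1 (Ψ.smooth ⊤) x (n := n)
    (by exact_mod_cast le_top)
  refine (mul_le_mul_of_nonneg_left h (by positivity)).trans ?_
  rw [Finset.mul_sum, Finset.sum_mul]
  refine Finset.sum_le_sum fun i hi => ?_
  have h1 := hgA i (Nat.lt_succ_iff.1 (Finset.mem_range.1 hi)) x
  have h2 := SchwartzMap.le_seminorm ℂ k (n - i) Ψ x
  have h3 := SchwartzMap.le_seminorm ℂ (k + 1) (n - i) Ψ x
  calc ‖x‖ ^ k * (n.choose i * ‖iteratedFDeriv ℝ i g x‖ * ‖iteratedFDeriv ℝ (n - i) Ψ x‖)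
      ≤ ‖x‖ ^ k * (n.choose i * (A * (1 + ‖x‖)) * ‖iteratedFDeriv ℝ (n - i) Ψ x‖) := by gcongr
    _ = n.choose i * (‖x‖ ^ k * ‖iteratedFDeriv ℝ (n - i) Ψ x‖
          + ‖x‖ ^ (k + 1) * ‖iteratedFDeriv ℝ (n - i) Ψ x‖) * A := by ring
    _ ≤ _ := by gcongr

/-- Smooth functions all of whose derivatives are bounded. -/
def BoundedDerivs (h : W → ℂ) : Prop :=
  ContDiff ℝ (⊤ : ℕ∞) h ∧ ∀ j : ℕ, ∃ A, ∀ y, ‖iteratedFDeriv ℝ j h y‖ ≤ A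

theorem BoundedDerivs.exists_uniform {h : W → ℂ} (hh : BoundedDerivs h) (n : ℕ) :
    ∃ A, 0 ≤ A ∧ ∀ j ≤ n, ∀ y, ‖iteratedFDeriv ℝ j h y‖ ≤ A := by
  choose A hA using hh.2
  refine ⟨∑ j ∈ Finset.range (n + 1), |A j|, Finset.sum_nonneg fun _ _ => abs_nonneg _,
    fun j hj y => (hA j y).trans ((le_abs_self _).trans ?_)⟩
  exact Finset.single_le_sum (f := fun j => |A j|) (fun _ _ => abs_nonneg _)
    (Finset.mem_range.2 (Nat.lt_succ_iff.2 hj))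

theorem norm_iteratedFDeriv_comp_clm_le {h : W → ℂ} (hh : ContDiff ℝ (⊤ : ℕ∞) h) (L : D →L[ℝ] W)
    (j : ℕ) (x : D) :
    ‖iteratedFDeriv ℝ j (fun x => h (L x)) x‖ ≤ ‖iteratedFDeriv ℝ j h (L x)‖ * ‖L‖ ^ j := by
  have h1 := L.iteratedFDeriv_comp_right hh x (i := j) (by exact_mod_cast le_top)
  have h2 := (iteratedFDeriv ℝ j h (L x)).norm_compContinuousLinearMap_le (fun _ => L)
  refine (le_of_eq (congrArg norm h1)).trans (h2.trans ?_)
  simp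

theorem BoundedDerivs.hasTemperateGrowth_comp {h : W → ℂ} (hh : BoundedDerivs h) (L : D →L[ℝ] W) :
    (fun x => h (L x)).HasTemperateGrowth := by
  refine ⟨hh.1.comp L.contDiff, fun n => ?_⟩
  obtain ⟨A, hA⟩ := hh.2 n
  refine ⟨0, A * ‖L‖ ^ n, fun x => ?_⟩
  rw [pow_zero, mul_one]
  exact (norm_iteratedFDeriv_comp_clm_le hh.1 L n x).trans (by gcongr; exact hA _)

/-- Each derivative of `h ∘ L` costs one factor `‖L‖`. The growth is thus polynomial in `L`, which
is harmless when integrated against a Schwartz function of the frequency. -/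
theorem BoundedDerivs.exists_seminorm_le {h : W → ℂ} (hh : BoundedDerivs h) (Ψ : 𝓢(D, ℂ))
    (k n : ℕ) : ∃ C, 0 ≤ C ∧ ∀ L : D →L[ℝ] W,
      SchwartzMap.seminorm ℂ k n (SchwartzMap.smulLeftCLM ℂ (fun x => h (L x)) Ψ)
        ≤ C * (1 + ‖L‖) ^ n := by
  obtain ⟨C, hC, hC'⟩ := exists_seminorm_smulLeftCLM_le Ψ k n
  obtain ⟨A, hA, hA'⟩ := hh.exists_uniform n
  refine ⟨C * A, mul_nonneg hC hA, fun L => ?_⟩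
  rw [mul_assoc]
  refine hC' _ (hh.hasTemperateGrowth_comp L) _ (by positivity) fun j hj x => ?_
  have h1 : ‖L‖ ^ j ≤ (1 + ‖L‖) ^ n :=
    (pow_le_pow_left₀ (norm_nonneg _) (by linarith) _).trans
      (pow_le_pow_right₀ (by linarith [norm_nonneg L]) hj)
  calc _ ≤ ‖iteratedFDeriv ℝ j h (L x)‖ * ‖L‖ ^ j := norm_iteratedFDeriv_comp_clm_le hh.1 L j x
    _ ≤ A * (1 + ‖L‖) ^ n := by gcongr; exact hA' j hj _
    _ ≤ _ := le_mul_of_one_le_right (by positivity) (by linarith [norm_nonneg x])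

/-- The undifferentiated factor `h(Lx) - 1` is at most `A ‖L‖ ‖x‖` by the mean value inequality, and
every derivative carries at least one factor `‖L‖`. This single estimate serves both for the
continuity of modulations and for the convergence of dilated cut-offs. -/
theorem BoundedDerivs.exists_seminorm_sub_le {h : W → ℂ} (hh : BoundedDerivs h) (h0 : h 0 = 1)
    (Ψ : 𝓢(D, ℂ)) (k n : ℕ) : ∃ C, 0 ≤ C ∧ ∀ L : D →L[ℝ] W, ‖L‖ ≤ 1 →
      SchwartzMap.seminorm ℂ k n (SchwartzMap.smulLeftCLM ℂ (fun x => h (L x)) Ψ - Ψ)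
        ≤ C * ‖L‖ := by
  obtain ⟨C, hC, hC'⟩ := exists_seminorm_smulLeftCLM_le Ψ k n
  obtain ⟨A, hA, hA'⟩ := hh.exists_uniform (n + 1)
  refine ⟨C * A, mul_nonneg hC hA, fun L hL => ?_⟩
  have hg := hh.hasTemperateGrowth_comp L
  have hc : (fun _ : D => (1 : ℂ)).HasTemperateGrowth := .const 1
  have hgc : (fun x => h (L x) - 1).HasTemperateGrowth := hg.sub hc
  have e : SchwartzMap.smulLeftCLM ℂ (fun x => h (L x)) Ψ - Ψ
      = SchwartzMap.smulLeftCLM ℂ (fun x => h (L x) - 1) Ψ := by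
    ext x
    rw [sub_apply, SchwartzMap.smulLeftCLM_apply_apply hg,
      SchwartzMap.smulLeftCLM_apply_apply hgc, sub_smul, one_smul]
  rw [e, mul_assoc]
  refine hC' _ hgc _ (by positivity) fun j hj x => ?_
  rcases Nat.eq_zero_or_pos j with rfl | hj0
  · rw [norm_iteratedFDeriv_zero]
    have hd : ∀ y ∈ (univ : Set W), DifferentiableAt ℝ h y := fun y _ =>
      (hh.1.differentiable (by simp)).differentiableAt
    have hb : ∀ y ∈ (univ : Set W), ‖fderiv ℝ h y‖ ≤ A := fun y _ => by
      rw [← norm_iteratedFDeriv_one]; exact hA' 1 (by omega) y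
    have := convex_univ.norm_image_sub_le_of_norm_fderiv_le hd hb (mem_univ 0) (mem_univ (L x))
    rw [h0, sub_zero] at this
    calc _ ≤ A * ‖L x‖ := this
      _ ≤ A * (‖L‖ * ‖x‖) := by gcongr; exact L.le_opNorm x
      _ ≤ A * ‖L‖ * (1 + ‖x‖) := by nlinarith [mul_nonneg hA (norm_nonneg L)]
  · have e1 : iteratedFDeriv ℝ j (fun x => h (L x) - 1) x
        = iteratedFDeriv ℝ j (fun x => h (L x)) x := by
      have := iteratedFDeriv_sub_apply (𝕜 := ℝ) (i := j) (x := x) (f := fun x => h (L x))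
        (g := fun _ => (1 : ℂ)) ((hg.1.of_le (by exact_mod_cast le_top)).contDiffAt)
        contDiff_const.contDiffAt
      rw [iteratedFDeriv_const_of_ne hj0.ne', Pi.zero_apply, sub_zero] at this
      exact this
    rw [e1]
    calc _ ≤ ‖iteratedFDeriv ℝ j h (L x)‖ * ‖L‖ ^ j := norm_iteratedFDeriv_comp_clm_le hh.1 L j x
      _ ≤ A * ‖L‖ := by
        gcongr
        · exact hA' j (by omega) _
        · exact pow_le_of_le_one (norm_nonneg _) hL hj0.ne'
      _ ≤ _ := le_mul_of_one_le_right (by positivity) (by linarith [norm_nonneg x])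

end Multiplication

/-! ### Schwartz seminorms as norms in Banach spaces of bounded continuous forms. -/

section WeightedDeriv

variable {D : Type*} [NormedAddCommGroup D] [NormedSpace ℝ D]

/-- The Banach space of bounded continuous functions with values in `n`-linear forms. -/
def FormSpace (D : Type*) [NormedAddCommGroup D] [NormedSpace ℝ D] (n : ℕ) : Type _ :=
  BoundedContinuousFunction D (D [×n]→L[ℝ] ℂ)

instance (n : ℕ) : NormedAddCommGroup (FormSpace D n) :=
  inferInstanceAs (NormedAddCommGroup (BoundedContinuousFunction D (D [×n]→L[ℝ] ℂ)))

instance (n : ℕ) : NormedSpace ℂ (FormSpace D n) :=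
  inferInstanceAs (NormedSpace ℂ (BoundedContinuousFunction D (D [×n]→L[ℝ] ℂ)))

instance (n : ℕ) : CompleteSpace (FormSpace D n) :=
  inferInstanceAs (CompleteSpace (BoundedContinuousFunction D (D [×n]→L[ℝ] ℂ)))

/-- Evaluation at a point on `FormSpace`. -/
def FormSpace.evalCLM (n : ℕ) (x : D) : FormSpace D n →L[ℂ] (D [×n]→L[ℝ] ℂ) :=
  BoundedContinuousFunction.evalCLM (β := D [×n]→L[ℝ] ℂ) ℂ x

theorem FormSpace.ext {n : ℕ} {F G : FormSpace D n}
    (h : ∀ x, FormSpace.evalCLM n x F = FormSpace.evalCLM n x G) : F = G :=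
  DFunLike.ext (F := BoundedContinuousFunction D (D [×n]→L[ℝ] ℂ)) _ _ h

theorem FormSpace.norm_evalCLM_le {n : ℕ} (F : FormSpace D n) (x : D) :
    ‖FormSpace.evalCLM n x F‖ ≤ ‖F‖ :=
  BoundedContinuousFunction.norm_coe_le_norm (β := D [×n]→L[ℝ] ℂ) F x

/-- The bounded continuous function `x ↦ ‖x‖ ^ k • D^n Φ(x)` attached to a Schwartz function. -/
def weightedDeriv (k n : ℕ) (Φ : 𝓢(D, ℂ)) : FormSpace D n :=
  BoundedContinuousFunction.ofNormedAddCommGroup (fun x => ‖x‖ ^ k • iteratedFDeriv ℝ n Φ x)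
    ((continuous_norm.pow k).smul
      ((Φ.smooth ⊤).continuous_iteratedFDeriv (m := n) (by exact_mod_cast le_top)))
    (SchwartzMap.seminorm ℂ k n Φ) fun x => by
      rw [norm_smul, norm_pow, norm_norm]
      exact SchwartzMap.le_seminorm ℂ k n Φ x

theorem norm_weightedDeriv_le (k n : ℕ) (Φ : 𝓢(D, ℂ)) :
    ‖weightedDeriv k n Φ‖ ≤ SchwartzMap.seminorm ℂ k n Φ :=
  BoundedContinuousFunction.norm_ofNormedAddCommGroup_le (β := D [×n]→L[ℝ] ℂ) _
    (apply_nonneg _ _) _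

/-- `weightedDeriv` as a continuous linear map. -/
def weightedDerivCLM (k n : ℕ) : 𝓢(D, ℂ) →L[ℂ] FormSpace D n :=
  SchwartzMap.mkCLMtoNormedSpace (σ := RingHom.id ℂ) (weightedDeriv k n)
    (fun f g => FormSpace.ext fun x => by
      rw [map_add]
      change ‖x‖ ^ k • iteratedFDeriv ℝ n (⇑f + ⇑g) x
        = ‖x‖ ^ k • iteratedFDeriv ℝ n f x + ‖x‖ ^ k • iteratedFDeriv ℝ n g x
      rw [iteratedFDeriv_add_apply (f.contDiffAt n) (g.contDiffAt n), smul_add])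
    (fun a f => FormSpace.ext fun x => by
      rw [map_smul]
      change ‖x‖ ^ k • iteratedFDeriv ℝ n (a • ⇑f) x = a • ‖x‖ ^ k • iteratedFDeriv ℝ n f x
      rw [iteratedFDeriv_const_smul_apply (f.contDiffAt n), smul_comm])
    ⟨{(k, n)}, 1, zero_le_one, fun f => by
      rw [Finset.sup_singleton, one_mul]; exact norm_weightedDeriv_le k n f⟩

theorem norm_weightedDerivCLM_le (k n : ℕ) (Φ : 𝓢(D, ℂ)) :
    ‖weightedDerivCLM k n Φ‖ ≤ SchwartzMap.seminorm ℂ k n Φ := norm_weightedDeriv_le k n Φ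

theorem seminorm_le_norm_weightedDerivCLM (k n : ℕ) (Φ : 𝓢(D, ℂ)) :
    SchwartzMap.seminorm ℂ k n Φ ≤ ‖weightedDerivCLM k n Φ‖ := by
  refine SchwartzMap.seminorm_le_bound ℂ k n Φ (norm_nonneg _) fun x => ?_
  refine le_trans (le_of_eq ?_) (FormSpace.norm_evalCLM_le (weightedDerivCLM k n Φ) x)
  change _ = ‖‖x‖ ^ k • iteratedFDeriv ℝ n Φ x‖
  rw [norm_smul, norm_pow, norm_norm]

end WeightedDeriv

/-! ### Superpositions of Schwartz functions and continuous functionals. -/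

section Superposition

variable {D P : Type*} [NormedAddCommGroup D] [NormedSpace ℝ D] [TopologicalSpace P]
  {H : P → 𝓢(D, ℂ)}

theorem continuous_iteratedFDeriv_of_continuous (hc : Continuous H) (n : ℕ) (x : D) :
    Continuous fun ξ => iteratedFDeriv ℝ n (H ξ) x := by
  rw [continuous_iff_continuousAt]
  intro ξ₀
  have h1 : Tendsto (fun ξ => SchwartzMap.seminorm ℂ 0 n (H ξ - H ξ₀)) (𝓝 ξ₀) (𝓝 0) := by
    have hs := (schwartz_withSeminorms ℂ D ℂ).continuous_seminorm (0, n)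
    have := (hs.comp (hc.sub (continuous_const (y := H ξ₀)))).tendsto ξ₀
    simp only [Function.comp_def, Pi.sub_apply, sub_self, map_zero] at this
    exact this
  rw [ContinuousAt, tendsto_iff_norm_sub_tendsto_zero]
  refine squeeze_zero (fun _ => norm_nonneg _) (fun ξ => ?_) h1
  have := SchwartzMap.norm_iteratedFDeriv_le_seminorm ℂ (H ξ - H ξ₀) n x
  have e : iteratedFDeriv ℝ n (⇑(H ξ - H ξ₀)) x
      = iteratedFDeriv ℝ n (H ξ) x - iteratedFDeriv ℝ n (H ξ₀) x := by
    have e0 : ⇑(H ξ - H ξ₀) = ⇑(H ξ) - ⇑(H ξ₀) := by ext; simp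
    rw [e0]
    exact iteratedFDeriv_sub_apply ((H ξ).contDiffAt n) ((H ξ₀).contDiffAt n)
  rwa [e] at this

variable [MeasurableSpace P] [OpensMeasurableSpace P] [SecondCountableTopology P] {μ : Measure P}

/-- Differentiation under the integral sign, by induction on the order: the seminorm of order `n +
1` of the integrand is a majorant independent of `x`. -/
theorem iteratedFDeriv_integral_schwartz (hc : Continuous H)
    (hb : ∀ n, Integrable (fun ξ => SchwartzMap.seminorm ℂ 0 n (H ξ)) μ) (n : ℕ) :
    iteratedFDeriv ℝ n (fun x => ∫ ξ, H ξ x ∂μ) = fun x => ∫ ξ, iteratedFDeriv ℝ n (H ξ) x ∂μ := by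
  have hint : ∀ n x, Integrable (fun ξ => iteratedFDeriv ℝ n (H ξ) x) μ := fun n x =>
    (hb n).mono' (continuous_iteratedFDeriv_of_continuous hc n x).aestronglyMeasurable
      (.of_forall fun ξ => SchwartzMap.norm_iteratedFDeriv_le_seminorm ℂ (H ξ) n x)
  induction n with
  | zero =>
    ext x m
    rw [iteratedFDeriv_zero_apply]
    have := ContinuousMultilinearMap.integral_apply (hint 0 x) m
    rw [this]
    simp
  | succ n ih =>
    funext x
    rw [iteratedFDeriv_succ_eq_comp_left, ih]
    let e := continuousMultilinearCurryLeftEquiv ℝ (fun _ : Fin (n + 1) => D) ℂ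
    have hfd : ∀ ξ x, e (iteratedFDeriv ℝ (n + 1) (H ξ) x)
        = fderiv ℝ (iteratedFDeriv ℝ n (H ξ)) x := fun ξ x => by
      rw [iteratedFDeriv_succ_eq_comp_left]; exact e.apply_symm_apply _
    have hmeas : AEStronglyMeasurable (fun ξ => fderiv ℝ (iteratedFDeriv ℝ n (H ξ)) x) μ := by
      simp_rw [← hfd]
      exact (e.continuous.comp
        (continuous_iteratedFDeriv_of_continuous hc (n + 1) x)).aestronglyMeasurable
    have hder := hasFDerivAt_integral_of_dominated_of_fderiv_le (𝕜 := ℝ) (μ := μ) (x₀ := x)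
      (s := univ) (F := fun x ξ => iteratedFDeriv ℝ n (H ξ) x)
      (F' := fun x ξ => fderiv ℝ (iteratedFDeriv ℝ n (H ξ)) x)
      (bound := fun ξ => SchwartzMap.seminorm ℂ 0 (n + 1) (H ξ)) univ_mem
      (.of_forall fun y => (hint n y).aestronglyMeasurable) (hint n x) hmeas
      (.of_forall fun ξ y _ => by
        rw [← hfd, e.norm_map]
        exact SchwartzMap.norm_iteratedFDeriv_le_seminorm ℂ (H ξ) (n + 1) y)
      (hb (n + 1))
      (.of_forall fun ξ y _ =>
        ((((H ξ).smooth ⊤).differentiable_iteratedFDeriv (m := n)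
          (by exact_mod_cast WithTop.coe_lt_top _)) y).hasFDerivAt)
    rw [Function.comp_apply, hder.fderiv]
    have := ContinuousLinearEquiv.integral_comp_comm (𝕜 := ℝ) (μ := μ)
      e.symm.toContinuousLinearEquiv (fun ξ => fderiv ℝ (iteratedFDeriv ℝ n (H ξ)) x)
    refine Eq.trans this.symm (integral_congr_ae (.of_forall fun ξ => ?_))
    change e.symm (fderiv ℝ (iteratedFDeriv ℝ n (H ξ)) x) = _
    rw [← hfd]; exact e.symm_apply_apply _

/-- Schwartz space is not a Banach space, so the integral is formed in the finite product of Banach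
spaces `E i` whose norms dominate `v`. There it lies in the closed span of the integrand, on which
`v` is small by approximation. -/
theorem apply_eq_zero_of_integral_eq {S : Type*} [AddCommGroup S] [Module ℂ S] {κ : Type*}
    [Fintype κ] {E : κ → Type*} [∀ i, NormedAddCommGroup (E i)] [∀ i, NormedSpace ℂ (E i)]
    [∀ i, CompleteSpace (E i)] {P : Type*} [MeasurableSpace P] {μ : Measure P} {H : P → S}
    (v : S →ₗ[ℂ] ℂ) (J : ∀ i, S →ₗ[ℂ] E i) {C : ℝ}
    (hv : ∀ Φ B, 0 ≤ B → (∀ i, ‖J i Φ‖ ≤ B) → ‖v Φ‖ ≤ C * B)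
    (hint : ∀ i, Integrable (fun ξ => J i (H ξ)) μ) (Ψ : S)
    (hΨ : ∀ i, J i Ψ = ∫ ξ, J i (H ξ) ∂μ) (hH : ∀ ξ, v (H ξ) = 0) : v Ψ = 0 := by
  let ι : S →ₗ[ℂ] (∀ i, E i) := LinearMap.pi J
  have hI : Integrable (fun ξ => ι (H ξ)) μ := Integrable.of_eval hint
  have hE : ι Ψ = ∫ ξ, ι (H ξ) ∂μ := by
    funext i
    exact (hΨ i).trans (eval_integral hint i).symm
  let M : Submodule ℂ (∀ i, E i) := (Submodule.span ℂ (range H)).map ι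
  have hmem : ι Ψ ∈ M.topologicalClosure := by
    have : IsClosed (M.topologicalClosure : Set (∀ i, E i)) := M.isClosed_topologicalClosure
    -- The quotient map by the closed span kills the integrand, hence also its integral.
    have hz : ∀ ξ, M.topologicalClosure.mkQL (ι (H ξ)) = 0 := fun ξ => by
      change M.topologicalClosure.mkQ (ι (H ξ)) = 0
      rw [Submodule.mkQ_apply, Submodule.Quotient.mk_eq_zero]
      exact M.le_topologicalClosure
        (Submodule.mem_map_of_mem (Submodule.subset_span (mem_range_self ξ)))
    have h3 := M.topologicalClosure.mkQL.integral_comp_comm hI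
    simp only [hz, integral_zero, ← hE] at h3
    exact (Submodule.Quotient.mk_eq_zero _).1 h3.symm
  have hspan : ∀ Φ ∈ Submodule.span ℂ (range H), v Φ = 0 := fun Φ hΦ => by
    induction hΦ using Submodule.span_induction with
    | mem x hx => obtain ⟨ξ, rfl⟩ := hx; exact hH ξ
    | zero => exact map_zero v
    | add x y _ _ hx hy => rw [map_add, hx, hy, add_zero]
    | smul a x _ hx => rw [map_smul, hx, smul_zero]
  rw [← norm_le_zero_iff]
  refine le_of_forall_pos_le_add fun ε hε => ?_
  -- `|C| + 1` rather than `C`, which may be zero or negative.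
  obtain ⟨-, ⟨Φ, hΦ, rfl⟩, hd⟩ := Metric.mem_closure_iff.1 hmem (ε / (|C| + 1)) (by positivity)
  have h4 := hv (Ψ - Φ) (ε / (|C| + 1)) (by positivity) fun i => by
    rw [map_sub, ← dist_eq_norm]
    exact (dist_le_pi_dist (ι Ψ) (ι Φ) i).trans hd.le
  rw [map_sub, hspan Φ hΦ, sub_zero] at h4
  refine h4.trans ?_
  rw [zero_add]
  calc C * (ε / (|C| + 1)) ≤ (|C| + 1) * (ε / (|C| + 1)) := by
        gcongr
        linarith [le_abs_self C]
    _ = ε := by field_simp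

/-- A continuous linear functional on Schwartz space which vanishes on a continuous family of
Schwartz functions vanishes on absolutely convergent superpositions of that family. -/
theorem apply_eq_zero_of_superposition (v : 𝓢(D, ℂ) →ₗ[ℂ] ℂ) (hvc : Continuous v)
    (hc : Continuous H)
    (hb : ∀ k n, Integrable (fun ξ => SchwartzMap.seminorm ℂ k n (H ξ)) μ) (Ψ : 𝓢(D, ℂ))
    (hΨ : ∀ x, Ψ x = ∫ ξ, H ξ x ∂μ) (hv : ∀ ξ, v (H ξ) = 0) : v Ψ = 0 := by
  obtain ⟨s, C, -, hC⟩ := Seminorm.bound_of_continuous (schwartz_withSeminorms ℂ D ℂ)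
    ((normSeminorm ℂ ℂ).comp v) (continuous_norm.comp hvc)
  have hint : ∀ i : s, Integrable (fun ξ => weightedDerivCLM i.1.1 i.1.2 (H ξ)) μ := fun i =>
    (hb i.1.1 i.1.2).mono'
      ((weightedDerivCLM i.1.1 i.1.2).continuous.comp hc).aestronglyMeasurable
      (.of_forall fun ξ => norm_weightedDerivCLM_le _ _ _)
  refine apply_eq_zero_of_integral_eq (κ := s) (C := C) v
    (fun i => (weightedDerivCLM (D := D) i.1.1 i.1.2).toLinearMap) (fun Φ B hB hΦ => ?_)
    hint Ψ (fun i => ?_) hv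
  · refine (hC Φ).trans ?_
    change (C : ℝ) * _ ≤ _
    gcongr
    refine Seminorm.finset_sup_apply_le hB fun i hi => ?_
    exact (seminorm_le_norm_weightedDerivCLM i.1 i.2 Φ).trans (hΦ ⟨i, hi⟩)
  · refine FormSpace.ext fun x => ?_
    have h2 := (FormSpace.evalCLM i.1.2 x).integral_comp_comm (hint i)
    refine Eq.trans ?_ h2
    change ‖x‖ ^ i.1.1 • iteratedFDeriv ℝ i.1.2 Ψ x
      = ∫ ξ, ‖x‖ ^ i.1.1 • iteratedFDeriv ℝ i.1.2 (H ξ) x ∂μ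
    rw [integral_smul, ← congrFun (iteratedFDeriv_integral_schwartz hc (hb 0) i.1.2) x,
      ← show ⇑Ψ = fun x => ∫ ξ, H ξ x ∂μ from funext hΨ]

end Superposition

/-! ### Injectivity of the Fourier–Laplace transform -/

theorem SchwartzMap.boundedDerivs {W : Type*} [NormedAddCommGroup W] [NormedSpace ℝ W]
    (h : 𝓢(W, ℂ)) : BoundedDerivs h :=
  ⟨h.smooth ⊤, fun j => ⟨_, fun y => SchwartzMap.norm_iteratedFDeriv_le_seminorm ℂ h j y⟩⟩

theorem boundedDerivs_exp : BoundedDerivs fun t : ℝ => Complex.exp (Complex.I * t) := by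
  have h := iteratedDeriv_exp_mul 1
  simp only [mul_one] at h
  refine ⟨((contDiff_const (c := Complex.I)).mul Complex.ofRealCLM.contDiff).cexp,
    fun j => ⟨1, fun y => ?_⟩⟩
  rw [norm_iteratedFDeriv_eq_norm_iteratedDeriv, h j, norm_mul, norm_pow, Complex.norm_I, one_pow,
    mul_comm Complex.I, Complex.norm_exp_ofReal_mul_I, one_mul]

/-! ### Modulation by real frequencies and truncation of Schwartz functions. -/

section Modulation

variable {D : Type*} [NormedAddCommGroup D] [NormedSpace ℝ D]

/-- The Schwartz function `x ↦ e^{i Λ x} Ψ(x)`. -/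
def modulate (Ψ : 𝓢(D, ℂ)) (Λ : D →L[ℝ] ℝ) : 𝓢(D, ℂ) :=
  SchwartzMap.smulLeftCLM ℂ (fun x => Complex.exp (Complex.I * (Λ x : ℝ))) Ψ

theorem modulate_apply (Ψ : 𝓢(D, ℂ)) (Λ : D →L[ℝ] ℝ) (x : D) :
    modulate Ψ Λ x = Complex.exp (Complex.I * (Λ x : ℝ)) * Ψ x := by
  rw [modulate, SchwartzMap.smulLeftCLM_apply_apply (boundedDerivs_exp.hasTemperateGrowth_comp Λ),
    smul_eq_mul]

theorem modulate_modulate (Ψ : 𝓢(D, ℂ)) (Λ Λ' : D →L[ℝ] ℝ) :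
    modulate (modulate Ψ Λ) Λ' = modulate Ψ (Λ + Λ') := by
  ext x
  simp only [modulate_apply, add_apply, Complex.ofReal_add]
  rw [← mul_assoc, ← Complex.exp_add]
  ring_nf

theorem continuous_modulate (Ψ : 𝓢(D, ℂ)) : Continuous (modulate Ψ) := by
  rw [continuous_iff_continuousAt]
  intro Λ₀
  rw [ContinuousAt, (schwartz_withSeminorms ℂ D ℂ).tendsto_nhds _ _]
  rintro ⟨k, n⟩ ε hε
  obtain ⟨C, hC, hC'⟩ := boundedDerivs_exp.exists_seminorm_sub_le (by simp) (modulate Ψ Λ₀) k n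
  have h1 : Tendsto (fun Λ : D →L[ℝ] ℝ => C * ‖Λ - Λ₀‖) (𝓝 Λ₀) (𝓝 0) := by
    have : Continuous fun Λ : D →L[ℝ] ℝ => C * ‖Λ - Λ₀‖ := by fun_prop
    simpa using this.tendsto Λ₀
  filter_upwards [h1.eventually (gt_mem_nhds hε), Metric.closedBall_mem_nhds Λ₀ one_pos]
    with Λ h2 h3
  have h4 := hC' (Λ - Λ₀) (by rwa [Metric.mem_closedBall, dist_eq_norm] at h3)
  -- Modulations form a group, so continuity at `Λ₀` reduces to continuity at `0` for the modulated
  -- function.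
  have e : modulate Ψ Λ = modulate (modulate Ψ Λ₀) (Λ - Λ₀) := by
    rw [modulate_modulate, add_sub_cancel]
  rw [e]
  exact h4.trans_lt h2

/-- Compactly supported Schwartz functions approximate a Schwartz function inside its support. -/
theorem apply_eq_zero_of_compactSupport [FiniteDimensional ℝ D] (v : 𝓢(D, ℂ) →ₗ[ℂ] ℂ)
    (hvc : Continuous v) (Ψ : 𝓢(D, ℂ))
    (h : ∀ Φ : 𝓢(D, ℂ), HasCompactSupport Φ → tsupport Φ ⊆ tsupport Ψ → v Φ = 0) : v Ψ = 0 := by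
  let b : ContDiffBump (0 : D) := ⟨1, 2, one_pos, one_lt_two⟩
  have hbs : ContDiff ℝ (⊤ : ℕ∞) fun x => (b x : ℂ) :=
    Complex.ofRealCLM.contDiff.comp b.contDiff
  have hbc : HasCompactSupport fun x => (b x : ℂ) :=
    b.hasCompactSupport.comp_left (g := fun t : ℝ => (t : ℂ)) Complex.ofReal_zero
  have hB : BoundedDerivs fun x => (b x : ℂ) :=
    SchwartzMap.boundedDerivs (hbc.toSchwartzMap hbs)
  have hb0 : (fun x => (b x : ℂ)) 0 = 1 := by
    simp [b.one_of_mem_closedBall (Metric.mem_closedBall_self b.rIn_pos.le)]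
  let L : ℝ → D →L[ℝ] D := fun δ => δ • ContinuousLinearMap.id ℝ D
  -- The bump stretched by `1/δ` has value `1` at the origin, and its argument map has norm of order
  -- `δ`.
  have hL : Tendsto (fun δ => SchwartzMap.smulLeftCLM ℂ (fun x => (b (L δ x) : ℂ)) Ψ)
      (𝓝[>] 0) (𝓝 Ψ) := by
    rw [(schwartz_withSeminorms ℂ D ℂ).tendsto_nhds _ _]
    rintro ⟨k, n⟩ ε hε
    obtain ⟨C, hC, hC'⟩ := hB.exists_seminorm_sub_le hb0 Ψ k n
    have h1 : Tendsto (fun δ => ‖L δ‖) (𝓝[>] 0) (𝓝 0) := by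
      have : Continuous fun δ => ‖L δ‖ := by fun_prop
      simpa [L] using (this.tendsto 0).mono_left nhdsWithin_le_nhds
    have h2 : Tendsto (fun δ => C * ‖L δ‖) (𝓝[>] 0) (𝓝 0) := by simpa using h1.const_mul C
    filter_upwards [h1.eventually (gt_mem_nhds one_pos), h2.eventually (gt_mem_nhds hε)]
      with δ h3 h4
    exact (hC' (L δ) h3.le).trans_lt h4
  have hz : ∀ᶠ δ in 𝓝[>] (0 : ℝ),
      v (SchwartzMap.smulLeftCLM ℂ (fun x => (b (L δ x) : ℂ)) Ψ) = 0 := by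
    filter_upwards [self_mem_nhdsWithin] with δ hδ
    have hg := hB.hasTemperateGrowth_comp (L δ)
    refine h _ ?_ ?_
    · rw [SchwartzMap.smulLeftCLM_apply hg]
      refine HasCompactSupport.smul_right (f := fun x => (b (L δ x) : ℂ)) ?_
      exact hbc.comp_homeomorph (Homeomorph.smulOfNeZero δ (ne_of_gt hδ))
    · rw [SchwartzMap.smulLeftCLM_apply hg]
      exact tsupport_smul_subset_right _ _
  exact tendsto_nhds_unique ((hvc.tendsto Ψ).comp hL)
    (tendsto_const_nhds.congr' (hz.mono fun δ h => h.symm))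

end Modulation

theorem exists_cutoff {E : Type*} [NormedAddCommGroup E] [NormedSpace ℝ E] [FiniteDimensional ℝ E]
    {K O : Set E} (hK : IsCompact K) (hO : IsOpen O) (hKO : K ⊆ O) :
    ∃ κ : 𝓢(E, ℂ), HasCompactSupport κ ∧ tsupport κ ⊆ O ∧ ∀ x ∈ K, κ x = 1 := by
  obtain ⟨K', hK', h1, h2⟩ := exists_compact_between hK hO hKO
  obtain ⟨g, hg0, hg1, -⟩ := exists_contMDiffMap_zero_one_of_isClosed (modelWithCornersSelf ℝ E)
    (s := (interior K')ᶜ) (t := K) isOpen_interior.isClosed_compl hK.isClosed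
    (disjoint_compl_left_iff_subset.2 h1)
  have hs : ContDiff ℝ (⊤ : ℕ∞) fun x => (g x : ℂ) :=
    Complex.ofRealCLM.contDiff.comp g.contMDiff.contDiff
  have ht : tsupport (fun x => (g x : ℂ)) ⊆ K' := by
    refine closure_minimal (fun x hx => ?_) hK'.isClosed
    by_contra hx'
    exact hx (by simp [hg0 (x := x) (fun h => hx' (interior_subset h))])
  have hc : HasCompactSupport fun x => (g x : ℂ) := hK'.of_isClosed_subset (isClosed_tsupport _) ht
  exact ⟨hc.toSchwartzMap hs, hc, ht.trans h2, fun x hx => by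
    simp [HasCompactSupport.toSchwartzMap_toFun, hg1 hx]⟩

/-- Space-time as a Euclidean space. -/
def euclideanEquiv : SpaceTime ≃L[ℝ] EuclideanSpace ℝ (Fin 3) :=
  LinearEquiv.toContinuousLinearEquiv
    { toFun := fun p => !₂[p.1.1, p.1.2, p.2]
      invFun := fun y => ((y 0, y 1), y 2)
      map_add' := fun p q => by ext i; fin_cases i <;> simp
      map_smul' := fun c p => by ext i; fin_cases i <;> simp
      left_inv := fun p => by simp
      right_inv := fun y => by ext i; fin_cases i <;> simp }

theorem euclideanEquiv_apply (p : SpaceTime) : euclideanEquiv p = !₂[p.1.1, p.1.2, p.2] := rfl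

/-- The linear form `p ↦ 2π ⟨ξ, p⟩` on space-time. -/
def frequencyForm : EuclideanSpace ℝ (Fin 3) →L[ℝ] (SpaceTime →L[ℝ] ℝ) :=
  (2 * Real.pi) •
    ((ContinuousLinearMap.compL ℝ SpaceTime (EuclideanSpace ℝ (Fin 3)) ℝ).flip
      (euclideanEquiv : SpaceTime →L[ℝ] EuclideanSpace ℝ (Fin 3))).comp (innerSL ℝ)

theorem frequencyForm_apply (ξ : EuclideanSpace ℝ (Fin 3)) (p : SpaceTime) :
    frequencyForm ξ p = 2 * Real.pi * inner ℝ ξ (euclideanEquiv p) := rfl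

theorem frequencyForm_eq (ξ : EuclideanSpace ℝ (Fin 3)) (p : SpaceTime) :
    frequencyForm ξ p = 2 * Real.pi * (ξ 0 * p.1.1 + ξ 1 * p.1.2) + 2 * Real.pi * ξ 2 * p.2 := by
  rw [frequencyForm_apply, euclideanEquiv_apply, PiLp.inner_apply, Fin.sum_univ_three]
  simp
  ring

/-- A real modulation in time shifts `ω` by a real number and so keeps it in the upper half-plane.
Modulated products are therefore again test functions on which the Fourier–Laplace transform is
evaluated. -/
theorem modulate_tensor (κ : 𝓢(Plane, ℂ)) (ω : ℂ) (hω : 0 < ω.im) (Λ : Plane →L[ℝ] ℝ) (τ : ℝ)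
    (Λ' : SpaceTime →L[ℝ] ℝ) (hΛ : ∀ p, Λ' p = Λ p.1 + τ * p.2) (hω' : 0 < (ω + τ).im) :
    modulate (tensor κ (timeKernel ω hω)) Λ' = tensor (modulate κ Λ) (timeKernel (ω + τ) hω') := by
  ext p
  rw [modulate_apply]
  change _ * (κ p.1 * expCutoff ω p.2) = modulate κ Λ p.1 * expCutoff (ω + τ) p.2
  rw [modulate_apply, hΛ, expCutoff, expCutoff]
  have : Complex.exp (Complex.I * ((Λ p.1 + τ * p.2 : ℝ) : ℂ)) * Complex.exp (Complex.I * ω * p.2)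
      = Complex.exp (Complex.I * (Λ p.1 : ℝ)) * Complex.exp (Complex.I * (ω + τ) * p.2) := by
    rw [← Complex.exp_add, ← Complex.exp_add]
    push_cast
    ring_nf
  linear_combination (κ p.1 * (Real.smoothTransition (p.2 + 2) : ℂ)) * this

theorem tsupport_modulate_subset {D : Type*} [NormedAddCommGroup D] [NormedSpace ℝ D]
    (Ψ : 𝓢(D, ℂ)) (Λ : D →L[ℝ] ℝ) : tsupport (modulate Ψ Λ) ⊆ tsupport Ψ :=
  SchwartzMap.tsupport_smulLeftCLM_subset _ _ |>.trans inter_subset_left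

theorem integrable_seminorm_modulate (Θ : 𝓢(EuclideanSpace ℝ (Fin 3), ℂ)) (m : 𝓢(SpaceTime, ℂ))
    (k n : ℕ) :
    Integrable fun ξ => SchwartzMap.seminorm ℂ k n (Θ ξ • modulate m (frequencyForm ξ)) := by
  obtain ⟨C, hC, hC'⟩ := boundedDerivs_exp.exists_seminorm_le m k n
  have hcont : Continuous fun ξ =>
      SchwartzMap.seminorm ℂ k n (Θ ξ • modulate m (frequencyForm ξ)) :=
    ((schwartz_withSeminorms ℂ SpaceTime ℂ).continuous_seminorm (k, n)).comp
      (Θ.continuous.smul ((continuous_modulate m).comp frequencyForm.continuous))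
  have h1 := (Θ.integrable_pow_mul volume 0).const_mul (C * 2 ^ (n - 1))
  have h2 := (Θ.integrable_pow_mul volume n).const_mul (C * 2 ^ (n - 1) * ‖frequencyForm‖ ^ n)
  refine (h1.add h2).mono' hcont.aestronglyMeasurable (.of_forall fun ξ => ?_)
  rw [Real.norm_of_nonneg (apply_nonneg _ _), map_smul_eq_mul]
  have h3 := hC' (frequencyForm ξ)
  have h4 : (1 + ‖frequencyForm ξ‖) ^ n ≤ 2 ^ (n - 1) * (1 + ‖frequencyForm‖ ^ n * ‖ξ‖ ^ n) :=
    (add_pow_le zero_le_one (norm_nonneg _) n).trans (by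
      rw [one_pow, ← mul_pow]
      gcongr
      exact frequencyForm.le_opNorm ξ)
  calc ‖Θ ξ‖ * SchwartzMap.seminorm ℂ k n (modulate m (frequencyForm ξ))
      ≤ ‖Θ ξ‖ * (C * (2 ^ (n - 1) * (1 + ‖frequencyForm‖ ^ n * ‖ξ‖ ^ n))) := by
        gcongr
        exact h3.trans (by gcongr)
    _ = _ := by simp only [Pi.add_apply, pow_zero]; ring

open FourierTransform in
-- Fourier inversion, carried over from Euclidean space because the product norm on space-time is
-- not an inner product norm.
theorem exists_fourier_representation (Ψ : 𝓢(SpaceTime, ℂ)) :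
    ∃ Θ : 𝓢(EuclideanSpace ℝ (Fin 3), ℂ), ∀ p,
      Ψ p = ∫ ξ, Complex.exp (Complex.I * (frequencyForm ξ p : ℝ)) * Θ ξ := by
  let Θ : 𝓢(EuclideanSpace ℝ (Fin 3), ℂ) :=
    SchwartzMap.compCLMOfContinuousLinearEquiv ℂ euclideanEquiv.symm Ψ
  refine ⟨𝓕 Θ, fun p => ?_⟩
  have h1 : 𝓕⁻ (𝓕 Θ) = Θ := FourierTransform.fourierInv_fourier_eq Θ
  have h3 : Θ (euclideanEquiv p) = Ψ p := by
    change Ψ (euclideanEquiv.symm (euclideanEquiv p)) = _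
    rw [ContinuousLinearEquiv.symm_apply_apply]
  rw [← h3, ← h1, SchwartzMap.fourierInv_coe, Real.fourierInv_eq', h1]
  refine integral_congr_ae (.of_forall fun ξ => ?_)
  dsimp only
  rw [frequencyForm_apply, mul_comm Complex.I, smul_eq_mul]

/-- Write `Ψ = (κ(x) e^{-t}) · (e^{t} Ψ)`, where `κ = 1` on the projection of the support, and
expand the second factor by Fourier inversion. This presents `Ψ` as a superposition of products
`φ(x) e^{iωt}` on the line `Im ω = 1`. The cut-off in `timeKernel` is invisible because it equals
`1` for `t ≥ -1`. -/
theorem apply_eq_zero_of_laplace_compact (v : 𝓢(SpaceTime, ℂ) →ₗ[ℂ] ℂ) (hvc : Continuous v)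
    {O : Set Plane} (hO : IsOpen O)
    (hv : ∀ (ω : ℂ) (hω : 0 < ω.im) (φ : 𝓢(Plane, ℂ)), HasCompactSupport φ → tsupport φ ⊆ O →
      v (tensor φ (timeKernel ω hω)) = 0)
    (Ψ : 𝓢(SpaceTime, ℂ)) (hc : HasCompactSupport Ψ) (hs : tsupport Ψ ⊆ O ×ˢ Ioi (-1)) :
    v Ψ = 0 := by
  obtain ⟨κ, hκc, hκO, hκ1⟩ := exists_cutoff (K := Prod.fst '' tsupport Ψ) (hc.isCompact.image
    continuous_fst) hO (by rintro - ⟨p, hp, rfl⟩; exact (hs hp).1)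
  have hI : (0 : ℝ) < Complex.I.im := by simp
  have hes : ContDiff ℝ (⊤ : ℕ∞) fun p : SpaceTime => Complex.exp (p.2 : ℝ) * Ψ p :=
    ((Complex.ofRealCLM.contDiff.comp contDiff_snd).cexp).mul (Ψ.smooth ⊤)
  have hec : HasCompactSupport fun p : SpaceTime => Complex.exp (p.2 : ℝ) * Ψ p := hc.mul_left
  -- The factor `e^t` compensates `e^{iωt}` at `ω = i`.
  let Ψ₁ : 𝓢(SpaceTime, ℂ) := hec.toSchwartzMap hes
  obtain ⟨Θ, hΘ⟩ := exists_fourier_representation Ψ₁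
  let m := tensor κ (timeKernel Complex.I hI)
  have hm : ∀ p, Ψ p = m p * Ψ₁ p := fun p => by
    change Ψ p = (κ p.1 * expCutoff Complex.I p.2) * (Complex.exp (p.2 : ℝ) * Ψ p)
    by_cases hp : p ∈ tsupport Ψ
    · rw [hκ1 _ (mem_image_of_mem _ hp), expCutoff_eq_exp _ (le_of_lt (hs hp).2), one_mul,
        ← mul_assoc, ← Complex.exp_add, Complex.I_mul_I]
      simp
    · rw [image_eq_zero_of_notMem_tsupport hp]; simp
  refine apply_eq_zero_of_superposition v hvc (μ := volume)
    (H := fun ξ => Θ ξ • modulate m (frequencyForm ξ))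
    (Θ.continuous.smul ((continuous_modulate m).comp frequencyForm.continuous))
    (integrable_seminorm_modulate _ _) Ψ (fun p => ?_) (fun ξ => ?_)
  · have h4 : ∀ ξ, (Θ ξ • modulate m (frequencyForm ξ)) p
        = m p * (Complex.exp (Complex.I * (frequencyForm ξ p : ℝ)) * Θ ξ) := fun ξ => by
      rw [smul_apply, modulate_apply, smul_eq_mul]; ring
    simp_rw [h4]
    rw [integral_const_mul, ← hΘ, hm]
  · have hω' : 0 < (Complex.I + (2 * Real.pi * ξ 2 : ℝ)).im := by simp
    rw [map_smul, modulate_tensor κ Complex.I hI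
      ((2 * Real.pi) • (ξ 0 • ContinuousLinearMap.fst ℝ ℝ ℝ + ξ 1 • ContinuousLinearMap.snd ℝ ℝ ℝ))
      (2 * Real.pi * ξ 2) (frequencyForm ξ) (fun p => by rw [frequencyForm_eq]; simp; ring) hω',
      hv _ hω' _ (hκc.of_isClosed_subset (isClosed_tsupport _) (tsupport_modulate_subset κ _))
        ((tsupport_modulate_subset κ _).trans hκO), smul_zero]

/-- A tempered distribution supported in `t ≥ 0` whose Fourier–Laplace transform vanishes on `O`
vanishes on `O × ℝ`. -/
theorem isVanishingOn_of_fourierLaplace_eq_zero (v : 𝓢'(SpaceTime, ℂ)) {O : Set Plane}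
    (hO : IsOpen O) (hv0 : IsVanishingOn v {p : SpaceTime | p.2 < 0})
    (hv : ∀ (ω : ℂ) (hω : 0 < ω.im) (φ : 𝓢(Plane, ℂ)), HasCompactSupport φ → tsupport φ ⊆ O →
      fourierLaplace v ω hω φ = 0) : IsVanishingOn v (O ×ˢ univ) := by
  intro Ψ hΨ
  refine apply_eq_zero_of_compactSupport (v : 𝓢(SpaceTime, ℂ) →ₗ[ℂ] ℂ) v.cont Ψ
    fun Φ hΦc hΦs => ?_
  -- `σ` vanishes for `t ≤ -3/4` and is `1` for `t ≥ -1/2`: the part `σΦ` lives in `t > -1`, where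
  -- the Laplace argument applies, and the rest lives in `t < 0`, where `v` vanishes.
  let σ : SpaceTime → ℂ := fun p => (Real.smoothTransition (4 * p.2 + 3) : ℂ)
  have hσ : ContDiff ℝ (⊤ : ℕ∞) σ := Complex.ofRealCLM.contDiff.comp
    (Real.smoothTransition.contDiff.comp ((contDiff_const.mul contDiff_snd).add contDiff_const))
  have h1 : HasCompactSupport fun p => σ p * Φ p := hΦc.mul_left
  have h2 : HasCompactSupport fun p => (1 - σ p) * Φ p := hΦc.mul_left
  let Φ₁ := h1.toSchwartzMap (hσ.mul (Φ.smooth ⊤))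
  let Φ₂ := h2.toSchwartzMap ((contDiff_const.sub hσ).mul (Φ.smooth ⊤))
  have e : Φ = Φ₁ + Φ₂ := by
    ext p
    change Φ p = σ p * Φ p + (1 - σ p) * Φ p
    ring
  change v Φ = 0
  rw [e, map_add]
  have hz1 : v Φ₁ = 0 := by
    refine apply_eq_zero_of_laplace_compact (v : 𝓢(SpaceTime, ℂ) →ₗ[ℂ] ℂ) v.cont hO hv Φ₁ h1 ?_
    intro p hp
    refine ⟨(hΨ (hΦs (tsupport_mul_subset_right hp))).1, ?_⟩
    have h3 : tsupport (fun p => σ p * Φ p) ⊆ {p : SpaceTime | -(3 / 4) ≤ p.2} := by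
      refine closure_minimal (fun q hq => ?_) (isClosed_le continuous_const continuous_snd)
      by_contra h4
      rw [mem_ofPred_eq, not_le] at h4
      refine hq ?_
      simp only [σ]
      rw [Real.smoothTransition.zero_of_nonpos (by linarith)]
      simp
    have h4 : -(3 / 4) ≤ p.2 := h3 hp
    change -1 < p.2
    linarith
  have hz2 : v Φ₂ = 0 := by
    refine hv0 Φ₂ fun p hp => ?_
    have h3 : tsupport (fun p => (1 - σ p) * Φ p) ⊆ {p : SpaceTime | p.2 ≤ -(1 / 2)} := by
      refine closure_minimal (fun q hq => ?_) (isClosed_le continuous_snd continuous_const)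
      by_contra h4
      rw [mem_ofPred_eq, not_le] at h4
      refine hq ?_
      simp only [σ]
      rw [Real.smoothTransition.one_of_one_le (by linarith)]
      simp
    have h4 : p.2 ≤ -(1 / 2) := h3 hp
    change p.2 < 0
    linarith
  rw [hz1, hz2, add_zero]

/-! ### Integration by parts in the slit plane and the Helmholtz equation -/

theorem isOpen_Q : IsOpen Q := by
  have : IsClosed {x : Plane | x.2 = 0 ∧ 0 ≤ x.1} :=
    (isClosed_eq continuous_snd continuous_const).inter
      (isClosed_le continuous_const continuous_fst)
  exact this.isOpen_compl

theorem ContDiffOn.mul_of_tsupport_subset {n : ℕ∞} {v φ : Plane → ℂ} (hv : ContDiffOn ℝ n v Q)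
    (hφ : ContDiff ℝ n φ) (hs : tsupport φ ⊆ Q) : ContDiff ℝ n fun x => v x * φ x := by
  refine contDiff_iff_contDiffAt.2 fun x => ?_
  by_cases hx : x ∈ tsupport φ
  · exact (hv.contDiffAt (isOpen_Q.mem_nhds (hs hx))).mul hφ.contDiffAt
  · have h : (fun x => v x * φ x) =ᶠ[𝓝 x] fun _ => 0 := by
      filter_upwards [notMem_tsupport_iff_eventuallyEq.1 hx] with y hy
      rw [hy, Pi.zero_apply, mul_zero]
    exact contDiffAt_const.congr_of_eventuallyEq h

theorem integral_fderiv_eq_zero {w : Plane → ℂ} (hw : ContDiff ℝ 1 w) (hc : HasCompactSupport w)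
    (e : Plane) : ∫ x, fderiv ℝ w x e = 0 := by
  have hd : Continuous fun x => fderiv ℝ w x e := (hw.continuous_fderiv one_ne_zero).clm_apply
    continuous_const
  have h1 : HasCompactSupport fun x => fderiv ℝ w x e := (hc.fderiv (𝕜 := ℝ)).comp_left
    (g := fun L : Plane →L[ℝ] ℂ => L e) rfl
  have := integral_smul_fderiv_eq_neg_fderiv_smul_of_integrable (𝕜 := ℝ) (μ := volume)
    (f := fun _ : Plane => (1 : ℝ)) (g := w) (v := e) (by simp)
    (by simpa using hd.integrable_of_hasCompactSupport h1)
    (by simpa using hw.continuous.integrable_of_hasCompactSupport hc)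
    (by fun_prop) (fun x _ => (hw.differentiable one_ne_zero) x)
  simpa using this

theorem setIntegral_Q_mul {v φ : Plane → ℂ} (hs : tsupport φ ⊆ Q) :
    ∫ x in Q, v x * φ x = ∫ x, v x * φ x :=
  setIntegral_eq_integral_of_forall_compl_eq_zero fun x hx => by
    rw [image_eq_zero_of_notMem_tsupport fun h => hx (hs h), mul_zero]

theorem tsupport_fderiv_apply_subset' {φ : Plane → ℂ} (e : Plane) :
    tsupport (fun x => fderiv ℝ φ x e) ⊆ tsupport φ := tsupport_fderiv_apply_subset ℝ e

theorem integrable_mul_of_tsupport {v φ : Plane → ℂ} (hv : ContinuousOn v Q) (hφ : Continuous φ)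
    (hc : HasCompactSupport φ) (hs : tsupport φ ⊆ Q) : Integrable fun x => v x * φ x := by
  have h := (contDiffOn_zero (𝕜 := ℝ)).2 hv
  have h2 := ContDiffOn.mul_of_tsupport_subset (n := 0) (by exact_mod_cast h)
    (contDiff_zero.2 hφ) hs
  exact h2.continuous.integrable_of_hasCompactSupport hc.mul_left

theorem continuousOn_fderiv_apply {n : ℕ∞} {v : Plane → ℂ} (hv : ContDiffOn ℝ (n + 1 : ℕ∞) v Q)
    (e : Plane) : ContDiffOn ℝ n (fun x => fderiv ℝ v x e) Q :=
  (hv.fderiv_of_isOpen isOpen_Q (by exact_mod_cast le_rfl)).clm_apply contDiffOn_const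

/-- Integration by parts in `Q` against a compactly supported function. -/
theorem integral_mul_fderiv {v φ : Plane → ℂ} (hv : ContDiffOn ℝ 1 v Q) (hφ : ContDiff ℝ 1 φ)
    (hc : HasCompactSupport φ) (hs : tsupport φ ⊆ Q) (e : Plane) :
    ∫ x in Q, v x * fderiv ℝ φ x e = -∫ x in Q, fderiv ℝ v x e * φ x := by
  have hw := ContDiffOn.mul_of_tsupport_subset (n := 1) (by exact_mod_cast hv) hφ hs
  have h0 := integral_fderiv_eq_zero hw hc.mul_left e
  have hs' := (tsupport_fderiv_apply_subset' (φ := φ) e).trans hs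
  have e1 : ∀ x, fderiv ℝ (fun x => v x * φ x) x e = v x * fderiv ℝ φ x e + fderiv ℝ v x e * φ x := by
    intro x
    by_cases hx : x ∈ tsupport φ
    · have hvx : DifferentiableAt ℝ v x :=
        (hv.contDiffAt (isOpen_Q.mem_nhds (hs hx))).differentiableAt one_ne_zero
      rw [fderiv_fun_mul hvx (hφ.differentiable one_ne_zero x)]
      simp only [add_apply, smul_apply, smul_eq_mul]
      ring
    · have h1 : x ∉ tsupport (fun x => v x * φ x) := fun h => hx (tsupport_mul_subset_right h)
      have h2 : fderiv ℝ (fun x => v x * φ x) x = 0 := image_eq_zero_of_notMem_tsupport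
        fun h => h1 (tsupport_fderiv_subset ℝ h)
      have h3 : fderiv ℝ φ x = 0 := image_eq_zero_of_notMem_tsupport
        fun h => hx (tsupport_fderiv_subset ℝ h)
      rw [h2, h3, image_eq_zero_of_notMem_tsupport hx]
      simp
  have i1 := integrable_mul_of_tsupport hv.continuousOn
    ((hφ.continuous_fderiv one_ne_zero).clm_apply continuous_const)
    ((hc.fderiv (𝕜 := ℝ)).comp_left (g := fun L : Plane →L[ℝ] ℂ => L e) rfl) hs'
  have i2 := integrable_mul_of_tsupport (continuousOn_fderiv_apply (n := 0)
    (by exact_mod_cast hv) e).continuousOn hφ.continuous hc hs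
  simp_rw [e1] at h0
  rw [integral_add i1 i2] at h0
  rw [setIntegral_Q_mul hs', setIntegral_Q_mul hs]
  exact eq_neg_of_add_eq_zero_left h0

/-- The Laplacian in the plane. -/
def planeLaplacian (v : Plane → ℂ) (x : Plane) : ℂ :=
  fderiv ℝ (fun y => fderiv ℝ v y (1, 0)) x (1, 0)
    + fderiv ℝ (fun y => fderiv ℝ v y (0, 1)) x (0, 1)

theorem integral_mul_fderiv_fderiv {v φ : Plane → ℂ} (hv : ContDiffOn ℝ 2 v Q)
    (hφ : ContDiff ℝ 2 φ) (hc : HasCompactSupport φ) (hs : tsupport φ ⊆ Q) (e : Plane) :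
    ∫ x in Q, v x * fderiv ℝ (fun y => fderiv ℝ φ y e) x e
      = ∫ x in Q, fderiv ℝ (fun y => fderiv ℝ v y e) x e * φ x := by
  have h1 : ContDiff ℝ 1 fun y => fderiv ℝ φ y e :=
    (hφ.fderiv_right (by norm_num)).clm_apply contDiff_const
  have h2 : ContDiffOn ℝ 1 (fun y => fderiv ℝ v y e) Q := by
    exact_mod_cast continuousOn_fderiv_apply (n := 1) (by exact_mod_cast hv) e
  have h3 : HasCompactSupport fun y => fderiv ℝ φ y e :=
    (hc.fderiv (𝕜 := ℝ)).comp_left (g := fun L : Plane →L[ℝ] ℂ => L e) rfl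
  rw [integral_mul_fderiv (hv.of_le (by norm_num)) h1 h3
      ((tsupport_fderiv_apply_subset' e).trans hs) e,
    integral_mul_fderiv h2 (hφ.of_le (by norm_num)) hc hs e, neg_neg]

theorem continuousOn_fderiv_fderiv {v : Plane → ℂ} (hv : ContDiffOn ℝ 2 v Q) (e : Plane) :
    ContinuousOn (fun x => fderiv ℝ (fun y => fderiv ℝ v y e) x e) Q := by
  have h1 : ContDiffOn ℝ 1 (fun y => fderiv ℝ v y e) Q := by
    exact_mod_cast continuousOn_fderiv_apply (n := 1) (by exact_mod_cast hv) e
  exact (continuousOn_fderiv_apply (n := 0) (by exact_mod_cast h1) e).continuousOn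

theorem continuousOn_planeLaplacian {v : Plane → ℂ} (hv : ContDiffOn ℝ 2 v Q) :
    ContinuousOn (planeLaplacian v) Q := by
  exact (continuousOn_fderiv_fderiv hv _).add (continuousOn_fderiv_fderiv hv _)

theorem integral_mul_planeLaplacian {v φ : Plane → ℂ} (hv : ContDiffOn ℝ 2 v Q)
    (hφ : ContDiff ℝ 2 φ) (hc : HasCompactSupport φ) (hs : tsupport φ ⊆ Q) :
    ∫ x in Q, v x * planeLaplacian φ x = ∫ x in Q, planeLaplacian v x * φ x := by
  have hs2 : ∀ e, tsupport (fun x => fderiv ℝ (fun y => fderiv ℝ φ y e) x e) ⊆ Q := fun e =>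
    ((tsupport_fderiv_apply_subset' e).trans (tsupport_fderiv_apply_subset' e)).trans hs
  have hc2 : ∀ e, HasCompactSupport (fun x => fderiv ℝ (fun y => fderiv ℝ φ y e) x e) := fun e =>
    hc.of_isClosed_subset (isClosed_tsupport _)
      ((tsupport_fderiv_apply_subset' e).trans (tsupport_fderiv_apply_subset' e))
  have hcont : ∀ e, Continuous (fun x => fderiv ℝ (fun y => fderiv ℝ φ y e) x e) := fun e => by
    have h1 : ContDiff ℝ 1 fun y => fderiv ℝ φ y e :=
      (hφ.fderiv_right (by norm_num)).clm_apply contDiff_const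
    exact (h1.continuous_fderiv one_ne_zero).clm_apply continuous_const
  have i1 : ∀ e, IntegrableOn (fun x => v x * fderiv ℝ (fun y => fderiv ℝ φ y e) x e) Q :=
    fun e => (integrable_mul_of_tsupport hv.continuousOn (hcont e) (hc2 e) (hs2 e)).integrableOn
  have i2 : ∀ e, IntegrableOn (fun x => fderiv ℝ (fun y => fderiv ℝ v y e) x e * φ x) Q :=
    fun e => (integrable_mul_of_tsupport (continuousOn_fderiv_fderiv hv e) hφ.continuous hc hs).integrableOn
  simp only [planeLaplacian, mul_add, add_mul]
  rw [integral_add (i1 _) (i1 _), integral_add (i2 _) (i2 _),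
    integral_mul_fderiv_fderiv hv hφ hc hs, integral_mul_fderiv_fderiv hv hφ hc hs]

theorem eqOn_zero_of_integral_eq_zero {g : Plane → ℂ} (hg : ContinuousOn g Q)
    (h : ∀ φ : Plane → ℂ, ContDiff ℝ (⊤ : ℕ∞) φ → HasCompactSupport φ → tsupport φ ⊆ Q →
      ∫ x in Q, g x * φ x = 0) : EqOn g 0 Q := by
  have h1 := isOpen_Q.ae_eq_zero_of_integral_contDiff_smul_eq_zero (μ := volume) (f := g)
    (hg.locallyIntegrableOn isOpen_Q.measurableSet) fun φ hφ hc hs => by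
      have hφ' : ContDiff ℝ (⊤ : ℕ∞) fun x => (φ x : ℂ) := Complex.ofRealCLM.contDiff.comp hφ
      have hc' : HasCompactSupport fun x => (φ x : ℂ) :=
        hc.comp_left (g := fun t : ℝ => (t : ℂ)) Complex.ofReal_zero
      have hs' : tsupport (fun x => (φ x : ℂ)) ⊆ Q :=
        (tsupport_comp_subset (g := fun t : ℝ => (t : ℂ)) Complex.ofReal_zero φ).trans hs
      have h2 := h _ hφ' hc' hs'
      rw [setIntegral_Q_mul hs'] at h2
      rw [← h2]
      refine integral_congr_ae (.of_forall fun x => ?_)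
      simp only [Complex.real_smul]
      ring
  refine Measure.eqOn_open_of_ae_eq (μ := volume) ?_ isOpen_Q hg continuousOn_const
  exact (ae_restrict_iff' isOpen_Q.measurableSet).2 h1

/-! ### The D'Alembert operator and the Fourier–Laplace transform -/

theorem tensor_apply (φ : 𝓢(Plane, ℂ)) (η : 𝓢(ℝ, ℂ)) (p : SpaceTime) :
    tensor φ η p = φ p.1 * η p.2 := rfl

theorem lineDeriv_tensor (φ : 𝓢(Plane, ℂ)) (η : 𝓢(ℝ, ℂ)) (e : Plane) (τ : ℝ) (p : SpaceTime) :
    (∂_{((e, τ) : SpaceTime)} (tensor φ η)) p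
      = (∂_{e} φ) p.1 * η p.2 + φ p.1 * (τ * SchwartzMap.derivCLM ℂ ℂ η p.2) := by
  rw [SchwartzMap.lineDerivOp_apply_eq_fderiv, SchwartzMap.lineDerivOp_apply_eq_fderiv,
    SchwartzMap.derivCLM_apply]
  have h1 : HasFDerivAt (fun p : SpaceTime => φ p.1)
      ((fderiv ℝ φ p.1).comp (ContinuousLinearMap.fst ℝ Plane ℝ)) p :=
    (φ.hasFDerivAt p.1).comp p hasFDerivAt_fst
  have h2 : HasFDerivAt (fun p : SpaceTime => η p.2)
      ((fderiv ℝ η p.2).comp (ContinuousLinearMap.snd ℝ Plane ℝ)) p :=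
    (η.hasFDerivAt p.2).comp p hasFDerivAt_snd
  have h3 := (h1.mul h2).fderiv
  change fderiv ℝ ((fun p : SpaceTime => φ p.1) * fun p => η p.2) p (e, τ) = _
  rw [h3]
  have h4 : fderiv ℝ η p.2 τ = τ * deriv η p.2 := by
    rw [← fderiv_apply_one_eq_deriv, ← smul_eq_mul (a := (τ : ℂ)), Complex.coe_smul, ← map_smul]
    simp
  simp [h4]
  ring

theorem lineDeriv_tensor_space (φ : 𝓢(Plane, ℂ)) (η : 𝓢(ℝ, ℂ)) (e : Plane) :
    ∂_{((e, 0) : SpaceTime)} (tensor φ η) = tensor (∂_{e} φ) η := by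
  ext p
  rw [lineDeriv_tensor, tensor_apply]
  simp

theorem lineDeriv_tensor_time (φ : 𝓢(Plane, ℂ)) (η : 𝓢(ℝ, ℂ)) :
    ∂_{(((0, 0), 1) : SpaceTime)} (tensor φ η) = tensor φ (SchwartzMap.derivCLM ℂ ℂ η) := by
  ext p
  rw [lineDeriv_tensor, tensor_apply]
  have : (∂_{((0, 0) : Plane)} φ) p.1 = 0 := by
    rw [SchwartzMap.lineDerivOp_apply_eq_fderiv]; exact map_zero _
  rw [this]
  simp

theorem dAlembert_apply (u : 𝓢'(SpaceTime, ℂ)) (Φ : 𝓢(SpaceTime, ℂ)) :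
    dAlembert u Φ = u (∂_{(((0, 0), 1) : SpaceTime)} (∂_{(((0, 0), 1) : SpaceTime)} Φ))
      - u (∂_{(((1, 0), 0) : SpaceTime)} (∂_{(((1, 0), 0) : SpaceTime)} Φ))
      - u (∂_{(((0, 1), 0) : SpaceTime)} (∂_{(((0, 1), 0) : SpaceTime)} Φ)) := by
  have h : ∀ m : SpaceTime, (∂_{m} (∂_{m} u)) Φ = u (∂_{m} (∂_{m} Φ)) := fun m => by
    rw [TemperedDistribution.lineDerivOp_apply_apply, TemperedDistribution.lineDerivOp_apply_apply]
    simp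
  rw [← h, ← h, ← h]
  rfl

theorem derivCLM_timeKernel (ω : ℂ) (hω : 0 < ω.im) {t : ℝ} (ht : -1 < t) :
    SchwartzMap.derivCLM ℂ ℂ (SchwartzMap.derivCLM ℂ ℂ (timeKernel ω hω)) t
      = -ω ^ 2 * timeKernel ω hω t := by
  rw [SchwartzMap.derivCLM_apply]
  have h1 : ⇑(SchwartzMap.derivCLM ℂ ℂ (timeKernel ω hω)) = deriv (expCutoff ω) := by
    ext s; rw [SchwartzMap.derivCLM_apply]; rfl
  have h2 : expCutoff ω =ᶠ[𝓝 t] fun t : ℝ => Complex.exp (Complex.I * ω * t) := by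
    filter_upwards [lt_mem_nhds ht] with s hs using expCutoff_eq_exp ω hs.le
  have h3 := h2.iteratedDeriv_eq 2
  rw [iteratedDeriv_exp_mul] at h3
  rw [h1]
  change _ = -ω ^ 2 * expCutoff ω t
  rw [expCutoff_eq_exp ω ht.le, ← iteratedDeriv_one (f := expCutoff ω), ← iteratedDeriv_succ, h3,
    mul_pow, Complex.I_sq]
  ring

/-- The time kernel `η` satisfies `η'' = -ω²η` only for `t > -1`; the discrepancy is supported in `t
≤ -1`, where `u` vanishes. -/
theorem fourierLaplace_dAlembert (u : 𝓢'(SpaceTime, ℂ))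
    (hu : IsVanishingOn u {p : SpaceTime | p.2 < 0}) (ω : ℂ) (hω : 0 < ω.im) (φ : 𝓢(Plane, ℂ)) :
    fourierLaplace (dAlembert u) ω hω φ = -ω ^ 2 * fourierLaplace u ω hω φ
      - fourierLaplace u ω hω (∂_{((1, 0) : Plane)} (∂_{((1, 0) : Plane)} φ))
      - fourierLaplace u ω hω (∂_{((0, 1) : Plane)} (∂_{((0, 1) : Plane)} φ)) := by
  simp only [fourierLaplace]
  rw [dAlembert_apply, lineDeriv_tensor_time, lineDeriv_tensor_time, lineDeriv_tensor_space,
    lineDeriv_tensor_space, lineDeriv_tensor_space, lineDeriv_tensor_space]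
  congr 2
  rw [← smul_eq_mul, ← map_smul, ← sub_eq_zero, ← map_sub]
  refine hu _ fun p hp => ?_
  have : tsupport (tensor φ (SchwartzMap.derivCLM ℂ ℂ (SchwartzMap.derivCLM ℂ ℂ
      (timeKernel ω hω))) - (-ω ^ 2) • tensor φ (timeKernel ω hω)) ⊆ {p : SpaceTime | p.2 ≤ -1} := by
    refine closure_minimal (fun q hq => ?_) (isClosed_le continuous_snd continuous_const)
    by_contra h
    rw [mem_ofPred_eq, not_le] at h
    refine hq ?_
    rw [sub_apply, smul_apply, tensor_apply, tensor_apply, derivCLM_timeKernel ω hω h, smul_eq_mul]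
    ring
  have h1 : p.2 ≤ -1 := this hp
  change p.2 < 0
  linarith

theorem fourierLaplace_dAlembert_eq_integral (u : 𝓢'(SpaceTime, ℂ))
    (hu : IsVanishingOn u {p : SpaceTime | p.2 < 0}) {U : ℂ → Plane → ℂ}
    (hU : HasFourierLaplaceTransform u U) (ω : ℂ) (hω : 0 < ω.im) (hU2 : ContDiffOn ℝ 2 (U ω) Q)
    (φ : 𝓢(Plane, ℂ)) (hc : HasCompactSupport φ) (hs : tsupport φ ⊆ Q) :
    fourierLaplace (dAlembert u) ω hω φ
      = -∫ x in Q, (planeLaplacian (U ω) x + ω ^ 2 * U ω x) * φ x := by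
  rw [fourierLaplace_dAlembert u hu, (hU ω hω _).2, (hU ω hω _).2, (hU ω hω _).2]
  have e : ∀ e : Plane, ⇑(∂_{e} (∂_{e} φ) : 𝓢(Plane, ℂ))
      = fun x => fderiv ℝ (fun y => fderiv ℝ φ y e) x e := fun e => by
    ext x
    rw [SchwartzMap.lineDerivOp_apply_eq_fderiv]
    rfl
  have hi : ∀ e : Plane,
      IntegrableOn (fun x => U ω x * fderiv ℝ (fun y => fderiv ℝ φ y e) x e) Q := fun m => by
    have := (hU ω hω (∂_{m} (∂_{m} φ))).1
    rwa [e] at this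
  have hφ : ContDiff ℝ 2 φ := φ.smooth 2
  rw [e, e, sub_sub, ← integral_add (hi _) (hi _)]
  have h1 := integral_mul_planeLaplacian hU2 hφ hc hs
  simp only [planeLaplacian, mul_add] at h1
  rw [h1, ← integral_const_mul]
  have i1 : IntegrableOn (fun x => planeLaplacian (U ω) x * φ x) Q :=
    (integrable_mul_of_tsupport (continuousOn_planeLaplacian hU2) φ.continuous hc hs).integrableOn
  have i2 : IntegrableOn (fun x => -ω ^ 2 * (U ω x * φ x)) Q := (hU ω hω φ).1.const_mul _
  change _ - ∫ x in Q, planeLaplacian (U ω) x * φ x = _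
  rw [← integral_sub i2 i1, ← integral_neg]
  refine integral_congr_ae (.of_forall fun x => ?_)
  simp only
  ring

theorem helmholtz_of_wave (u : 𝓢'(SpaceTime, ℂ))
    (hu : IsVanishingOn u {p : SpaceTime | p.2 < 0}) {U : ℂ → Plane → ℂ}
    (hU : HasFourierLaplaceTransform u U) (hw : IsVanishingOn (dAlembert u) (Q ×ˢ univ)) (ω : ℂ)
    (hω : 0 < ω.im) (hU2 : ContDiffOn ℝ 2 (U ω) Q) {x : Plane} (hx : x ∈ Q) :
    planeLaplacian (U ω) x = -ω ^ 2 * U ω x := by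
  have h := eqOn_zero_of_integral_eq_zero
    (g := fun x => planeLaplacian (U ω) x + ω ^ 2 * U ω x)
    ((continuousOn_planeLaplacian hU2).add (continuousOn_const.mul hU2.continuousOn))
    (fun φ hφ hc hs => by
      have h1 := fourierLaplace_dAlembert_eq_integral u hu hU ω hω hU2 (hc.toSchwartzMap hφ) hc hs
      have h2 : fourierLaplace (dAlembert u) ω hω (hc.toSchwartzMap hφ) = 0 := by
        refine hw _ ?_
        have h3 : tsupport (tensor (hc.toSchwartzMap hφ) (timeKernel ω hω))
            ⊆ Prod.fst ⁻¹' tsupport φ := by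
          refine closure_minimal (fun q hq => ?_)
            ((isClosed_tsupport φ).preimage continuous_fst)
          refine subset_tsupport φ fun h => hq ?_
          rw [tensor_apply, HasCompactSupport.toSchwartzMap_toFun, h, zero_mul]
        exact fun q hq => ⟨hs (h3 hq), mem_univ _⟩
      rw [h2] at h1
      exact neg_eq_zero.1 h1.symm)
  have := h hx
  simp only [Pi.zero_apply] at this
  linear_combination this

/-- The transform of `dAlembert u` tested inside `Q` is the weak form of the Helmholtz equation, so
it vanishes, and the transform is injective on distributions supported in `t ≥ 0`. -/
theorem wave_of_helmholtz (u : 𝓢'(SpaceTime, ℂ))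
    (hu : IsVanishingOn u {p : SpaceTime | p.2 < 0}) {U : ℂ → Plane → ℂ}
    (hU : HasFourierLaplaceTransform u U)
    (hU2 : ∀ ω : ℂ, 0 < ω.im → ContDiffOn ℝ 2 (U ω) Q)
    (hH : ∀ ω : ℂ, 0 < ω.im → ∀ x ∈ Q, planeLaplacian (U ω) x = -ω ^ 2 * U ω x) :
    IsVanishingOn (dAlembert u) (Q ×ˢ univ) := by
  refine isVanishingOn_of_fourierLaplace_eq_zero _ isOpen_Q (fun Φ hΦ => ?_) ?_
  · have h : ∀ m : SpaceTime, u (∂_{m} (∂_{m} Φ)) = 0 := fun m =>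
      hu _ (((SchwartzMap.tsupport_lineDerivOp_subset m _).trans
        (SchwartzMap.tsupport_lineDerivOp_subset m _)).trans hΦ)
    rw [dAlembert_apply, h, h, h]
    simp
  · intro ω hω φ hc hs
    rw [fourierLaplace_dAlembert_eq_integral u hu hU ω hω (hU2 ω hω) φ hc hs, neg_eq_zero]
    rw [setIntegral_congr_fun isOpen_Q.measurableSet (g := fun _ => 0) fun x hx => ?_]
    · simp
    · simp only
      rw [hH ω hω x hx]
      ring

/-! ### A Hardy-type inequality near the slit -/

theorem lintegral_sq_le {X : Type*} [MeasurableSpace X] {μ : Measure X} {g : X → ENNReal}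
    (hg : AEMeasurable g μ) : (∫⁻ x, g x ∂μ) ^ 2 ≤ μ univ * ∫⁻ x, g x ^ 2 ∂μ := by
  have h := ENNReal.lintegral_mul_le_Lp_mul_Lq μ Real.HolderConjugate.two_two
    (aemeasurable_const (b := (1 : ENNReal))) hg
  simp only [Pi.mul_apply, one_mul, ENNReal.one_rpow, lintegral_const] at h
  have h2 : ∀ a : ENNReal, (a ^ (1 / 2 : ℝ)) ^ 2 = a := fun a => by
    rw [← ENNReal.rpow_natCast, ← ENNReal.rpow_mul]; norm_num
  calc (∫⁻ x, g x ∂μ) ^ 2 ≤ _ := pow_le_pow_left' h 2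
    _ = _ := by
      rw [mul_pow, h2, h2]
      norm_cast

theorem enorm_add_sq_le (a b : ENNReal) : (a + b) ^ 2 ≤ 2 * a ^ 2 + 2 * b ^ 2 := by
  have h := ENNReal.rpow_add_le_mul_rpow_add_rpow a b (p := 2) (by norm_num)
  norm_num at h
  rw [← mul_add]
  exact_mod_cast h

/-- Fundamental theorem of calculus and Cauchy–Schwarz. Either endpoint may be the reference point,
since the estimate is used both upwards from the slit and leftwards past the edge; the slack in `s`
and `L` makes the bound uniform in the segment. -/
theorem enorm_sq_le_of_hasDerivAt {w w' : ℝ → ℂ} {a b : ℝ} (hab : a ≤ b)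
    (hw : ∀ t ∈ Icc a b, HasDerivAt w (w' t) t) (hc : ContinuousOn w' (Icc a b)) {s : Set ℝ}
    (hs : Ioc a b ⊆ s) {L : ℝ} (hL : b - a ≤ L) {c : ℝ} (hcc : c = a ∨ c = b) {d : ℝ}
    (hd : d = a ∨ d = b) :
    ‖w d‖ₑ ^ 2 ≤ 2 * ‖w c‖ₑ ^ 2 + 2 * (ENNReal.ofReal L * ∫⁻ t in s, ‖w' t‖ₑ ^ 2) := by
  have h1 : w b - w a = ∫ t in Ioc a b, w' t := by
    rw [← intervalIntegral.integral_of_le hab]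
    exact (intervalIntegral.integral_eq_sub_of_hasDerivAt (by rwa [uIcc_of_le hab])
      (hc.intervalIntegrable_of_Icc hab)).symm
  have h2 : ‖w d‖ₑ ≤ ‖w c‖ₑ + ∫⁻ t in Ioc a b, ‖w' t‖ₑ := by
    have h3 : ‖w b - w a‖ₑ ≤ ∫⁻ t in Ioc a b, ‖w' t‖ₑ := h1 ▸ enorm_integral_le_lintegral_enorm _
    have h4 : ‖w d - w c‖ₑ ≤ ‖w b - w a‖ₑ := by
      rcases hcc with rfl | rfl <;> rcases hd with rfl | rfl
      · simp
      · rfl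
      · rw [← enorm_neg]; simp
      · simp
    calc ‖w d‖ₑ = ‖w c + (w d - w c)‖ₑ := by ring_nf
      _ ≤ _ := (enorm_add_le _ _).trans (by gcongr; exact h4.trans h3)
  refine (pow_le_pow_left' h2 2).trans ((enorm_add_sq_le _ _).trans ?_)
  gcongr
  have hm : AEMeasurable (fun t => ‖w' t‖ₑ) (volume.restrict (Ioc a b)) :=
    ((hc.mono Ioc_subset_Icc_self).aestronglyMeasurable measurableSet_Ioc).enorm
  refine (lintegral_sq_le hm).trans ?_
  rw [Measure.restrict_apply_univ, Real.volume_Ioc]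
  gcongr

/-- The open upper half-plane. -/
def UpperHalf : Set Plane := {x | 0 < x.2}

theorem isOpen_UpperHalf : IsOpen UpperHalf := isOpen_lt continuous_const continuous_snd

section Hardy

variable {V : Plane → ℂ} (hV : ContDiffOn ℝ 1 V UpperHalf)

include hV

theorem hasDerivAt_vertical {x y : ℝ} (hy : 0 < y) :
    HasDerivAt (fun s => V (x, s)) (fderiv ℝ V (x, y) (0, 1)) y := by
  have h1 : DifferentiableAt ℝ V (x, y) :=
    (hV.contDiffAt (isOpen_UpperHalf.mem_nhds hy)).differentiableAt one_ne_zero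
  have h2 : HasDerivAt (fun s : ℝ => ((x, s) : Plane)) (0, 1) y :=
    (hasDerivAt_const y x).prodMk (hasDerivAt_id y)
  exact h1.hasFDerivAt.comp_hasDerivAt y h2

theorem hasDerivAt_horizontal {x y : ℝ} (hy : 0 < y) :
    HasDerivAt (fun s => V (s, y)) (fderiv ℝ V (x, y) (1, 0)) x := by
  have h1 : DifferentiableAt ℝ V (x, y) :=
    (hV.contDiffAt (isOpen_UpperHalf.mem_nhds hy)).differentiableAt one_ne_zero
  have h2 : HasDerivAt (fun s : ℝ => ((s, y) : Plane)) (1, 0) x :=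
    (hasDerivAt_id x).prodMk (hasDerivAt_const x y)
  exact h1.hasFDerivAt.comp_hasDerivAt x h2

theorem continuousOn_fderiv_upper (e : Plane) :
    ContinuousOn (fun x => fderiv ℝ V x e) UpperHalf :=
  (hV.continuousOn_fderiv_of_isOpen isOpen_UpperHalf le_rfl).clm_apply continuousOn_const

/-- Compare height `y` with height `δ` along vertical segments over the slit and let `δ → 0`; the
boundary term is the vanishing trace. -/
theorem lintegral_horizontal_line_le {ε y : ℝ} (hy : 0 < y) (hyε : y < ε)
    (ht : Tendsto (fun δ : ℝ => ∫⁻ x in Ioi (0 : ℝ), ‖V (x, δ)‖ₑ ^ 2) (𝓝[>] 0) (𝓝 0)) :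
    ∫⁻ x in Ioi (0 : ℝ), ‖V (x, y)‖ₑ ^ 2 ≤ 2 * (ENNReal.ofReal ε *
      ∫⁻ x in Ioi (0 : ℝ), ∫⁻ s in Ioo 0 ε, ‖fderiv ℝ V (x, s) (0, 1)‖ₑ ^ 2) := by
  set A := ∫⁻ x in Ioi (0 : ℝ), ∫⁻ s in Ioo 0 ε, ‖fderiv ℝ V (x, s) (0, 1)‖ₑ ^ 2
  have hlim : Tendsto (fun δ : ℝ => 2 * (∫⁻ x in Ioi (0 : ℝ), ‖V (x, δ)‖ₑ ^ 2)
      + 2 * (ENNReal.ofReal ε * A)) (𝓝[>] 0) (𝓝 (2 * 0 + 2 * (ENNReal.ofReal ε * A))) :=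
    (ENNReal.Tendsto.const_mul ht (Or.inr (by simp))).add_const _
  rw [mul_zero, zero_add] at hlim
  refine ge_of_tendsto hlim ?_
  filter_upwards [Ioo_mem_nhdsGT hy] with δ hδ
  have hm : AEMeasurable (fun x : ℝ => 2 * ‖V (x, δ)‖ₑ ^ 2) (volume.restrict (Ioi 0)) := by
    have hc : Continuous fun x : ℝ => V (x, δ) := by
      refine hV.continuousOn.comp_continuous (by fun_prop) fun x => ?_
      exact hδ.1
    exact ((hc.enorm.measurable.pow_const 2).const_mul 2).aemeasurable
  calc ∫⁻ x in Ioi (0 : ℝ), ‖V (x, y)‖ₑ ^ 2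
      ≤ ∫⁻ x in Ioi (0 : ℝ), (2 * ‖V (x, δ)‖ₑ ^ 2 + 2 * (ENNReal.ofReal ε *
          ∫⁻ s in Ioo 0 ε, ‖fderiv ℝ V (x, s) (0, 1)‖ₑ ^ 2)) := by
        refine lintegral_mono fun x => ?_
        refine enorm_sq_le_of_hasDerivAt (w := fun s => V (x, s))
          (w' := fun s => fderiv ℝ V (x, s) (0, 1)) hδ.2.le
          (fun t ht => hasDerivAt_vertical hV (hδ.1.trans_le ht.1)) ?_ ?_ (by linarith [hδ.1])
          (Or.inl rfl) (Or.inr rfl)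
        · exact (continuousOn_fderiv_upper hV (0, 1)).comp (by fun_prop)
            fun t ht => hδ.1.trans_le ht.1
        · exact fun t ht => ⟨hδ.1.trans ht.1, ht.2.trans_lt hyε⟩
    _ = _ := by
        rw [lintegral_add_left' hm, lintegral_const_mul' _ _ (by simp),
          lintegral_const_mul' _ _ (by simp), lintegral_const_mul' _ _ (by simp)]

/-- No boundary value is available to the left of the edge, so a point there is compared with the
point at distance `ε` to its right, which lies above the slit. -/
theorem lintegral_left_segment_le {ε y : ℝ} (hε : 0 < ε) (hy : 0 < y) :
    ∫⁻ x in Ioc (-ε) 0, ‖V (x, y)‖ₑ ^ 2 ≤ 2 * (∫⁻ x in Ioi (0 : ℝ), ‖V (x, y)‖ₑ ^ 2)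
      + 2 * (ENNReal.ofReal ε ^ 2 *
        ∫⁻ s in Ioi (-ε), ‖fderiv ℝ V (s, y) (1, 0)‖ₑ ^ 2) := by
  have hc : Continuous fun x : ℝ => V (x, y) := by
    refine hV.continuousOn.comp_continuous (by fun_prop) fun x => ?_
    exact hy
  have hm : AEMeasurable (fun x : ℝ => 2 * ‖V (x + ε, y)‖ₑ ^ 2) (volume.restrict (Ioc (-ε) 0)) := by
    have hc' : Continuous fun x : ℝ => V (x + ε, y) := hc.comp (continuous_add_const ε)
    exact ((hc'.enorm.measurable.pow_const 2).const_mul 2).aemeasurable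
  set B := ∫⁻ s in Ioi (-ε), ‖fderiv ℝ V (s, y) (1, 0)‖ₑ ^ 2
  calc ∫⁻ x in Ioc (-ε) 0, ‖V (x, y)‖ₑ ^ 2
      ≤ ∫⁻ x in Ioc (-ε) 0, (2 * ‖V (x + ε, y)‖ₑ ^ 2 + 2 * (ENNReal.ofReal ε * B)) := by
        refine setLIntegral_mono' measurableSet_Ioc fun x hx => ?_
        refine enorm_sq_le_of_hasDerivAt (w := fun s => V (s, y))
          (w' := fun s => fderiv ℝ V (s, y) (1, 0)) (a := x) (b := x + ε) (by linarith)
          (fun t ht => hasDerivAt_horizontal hV hy) ?_ ?_ (by linarith) (Or.inr rfl) (Or.inl rfl)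
        · exact (continuousOn_fderiv_upper hV (1, 0)).comp (by fun_prop) fun t ht => hy
        · exact fun t ht => hx.1.trans ht.1
    _ = 2 * (∫⁻ x in Ioc (-ε) 0, ‖V (x + ε, y)‖ₑ ^ 2) + 2 * (ENNReal.ofReal ε ^ 2 * B) := by
        rw [lintegral_add_left' hm, lintegral_const_mul' _ _ (by simp), lintegral_const,
          Measure.restrict_apply_univ, Real.volume_Ioc]
        simp only [sub_neg_eq_add, zero_add]
        ring
    _ ≤ _ := by
        gcongr 2 * ?_ + _
        have h := (measurePreserving_add_right volume ε).setLIntegral_comp_preimage_emb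
          (measurableEmbedding_addRight ε) (fun x => ‖V (x, y)‖ₑ ^ 2) (Ioc 0 ε)
        simp only [preimage_add_const_Ioc, zero_sub, sub_self] at h
        rw [h]
        exact lintegral_mono_set Ioc_subset_Ioi_self

/-- The scaling `ε²` matches the square of a cut-off gradient of size `1/ε`. Extending the strip by
`ε` beyond the edge lets the cut-off vanish near the edge as well. -/
theorem lintegral_strip_le {ε : ℝ} (hε : 0 < ε)
    (ht : Tendsto (fun δ : ℝ => ∫⁻ x in Ioi (0 : ℝ), ‖V (x, δ)‖ₑ ^ 2) (𝓝[>] 0) (𝓝 0)) :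
    ∫⁻ x in Ioi (-ε) ×ˢ Ioo 0 ε, ‖V x‖ₑ ^ 2 ≤ 8 * ENNReal.ofReal ε ^ 2 *
      ∫⁻ x in Ioi (-ε) ×ˢ Ioo 0 ε,
        (‖fderiv ℝ V x (1, 0)‖ₑ ^ 2 + ‖fderiv ℝ V x (0, 1)‖ₑ ^ 2) := by
  have hsub : Ioi (-ε) ×ˢ Ioo 0 ε ⊆ UpperHalf := fun x hx => hx.2.1
  have hms : MeasurableSet (Ioi (-ε) ×ˢ Ioo (0 : ℝ) ε) := measurableSet_Ioi.prod measurableSet_Ioo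
  have hm : ∀ g : Plane → ℂ, ContinuousOn g UpperHalf → AEMeasurable (fun x => ‖g x‖ₑ ^ 2)
      ((volume.restrict (Ioi (-ε))).prod (volume.restrict (Ioo (0 : ℝ) ε))) := fun g hg => by
    rw [Measure.prod_restrict]
    exact (((hg.mono hsub).aestronglyMeasurable hms).enorm).pow_const 2
  have hfub : ∀ g : Plane → ℂ, ContinuousOn g UpperHalf →
      ∫⁻ x in Ioi (-ε) ×ˢ Ioo 0 ε, ‖g x‖ₑ ^ 2
        = ∫⁻ y in Ioo 0 ε, ∫⁻ x in Ioi (-ε), ‖g (x, y)‖ₑ ^ 2 := fun g hg => by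
    rw [Measure.volume_eq_prod, ← Measure.prod_restrict, lintegral_prod_symm _ (hm g hg)]
  have hfub' : ∀ g : Plane → ℂ, ContinuousOn g UpperHalf →
      ∫⁻ x in Ioi (-ε) ×ˢ Ioo 0 ε, ‖g x‖ₑ ^ 2
        = ∫⁻ x in Ioi (-ε), ∫⁻ y in Ioo 0 ε, ‖g (x, y)‖ₑ ^ 2 := fun g hg => by
    rw [Measure.volume_eq_prod, ← Measure.prod_restrict, lintegral_prod _ (hm g hg)]
  have hc1 := continuousOn_fderiv_upper hV (1, 0)
  have hc2 := continuousOn_fderiv_upper hV (0, 1)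
  set A := ∫⁻ x in Ioi (-ε) ×ˢ Ioo 0 ε, ‖fderiv ℝ V x (0, 1)‖ₑ ^ 2 with hA
  set B := ∫⁻ x in Ioi (-ε) ×ˢ Ioo 0 ε, ‖fderiv ℝ V x (1, 0)‖ₑ ^ 2 with hB
  have hAle : ∫⁻ x in Ioi (0 : ℝ), ∫⁻ s in Ioo 0 ε, ‖fderiv ℝ V (x, s) (0, 1)‖ₑ ^ 2 ≤ A := by
    rw [hA, hfub' _ hc2]
    exact lintegral_mono_set (Ioi_subset_Ioi (by linarith))
  have hadd : ∫⁻ x in Ioi (-ε) ×ˢ Ioo 0 ε,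
      (‖fderiv ℝ V x (1, 0)‖ₑ ^ 2 + ‖fderiv ℝ V x (0, 1)‖ₑ ^ 2) = B + A := by
    refine lintegral_add_left' ?_ _
    have := hm _ hc1
    rwa [Measure.prod_restrict] at this
  rw [hadd, hfub V hV.continuousOn]
  -- The part over the slit is at most `2εA`; the left part is at most twice that plus the
  -- horizontal term, whence `6 = 2·2 + 2`.
  have hline : ∀ y ∈ Ioo 0 ε, ∫⁻ x in Ioi (-ε), ‖V (x, y)‖ₑ ^ 2
      ≤ 6 * (ENNReal.ofReal ε * A) + 2 * (ENNReal.ofReal ε ^ 2 *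
        ∫⁻ s in Ioi (-ε), ‖fderiv ℝ V (s, y) (1, 0)‖ₑ ^ 2) := fun y hy => by
    have h1 : ∫⁻ x in Ioi (0 : ℝ), ‖V (x, y)‖ₑ ^ 2 ≤ 2 * (ENNReal.ofReal ε * A) :=
      (lintegral_horizontal_line_le hV hy.1 hy.2 ht).trans (by gcongr)
    have h2 := lintegral_left_segment_le hV hε hy.1
    have h3 : Ioi (-ε) = Ioc (-ε) 0 ∪ Ioi 0 := (Ioc_union_Ioi_eq_Ioi (by linarith)).symm
    calc _ ≤ (∫⁻ x in Ioc (-ε) 0, ‖V (x, y)‖ₑ ^ 2) + ∫⁻ x in Ioi (0 : ℝ), ‖V (x, y)‖ₑ ^ 2 := by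
          rw [h3]
          exact lintegral_union_le _ _ _
      _ ≤ (2 * (2 * (ENNReal.ofReal ε * A)) + 2 * (ENNReal.ofReal ε ^ 2 *
          ∫⁻ s in Ioi (-ε), ‖fderiv ℝ V (s, y) (1, 0)‖ₑ ^ 2))
          + 2 * (ENNReal.ofReal ε * A) := by
          exact add_le_add (h2.trans (by gcongr)) h1
      _ = _ := by ring
  calc _ ≤ ∫⁻ y in Ioo 0 ε, (6 * (ENNReal.ofReal ε * A) + 2 * (ENNReal.ofReal ε ^ 2 *
        ∫⁻ s in Ioi (-ε), ‖fderiv ℝ V (s, y) (1, 0)‖ₑ ^ 2)) :=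
        setLIntegral_mono' measurableSet_Ioo hline
    _ = 6 * (ENNReal.ofReal ε ^ 2 * A) + 2 * (ENNReal.ofReal ε ^ 2 * B) := by
        rw [lintegral_add_left' aemeasurable_const, lintegral_const, Measure.restrict_apply_univ,
          Real.volume_Ioo, lintegral_const_mul' _ _ (by simp), lintegral_const_mul' _ _ (by simp),
          hB, hfub _ hc1, sub_zero]
        ring
    _ ≤ 8 * (ENNReal.ofReal ε ^ 2 * A) + 8 * (ENNReal.ofReal ε ^ 2 * B) := by
        gcongr <;> norm_num
    _ = _ := by ring

end Hardy

/-! ### Uniqueness for the Dirichlet problem in the slit plane -/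

theorem tendsto_lintegral_sq_of_eLpNorm {F : ℝ → ℝ → ℂ} {l : Filter ℝ} {μ : Measure ℝ}
    (h : Tendsto (fun ε => eLpNorm (F ε) 2 μ) l (𝓝 0)) :
    Tendsto (fun ε => ∫⁻ s, ‖F ε s‖ₑ ^ 2 ∂μ) l (𝓝 0) := by
  have h1 : ∀ ε, eLpNorm (F ε) 2 μ ^ 2 = ∫⁻ s, ‖F ε s‖ₑ ^ 2 ∂μ := fun ε => by
    have := eLpNorm_nnreal_pow_eq_lintegral (f := F ε) (μ := μ) (p := 2) two_ne_zero
    simpa using this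
  simp_rw [← h1]
  have := ((ENNReal.continuous_pow 2).tendsto 0).comp h
  simpa [Function.comp_def] using this

/-- The points of the strip of width `ε` around the slit which do not lie on the axis. -/
def slitStrip (ε : ℝ) : Set Plane := Ioi (-ε) ×ˢ Ioo 0 ε ∪ Ioi (-ε) ×ˢ Ioo (-ε) 0

theorem measurableSet_slitStrip (ε : ℝ) : MeasurableSet (slitStrip ε) :=
  (measurableSet_Ioi.prod measurableSet_Ioo).union (measurableSet_Ioi.prod measurableSet_Ioo)

theorem slitStrip_subset_Q (ε : ℝ) : slitStrip ε ⊆ Q := by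
  rintro x (hx | hx) ⟨h, -⟩
  · exact hx.2.1.ne' h
  · exact hx.2.2.ne h

/-- Reflection in the axis that contains the slit. -/
def reflection : Plane →L[ℝ] Plane :=
  (ContinuousLinearMap.fst ℝ ℝ ℝ).prod (-ContinuousLinearMap.snd ℝ ℝ ℝ)

theorem reflection_apply (x : Plane) : reflection x = (x.1, -x.2) := rfl

theorem measurePreserving_reflection : MeasurePreserving reflection := by
  have := (MeasurePreserving.id (volume : Measure ℝ)).prod
    (Measure.measurePreserving_neg (volume : Measure ℝ))
  exact this

theorem setLIntegral_reflection (g : Plane → ENNReal) (ε : ℝ) :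
    ∫⁻ x in Ioi (-ε) ×ˢ Ioo 0 ε, g (reflection x) = ∫⁻ x in Ioi (-ε) ×ˢ Ioo (-ε) 0, g x := by
  have hemb : MeasurableEmbedding reflection := by
    refine MeasurableEmbedding.of_measurable_inverse (g := reflection)
      reflection.continuous.measurable ?_ reflection.continuous.measurable fun x => by
        simp [reflection_apply]
    have : range reflection = univ :=
      (Function.RightInverse.surjective (g := reflection) fun _ => by
        simp [reflection_apply]).range_eq
    rw [this]; exact MeasurableSet.univ
  have h := measurePreserving_reflection.setLIntegral_comp_preimage_emb hemb g
    (Ioi (-ε) ×ˢ Ioo (-ε) 0)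
  rw [← h]
  congr 2
  ext x
  simp only [mem_prod, mem_preimage, reflection_apply, mem_Ioi, mem_Ioo]
  constructor <;> rintro ⟨h1, h2, h3⟩ <;> refine ⟨h1, ?_, ?_⟩ <;> linarith

theorem upperHalf_subset_Q : UpperHalf ⊆ Q := fun _ hx h => (ne_of_gt hx) h.1

theorem lintegral_slitStrip_le {v : Plane → ℂ} (hv : ContDiffOn ℝ 1 v Q)
    (ht : HasDirichletTrace v fun _ => 0) {ε : ℝ} (hε : 0 < ε) :
    ∫⁻ x in slitStrip ε, ‖v x‖ₑ ^ 2 ≤ 8 * ENNReal.ofReal ε ^ 2 * ∫⁻ x in slitStrip ε,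
      (‖fderiv ℝ v x (1, 0)‖ₑ ^ 2 + ‖fderiv ℝ v x (0, 1)‖ₑ ^ 2) := by
  have h1 := lintegral_strip_le (hv.mono upperHalf_subset_Q) hε (by
    simpa using tendsto_lintegral_sq_of_eLpNorm ht.1)
  -- The lower side of the slit is treated by reflecting it to the upper side; the sign change of
  -- the normal derivative does not affect its norm.
  have hmap : MapsTo reflection UpperHalf Q := fun x hx h => by
    have h1 : -x.2 = 0 := h.1
    have h2 : 0 < x.2 := hx
    linarith
  have hw : ContDiffOn ℝ 1 (fun x => v (reflection x)) UpperHalf :=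
    hv.comp reflection.contDiff.contDiffOn hmap
  have h2 := lintegral_strip_le hw hε (by
    simpa [reflection_apply] using tendsto_lintegral_sq_of_eLpNorm ht.2)
  have hd : ∀ x ∈ UpperHalf, ∀ e, fderiv ℝ (fun x => v (reflection x)) x e
      = fderiv ℝ v (reflection x) (reflection e) := fun x hx e => by
    have hvx : DifferentiableAt ℝ v (reflection x) :=
      (hv.contDiffAt (isOpen_Q.mem_nhds (hmap hx))).differentiableAt one_ne_zero
    have := (hvx.hasFDerivAt.comp x reflection.hasFDerivAt).fderiv
    rw [Function.comp_def] at this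
    rw [this]
    rfl
  have e1 : ∫⁻ x in Ioi (-ε) ×ˢ Ioo 0 ε, (‖fderiv ℝ (fun x => v (reflection x)) x (1, 0)‖ₑ ^ 2
      + ‖fderiv ℝ (fun x => v (reflection x)) x (0, 1)‖ₑ ^ 2)
      = ∫⁻ x in Ioi (-ε) ×ˢ Ioo (-ε) 0, (‖fderiv ℝ v x (1, 0)‖ₑ ^ 2
        + ‖fderiv ℝ v x (0, 1)‖ₑ ^ 2) := by
    rw [← setLIntegral_reflection]
    refine setLIntegral_congr_fun (measurableSet_Ioi.prod measurableSet_Ioo) fun x hx => ?_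
    rw [hd x hx.2.1, hd x hx.2.1]
    have r1 : reflection (1, 0) = (1, 0) := by simp [reflection_apply]
    have r2 : reflection (0, 1) = -(0, 1) := by simp [reflection_apply]
    rw [r1, r2, map_neg, enorm_neg]
  rw [e1, setLIntegral_reflection (fun x => ‖v x‖ₑ ^ 2)] at h2
  have hdisj : Disjoint (Ioi (-ε) ×ˢ Ioo 0 ε) (Ioi (-ε) ×ˢ Ioo (-ε) 0) := by
    rw [Set.disjoint_left]
    rintro x hx hx'
    exact lt_asymm hx.2.1 hx'.2.2
  rw [slitStrip, lintegral_union (measurableSet_Ioi.prod measurableSet_Ioo) hdisj,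
    lintegral_union (measurableSet_Ioi.prod measurableSet_Ioo) hdisj, mul_add]
  exact add_le_add h1 h2

/-- The classical derivatives of a function in `H¹(Q)` are square integrable. -/
theorem memLp_fderiv_of_memH1 {v : Plane → ℂ} (hv : ContDiffOn ℝ 1 v Q) (h1 : MemH1 v)
    {e : Plane} (he : e ∈ ({(1, 0), (0, 1)} : Set Plane)) :
    MemLp (fun x => fderiv ℝ v x e) 2 (volume.restrict Q) := by
  obtain ⟨g, hg, hw⟩ := h1.2 e he
  have hc : ContinuousOn (fun x => fderiv ℝ v x e) Q :=
    (continuousOn_fderiv_apply (n := 0) (by exact_mod_cast hv) e).continuousOn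
  have hgl : LocallyIntegrableOn g Q := by
    rw [locallyIntegrableOn_iff isOpen_Q.isLocallyClosed]
    intro K hKQ hK
    have h2 : MemLp g 2 (volume.restrict K) := hg.mono_measure (Measure.restrict_mono_set _ hKQ)
    have : IsFiniteMeasure (volume.restrict K) := ⟨by
      rw [Measure.restrict_apply_univ]; exact hK.measure_lt_top⟩
    exact h2.integrable one_le_two
  have hz : ∀ᵐ x, x ∈ Q → (fun x => fderiv ℝ v x e - g x) x = 0 := by
    refine isOpen_Q.ae_eq_zero_of_integral_contDiff_smul_eq_zero
      ((hc.locallyIntegrableOn isOpen_Q.measurableSet).sub hgl) fun φ hφ hφc hφs => ?_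
    have hφ' : ContDiff ℝ (⊤ : ℕ∞) fun x => (φ x : ℂ) := Complex.ofRealCLM.contDiff.comp hφ
    have hc' : HasCompactSupport fun x => (φ x : ℂ) :=
      hφc.comp_left (g := fun t : ℝ => (t : ℂ)) Complex.ofReal_zero
    have hs' : tsupport (fun x => (φ x : ℂ)) ⊆ Q :=
      (tsupport_comp_subset (g := fun t : ℝ => (t : ℂ)) Complex.ofReal_zero φ).trans hφs
    have i1 := integral_mul_fderiv hv (hφ'.of_le (by exact_mod_cast le_top)) hc' hs' e
    have i2 := hw _ hφ' hc' hs'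
    rw [i1, neg_inj, setIntegral_Q_mul hs', setIntegral_Q_mul hs'] at i2
    have j1 : Integrable fun x => φ x • fderiv ℝ v x e := by
      refine (integrable_mul_of_tsupport hc hφ'.continuous hc' hs').congr (.of_forall fun x => ?_)
      simp only [Complex.real_smul]; ring
    have j2 : Integrable fun x => φ x • g x := by
      have h3 : MemLp φ 2 (volume.restrict Q) :=
        (hφ.continuous.memLp_of_hasCompactSupport hφc).restrict Q
      rw [← integrableOn_iff_integrable_of_support_subset (s := Q)]
      · exact memLp_one_iff_integrable.1 (hg.smul h3 (r := 1))
      · exact fun x hx => hφs (subset_tsupport φ fun h => hx (by simp only [h, zero_smul]))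
    simp only [smul_sub]
    rw [integral_sub j1 j2, sub_eq_zero]
    simpa only [Complex.real_smul, mul_comm] using i2
  refine (memLp_congr_ae ?_).1 hg
  filter_upwards [(ae_restrict_iff' isOpen_Q.measurableSet).2 hz] with x hx
  exact (sub_eq_zero.1 hx).symm

/-! ### Cut-off functions adapted to the slit -/

theorem exists_lipschitz_smoothTransition :
    ∃ M : ℝ, 0 ≤ M ∧ ∀ s t, |Real.smoothTransition s - Real.smoothTransition t| ≤ M * |s - t| := by
  have hd : ContDiff ℝ 1 Real.smoothTransition := Real.smoothTransition.contDiff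
  have hc := hd.continuous_deriv le_rfl
  obtain ⟨M, hM⟩ := (isCompact_Icc (a := (0 : ℝ)) (b := 1)).exists_bound_of_continuousOn
    hc.continuousOn
  have hb : ∀ t, ‖deriv Real.smoothTransition t‖ ≤ max M 0 := fun t => by
    rcases lt_or_ge t 0 with h | h
    · have : Real.smoothTransition =ᶠ[𝓝 t] fun _ => 0 := by
        filter_upwards [gt_mem_nhds h] with s hs using Real.smoothTransition.zero_of_nonpos hs.le
      rw [this.deriv_eq]; simp
    rcases le_or_gt t 1 with h' | h'
    · exact (hM t ⟨h, h'⟩).trans (le_max_left _ _)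
    · have : Real.smoothTransition =ᶠ[𝓝 t] fun _ => 1 := by
        filter_upwards [lt_mem_nhds h'] with s hs using Real.smoothTransition.one_of_one_le hs.le
      rw [this.deriv_eq]; simp
  refine ⟨max M 0, le_max_right _ _, fun s t => ?_⟩
  exact Convex.norm_image_sub_le_of_norm_deriv_le (s := univ)
    (fun x _ => hd.differentiable one_ne_zero x) (fun x _ => hb x) convex_univ (mem_univ t)
    (mem_univ s)

theorem abs_mul_sub_mul_le {a b c d : ℝ} (ha : |a| ≤ 1) (hd : |d| ≤ 1) :
    |a * b - c * d| ≤ |a - c| + |b - d| := by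
  have : a * b - c * d = a * (b - d) + (a - c) * d := by ring
  rw [this]
  refine (abs_add_le _ _).trans ?_
  rw [abs_mul, abs_mul]
  nlinarith [abs_nonneg (b - d), abs_nonneg (a - c)]

theorem abs_smoothTransition_le (t : ℝ) : |Real.smoothTransition t| ≤ 1 := by
  rw [abs_of_nonneg (Real.smoothTransition.nonneg t)]
  exact Real.smoothTransition.le_one t

/-- A smooth function which is `1` near the slit and vanishes outside of the strip of width `1`. -/
def slitBump (y : Plane) : ℝ :=
  Real.smoothTransition (2 * y.1 + 2) *
    (Real.smoothTransition (2 - 2 * y.2) * Real.smoothTransition (2 + 2 * y.2))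

/-- A smooth function which is `1` on the square of half-width `1` and has compact support. -/
def squareBump (y : Plane) : ℝ :=
  (Real.smoothTransition (2 - y.1) * Real.smoothTransition (2 + y.1)) *
    (Real.smoothTransition (2 - y.2) * Real.smoothTransition (2 + y.2))

theorem contDiff_slitBump : ContDiff ℝ 1 slitBump := by
  have h : ContDiff ℝ 1 Real.smoothTransition := Real.smoothTransition.contDiff
  unfold slitBump
  exact (h.comp (by fun_prop)).mul ((h.comp (by fun_prop)).mul (h.comp (by fun_prop)))

theorem contDiff_squareBump : ContDiff ℝ 1 squareBump := by
  have h : ContDiff ℝ 1 Real.smoothTransition := Real.smoothTransition.contDiff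
  unfold squareBump
  exact ((h.comp (by fun_prop)).mul (h.comp (by fun_prop))).mul
    ((h.comp (by fun_prop)).mul (h.comp (by fun_prop)))

theorem abs_mul_le_one {a b : ℝ} (ha : |a| ≤ 1) (hb : |b| ≤ 1) : |a * b| ≤ 1 := by
  rw [abs_mul]; exact mul_le_one₀ ha (abs_nonneg _) hb

theorem slitBump_nonneg (y : Plane) : 0 ≤ slitBump y := by
  have := Real.smoothTransition.nonneg
  exact mul_nonneg (this _) (mul_nonneg (this _) (this _))

theorem squareBump_nonneg (y : Plane) : 0 ≤ squareBump y := by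
  have := Real.smoothTransition.nonneg
  exact mul_nonneg (mul_nonneg (this _) (this _)) (mul_nonneg (this _) (this _))

theorem slitBump_le_one (y : Plane) : slitBump y ≤ 1 :=
  (le_abs_self _).trans (abs_mul_le_one (abs_smoothTransition_le _)
    (abs_mul_le_one (abs_smoothTransition_le _) (abs_smoothTransition_le _)))

theorem squareBump_le_one (y : Plane) : squareBump y ≤ 1 :=
  (le_abs_self _).trans (abs_mul_le_one
    (abs_mul_le_one (abs_smoothTransition_le _) (abs_smoothTransition_le _))
    (abs_mul_le_one (abs_smoothTransition_le _) (abs_smoothTransition_le _)))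

theorem exists_lipschitz_bumps : ∃ M : ℝ, 0 ≤ M ∧
    (∀ x y, |slitBump x - slitBump y| ≤ M * ‖x - y‖) ∧
      ∀ x y, |squareBump x - squareBump y| ≤ M * ‖x - y‖ := by
  obtain ⟨M, hM0, hM⟩ := exists_lipschitz_smoothTransition
  have hS := abs_smoothTransition_le
  have h1 : ∀ x y : Plane, |x.1 - y.1| ≤ ‖x - y‖ := fun x y => norm_fst_le (x - y)
  have h2 : ∀ x y : Plane, |x.2 - y.2| ≤ ‖x - y‖ := fun x y => norm_snd_le (x - y)
  have key : ∀ (a b s t : ℝ), |Real.smoothTransition (a + b * s)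
      - Real.smoothTransition (a + b * t)| ≤ M * (|b| * |s - t|) := fun a b s t => by
    refine (hM _ _).trans_eq ?_
    rw [← abs_mul]; congr 2; ring
  refine ⟨6 * M, by positivity, fun x y => ?_, fun x y => ?_⟩
  · have k1 := key 2 2 x.1 y.1
    have k2 := key 2 (-2) x.2 y.2
    have k3 := key 2 2 x.2 y.2
    refine (abs_mul_sub_mul_le (hS _) (abs_mul_le_one (hS _) (hS _))).trans ?_
    have := abs_mul_sub_mul_le (b := Real.smoothTransition (2 + 2 * x.2))
      (c := Real.smoothTransition (2 - 2 * y.2)) (hS (2 - 2 * x.2)) (hS (2 + 2 * y.2))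
    rw [add_comm (2 * x.1), add_comm (2 * y.1)]
    simp only [neg_mul, ← sub_eq_add_neg, abs_neg, abs_two] at k1 k2 k3
    nlinarith [mul_le_mul_of_nonneg_left (h1 x y) hM0, mul_le_mul_of_nonneg_left (h2 x y) hM0]
  · have k1 := key 2 (-1) x.1 y.1
    have k2 := key 2 1 x.1 y.1
    have k3 := key 2 (-1) x.2 y.2
    have k4 := key 2 1 x.2 y.2
    refine (abs_mul_sub_mul_le (abs_mul_le_one (hS _) (hS _))
      (abs_mul_le_one (hS _) (hS _))).trans ?_
    have e1 := abs_mul_sub_mul_le (b := Real.smoothTransition (2 + x.1))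
      (c := Real.smoothTransition (2 - y.1)) (hS (2 - x.1)) (hS (2 + y.1))
    have e2 := abs_mul_sub_mul_le (b := Real.smoothTransition (2 + x.2))
      (c := Real.smoothTransition (2 - y.2)) (hS (2 - x.2)) (hS (2 + y.2))
    simp only [neg_mul, one_mul, ← sub_eq_add_neg, abs_neg, abs_one] at k1 k2 k3 k4
    nlinarith [mul_le_mul_of_nonneg_left (h1 x y) hM0, mul_le_mul_of_nonneg_left (h2 x y) hM0,
      mul_nonneg hM0 (norm_nonneg (x - y))]

theorem norm_fderiv_comp_smul_le {F : Plane → ℝ} {M : ℝ} (hM : 0 ≤ M)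
    (hF : ∀ x y, |F x - F y| ≤ M * ‖x - y‖) {c : ℝ} (hc : 0 ≤ c) (x : Plane) :
    ‖fderiv ℝ (fun x => F (c • x)) x‖ ≤ M * c := by
  refine norm_fderiv_le_of_lip' ℝ (mul_nonneg hM hc) (.of_forall fun y => ?_)
  refine (hF _ _).trans_eq ?_
  rw [← smul_sub, norm_smul, Real.norm_of_nonneg hc, mul_assoc]

/-- Smooth functions with compact support in `Q` which increase to `1`, with control of their
gradients. -/
theorem exists_slit_cutoffs : ∃ (C : ℝ) (η : ℕ → Plane → ℝ), 0 ≤ C ∧ ∀ n : ℕ, 0 < n →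
    ContDiff ℝ 1 (η n) ∧ HasCompactSupport (η n) ∧ tsupport (η n) ⊆ Q ∧
    (∀ x, 0 ≤ η n x ∧ η n x ≤ 1) ∧
    (∀ x : Plane, x.2 ≠ 0 → 1 ≤ (n : ℝ) * |x.2| → ‖x‖ ≤ n → η n x = 1) ∧
    ∀ x, x.2 ≠ 0 → ‖fderiv ℝ (η n) x‖
      ≤ C * ((slitStrip (n : ℝ)⁻¹).indicator (fun _ => (n : ℝ)) x + (n : ℝ)⁻¹) := by
  obtain ⟨M, hM0, hM1, hM2⟩ := exists_lipschitz_bumps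
  -- The first factor removes a strip of width `1/n` around the slit, at the cost of a gradient of
  -- size `n` there; the second truncates at distance of order `n`, with a gradient of size `1/n`.
  refine ⟨M, fun n x => (1 - slitBump ((n : ℝ) • x)) * squareBump ((n : ℝ)⁻¹ • x), hM0,
    fun n hn => ?_⟩
  have hn' : (0 : ℝ) < n := by exact_mod_cast hn
  have d1 : ContDiff ℝ 1 fun x : Plane => slitBump ((n : ℝ) • x) :=
    contDiff_slitBump.comp (by fun_prop)
  have d2 : ContDiff ℝ 1 fun x : Plane => squareBump ((n : ℝ)⁻¹ • x) :=
    contDiff_squareBump.comp (by fun_prop)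
  refine ⟨(contDiff_const.sub d1).mul d2, ?_, ?_, ?_, ?_, ?_⟩
  · refine HasCompactSupport.of_support_subset_isCompact
      (isCompact_closedBall (0 : Plane) (2 * n)) fun x hx => ?_
    by_contra hx'
    rw [mem_closedBall_zero_iff, Prod.norm_def, max_le_iff, not_and_or, not_le, not_le] at hx'
    refine hx ?_
    have z : ∀ t : ℝ, 2 * n < ‖t‖ → Real.smoothTransition (2 - (n : ℝ)⁻¹ * t) *
        Real.smoothTransition (2 + (n : ℝ)⁻¹ * t) = 0 := fun t ht => by
      have e : t = n * ((n : ℝ)⁻¹ * t) := by field_simp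
      rw [Real.norm_eq_abs, e, abs_mul, abs_of_pos hn', mul_comm] at ht
      have h2 := lt_of_mul_lt_mul_left ht hn'.le
      rcases lt_abs.1 h2 with h | h
      · rw [Real.smoothTransition.zero_of_nonpos (by linarith), zero_mul]
      · rw [mul_comm, Real.smoothTransition.zero_of_nonpos (by linarith), zero_mul]
    have : squareBump ((n : ℝ)⁻¹ • x) = 0 := by
      simp only [squareBump, Prod.smul_fst, Prod.smul_snd, smul_eq_mul]
      rcases hx' with h | h
      · rw [z _ h, zero_mul]
      · rw [z _ h, mul_zero]
    simp only [this, mul_zero]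
  · intro x hx hxQ
    refine notMem_tsupport_iff_eventuallyEq.2 ?_ hx
    have h1 : ∀ᶠ y : Plane in 𝓝 x, -1 / 2 < n * y.1 ∧ |n * y.2| < 1 / 2 := by
      have c1 : Continuous fun y : Plane => n * y.1 := by fun_prop
      have c2 : Continuous fun y : Plane => |n * y.2| := by fun_prop
      refine (c1.continuousAt.eventually (lt_mem_nhds ?_)).and
        (c2.continuousAt.eventually (gt_mem_nhds ?_))
      · have := mul_nonneg hn'.le hxQ.2
        linarith
      · simp only [hxQ.1]; norm_num
    filter_upwards [h1] with y hy
    have h2 := abs_lt.1 hy.2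
    have : slitBump ((n : ℝ) • y) = 1 := by
      simp only [slitBump, Prod.smul_fst, Prod.smul_snd, smul_eq_mul]
      rw [Real.smoothTransition.one_of_one_le (by linarith),
        Real.smoothTransition.one_of_one_le (by linarith),
        Real.smoothTransition.one_of_one_le (by linarith)]
      norm_num
    simp [this]
  · exact fun x => ⟨mul_nonneg (sub_nonneg.2 (slitBump_le_one _)) (squareBump_nonneg _),
      mul_le_one₀ (by linarith [slitBump_nonneg ((n : ℝ) • x)]) (squareBump_nonneg _)
        (squareBump_le_one _)⟩
  · intro x _ hx2 hx
    have e1 : slitBump ((n : ℝ) • x) = 0 := by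
      simp only [slitBump, Prod.smul_fst, Prod.smul_snd, smul_eq_mul]
      rcases le_abs.1 (show (1 : ℝ) ≤ |n * x.2| by rwa [abs_mul, abs_of_pos hn']) with h | h
      · rw [Real.smoothTransition.zero_of_nonpos (x := 2 - 2 * (n * x.2)) (by linarith)]; ring
      · rw [Real.smoothTransition.zero_of_nonpos (x := 2 + 2 * (n * x.2)) (by linarith)]; ring
    have z : ∀ t : ℝ, ‖t‖ ≤ n → Real.smoothTransition (2 - (n : ℝ)⁻¹ * t) *
        Real.smoothTransition (2 + (n : ℝ)⁻¹ * t) = 1 := fun t ht => by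
      have : |(n : ℝ)⁻¹ * t| ≤ 1 := by
        rw [abs_mul, abs_of_pos (inv_pos.2 hn'), inv_mul_le_iff₀ hn', mul_one]; exact ht
      have := abs_le.1 this
      rw [Real.smoothTransition.one_of_one_le (by linarith),
        Real.smoothTransition.one_of_one_le (by linarith), one_mul]
    have e2 : squareBump ((n : ℝ)⁻¹ • x) = 1 := by
      simp only [squareBump, Prod.smul_fst, Prod.smul_snd, smul_eq_mul]
      rw [z _ ((norm_fst_le x).trans hx), z _ ((norm_snd_le x).trans hx), one_mul]
    simp [e1, e2]
  · intro x hx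
    have hd1 := d1.differentiable one_ne_zero x
    have hd2 := d2.differentiable one_ne_zero x
    rw [fderiv_fun_mul (hd1.const_sub 1) hd2, fderiv_const_sub]
    have b1 : ‖fderiv ℝ (fun x : Plane => slitBump ((n : ℝ) • x)) x‖
        ≤ M * (slitStrip (n : ℝ)⁻¹).indicator (fun _ => (n : ℝ)) x := by
      by_cases hs : x ∈ slitStrip (n : ℝ)⁻¹
      · rw [indicator_of_mem hs]
        exact norm_fderiv_comp_smul_le hM0 hM1 hn'.le x
      · rw [indicator_of_notMem hs, mul_zero]
        refine (norm_eq_zero.2 ?_).le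
        -- Off the strip and off the axis the nonnegative bump is zero, hence minimal, so its
        -- derivative vanishes there without any computation.
        refine IsLocalMin.fderiv_eq_zero (.of_forall fun y => ?_)
        refine le_of_eq_of_le ?_ (slitBump_nonneg _)
        by_contra hne
        refine hs ?_
        simp only [slitBump, Prod.smul_fst, Prod.smul_snd, smul_eq_mul] at hne
        have p1 : 0 < 2 * (n * x.1) + 2 := not_le.1 fun h => hne (by
          rw [Real.smoothTransition.zero_of_nonpos h]; ring)
        have p2 : 0 < 2 - 2 * (n * x.2) := not_le.1 fun h => hne (by
          rw [Real.smoothTransition.zero_of_nonpos h]; ring)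
        have p3 : 0 < 2 + 2 * (n * x.2) := not_le.1 fun h => hne (by
          rw [Real.smoothTransition.zero_of_nonpos h]; ring)
        have q1 : -(n : ℝ)⁻¹ < x.1 := by
          rw [neg_lt, ← sub_pos]
          have : (n : ℝ)⁻¹ - -x.1 = (n : ℝ)⁻¹ * (1 + n * x.1) := by field_simp; ring
          rw [this]; exact mul_pos (inv_pos.2 hn') (by linarith)
        have q2 : x.2 < (n : ℝ)⁻¹ := by
          rw [← sub_pos]
          have : (n : ℝ)⁻¹ - x.2 = (n : ℝ)⁻¹ * (1 - n * x.2) := by field_simp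
          rw [this]; exact mul_pos (inv_pos.2 hn') (by linarith)
        have q3 : -(n : ℝ)⁻¹ < x.2 := by
          rw [neg_lt, ← sub_pos]
          have : (n : ℝ)⁻¹ - -x.2 = (n : ℝ)⁻¹ * (1 + n * x.2) := by field_simp; ring
          rw [this]; exact mul_pos (inv_pos.2 hn') (by linarith)
        rcases lt_or_gt_of_ne hx with h | h
        · exact Or.inr ⟨q1, q3, h⟩
        · exact Or.inl ⟨q1, h, q2⟩
    have b2 := norm_fderiv_comp_smul_le hM0 hM2 (inv_nonneg.2 hn'.le) x
    refine (norm_add_le _ _).trans ?_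
    rw [norm_smul, norm_smul, norm_neg, mul_add, add_comm]
    refine add_le_add ((mul_le_of_le_one_left (norm_nonneg _) ?_).trans b1)
      ((mul_le_of_le_one_left (norm_nonneg _) ?_).trans b2)
    · rw [Real.norm_of_nonneg (squareBump_nonneg _)]; exact squareBump_le_one _
    · rw [Real.norm_of_nonneg (sub_nonneg.2 (slitBump_le_one _))]
      linarith [slitBump_nonneg ((n : ℝ) • x)]

/-! ### The energy identity -/

theorem ae_snd_ne_zero : ∀ᵐ x : Plane, x.2 ≠ 0 := by
  have h : volume {x : Plane | x.2 = 0} = 0 := by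
    have : {x : Plane | x.2 = 0} = univ ×ˢ {0} := by ext x; simp
    rw [this, Measure.volume_eq_prod, Measure.prod_prod]; simp
  exact measure_eq_zero_iff_ae_notMem.1 h

/-- Test the Helmholtz equation with `conj v · η`. The cut-off makes all integrations by parts
legitimate, and the price is the term containing the gradient of `η`. -/
theorem energy_identity {v : Plane → ℂ} (hv : ContDiffOn ℝ 2 v Q) {ω : ℂ}
    (hH : ∀ x ∈ Q, planeLaplacian v x = -ω ^ 2 * v x) {η : Plane → ℝ} (hη : ContDiff ℝ 1 η)
    (hc : HasCompactSupport η) (hs : tsupport η ⊆ Q) :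
    ∫ x in Q, (η x : ℂ) * ((‖fderiv ℝ v x (1, 0)‖ ^ 2 + ‖fderiv ℝ v x (0, 1)‖ ^ 2 : ℝ) : ℂ)
      = ω ^ 2 * (∫ x in Q, (η x : ℂ) * ((‖v x‖ ^ 2 : ℝ) : ℂ))
        - ∫ x in Q, (starRingEnd ℂ) (v x) * (fderiv ℝ v x (1, 0) * (fderiv ℝ η x (1, 0) : ℂ)
          + fderiv ℝ v x (0, 1) * (fderiv ℝ η x (0, 1) : ℂ)) := by
  have hη' : ContDiff ℝ 1 fun x => (η x : ℂ) := Complex.ofRealCLM.contDiff.comp hη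
  have hc' : HasCompactSupport fun x => (η x : ℂ) :=
    hc.comp_left (g := fun t : ℝ => (t : ℂ)) Complex.ofReal_zero
  have hs' : tsupport (fun x => (η x : ℂ)) ⊆ Q :=
    (tsupport_comp_subset (g := fun t : ℝ => (t : ℂ)) Complex.ofReal_zero η).trans hs
  have hv1 : ContDiffOn ℝ 1 v Q := hv.of_le (by norm_num)
  have hcv : ContDiffOn ℝ 1 (fun x => (starRingEnd ℂ) (v x)) Q :=
    Complex.conjCLE.contDiff.comp_contDiffOn hv1
  have hφ : ContDiff ℝ 1 fun x => (starRingEnd ℂ) (v x) * (η x : ℂ) := by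
    exact_mod_cast ContDiffOn.mul_of_tsupport_subset (n := 1) (by exact_mod_cast hcv)
      (by exact_mod_cast hη') hs'
  have hφc : HasCompactSupport fun x => (starRingEnd ℂ) (v x) * (η x : ℂ) := hc'.mul_left
  have hφs : tsupport (fun x => (starRingEnd ℂ) (v x) * (η x : ℂ)) ⊆ Q :=
    tsupport_mul_subset_right.trans hs'
  have hG : ∀ e, ContDiffOn ℝ 1 (fun x => fderiv ℝ v x e) Q := fun e => by
    exact_mod_cast continuousOn_fderiv_apply (n := 1) (by exact_mod_cast hv) e
  have hdη : ∀ e x, fderiv ℝ (fun x => (η x : ℂ)) x e = (fderiv ℝ η x e : ℂ) := fun e x => by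
    have := (Complex.ofRealCLM.hasFDerivAt.comp x
      (hη.differentiable one_ne_zero x).hasFDerivAt).fderiv
    rw [Function.comp_def] at this
    change fderiv ℝ (fun x => Complex.ofRealCLM (η x)) x e = _
    rw [this]; rfl
  have hdφ : ∀ e, ∀ x ∈ Q, fderiv ℝ v x e *
      fderiv ℝ (fun x => (starRingEnd ℂ) (v x) * (η x : ℂ)) x e
      = (η x : ℂ) * ((‖fderiv ℝ v x e‖ ^ 2 : ℝ) : ℂ)
        + (starRingEnd ℂ) (v x) * (fderiv ℝ v x e * (fderiv ℝ η x e : ℂ)) := fun e x hx => by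
    have hvx : DifferentiableAt ℝ v x :=
      (hv1.contDiffAt (isOpen_Q.mem_nhds hx)).differentiableAt one_ne_zero
    have hcd : HasFDerivAt (fun x => (starRingEnd ℂ) (v x))
        ((Complex.conjCLE : ℂ →L[ℝ] ℂ).comp (fderiv ℝ v x)) x :=
      (Complex.conjCLE : ℂ →L[ℝ] ℂ).hasFDerivAt.comp x hvx.hasFDerivAt
    rw [fderiv_fun_mul hcd.differentiableAt (hη'.differentiable one_ne_zero x), hcd.fderiv]
    simp only [add_apply, smul_apply, smul_eq_mul, hdη]
    have := Complex.mul_conj' (fderiv ℝ v x e)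
    push_cast
    rw [← this]
    change _ * (_ + _ * (starRingEnd ℂ) (fderiv ℝ v x e)) = _
    ring
  have hibp : ∀ e, (∫ x in Q, fderiv ℝ v x e *
      fderiv ℝ (fun x => (starRingEnd ℂ) (v x) * (η x : ℂ)) x e)
      = -∫ x in Q, fderiv ℝ (fun y => fderiv ℝ v y e) x e * ((starRingEnd ℂ) (v x) * (η x : ℂ)) :=
    fun e => integral_mul_fderiv (hG e) hφ hφc hφs e
  have i0 : ∀ e, IntegrableOn (fun x => fderiv ℝ v x e *
      fderiv ℝ (fun x => (starRingEnd ℂ) (v x) * (η x : ℂ)) x e) Q := fun e =>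
    (integrable_mul_of_tsupport (hG e).continuousOn
      ((hφ.continuous_fderiv one_ne_zero).clm_apply continuous_const)
      ((hφc.fderiv (𝕜 := ℝ)).comp_left (g := fun L : Plane →L[ℝ] ℂ => L e) rfl)
      ((tsupport_fderiv_apply_subset' e).trans hφs)).integrableOn
  have i1 : ∀ e, IntegrableOn (fun x => fderiv ℝ (fun y => fderiv ℝ v y e) x e *
      ((starRingEnd ℂ) (v x) * (η x : ℂ))) Q := fun e =>
    (integrable_mul_of_tsupport (continuousOn_fderiv_fderiv hv e) hφ.continuous hφc
      hφs).integrableOn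
  have hsum : (∫ x in Q, fderiv ℝ v x (1, 0) *
        fderiv ℝ (fun x => (starRingEnd ℂ) (v x) * (η x : ℂ)) x (1, 0))
      + (∫ x in Q, fderiv ℝ v x (0, 1) *
        fderiv ℝ (fun x => (starRingEnd ℂ) (v x) * (η x : ℂ)) x (0, 1))
      = ω ^ 2 * (∫ x in Q, (η x : ℂ) * ((‖v x‖ ^ 2 : ℝ) : ℂ)) := by
    rw [hibp, hibp, ← neg_add, ← integral_add (i1 _) (i1 _), ← integral_const_mul, ← integral_neg]
    refine setIntegral_congr_fun isOpen_Q.measurableSet fun x hx => ?_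
    have h1 := hH x hx
    have h2 := Complex.mul_conj' (v x)
    simp only [planeLaplacian] at h1
    push_cast
    rw [← h2, ← add_mul, h1]
    ring
  rw [← hsum, ← integral_add (i0 _) (i0 _)]
  have hcG : ∀ e, ContinuousOn (fun x => ((‖fderiv ℝ v x e‖ ^ 2 : ℝ) : ℂ)) Q := fun e =>
    Complex.continuous_ofReal.comp_continuousOn ((hG e).continuousOn.norm.pow 2)
  have j1 : IntegrableOn (fun x => (η x : ℂ) *
      ((‖fderiv ℝ v x (1, 0)‖ ^ 2 + ‖fderiv ℝ v x (0, 1)‖ ^ 2 : ℝ) : ℂ)) Q := by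
    refine (integrable_mul_of_tsupport ((hcG (1, 0)).add (hcG (0, 1))) hη'.continuous hc'
      hs').integrableOn.congr (.of_forall fun x => ?_)
    simp only [Pi.add_apply, Complex.ofReal_add]; ring
  have j2 : IntegrableOn (fun x => (starRingEnd ℂ) (v x) *
      (fderiv ℝ v x (1, 0) * (fderiv ℝ η x (1, 0) : ℂ)
        + fderiv ℝ v x (0, 1) * (fderiv ℝ η x (0, 1) : ℂ))) Q := by
    have : ∀ e, IntegrableOn (fun x => (starRingEnd ℂ) (v x) * fderiv ℝ v x e *
        (fderiv ℝ η x e : ℂ)) Q := fun e => by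
      simp only [← hdη]
      exact (integrable_mul_of_tsupport (hcv.continuousOn.mul (hG e).continuousOn)
        ((hη'.continuous_fderiv one_ne_zero).clm_apply continuous_const)
        ((hc'.fderiv (𝕜 := ℝ)).comp_left (g := fun L : Plane →L[ℝ] ℂ => L e) rfl)
        ((tsupport_fderiv_apply_subset' e).trans hs')).integrableOn
    refine ((this (1, 0)).add (this (0, 1))).congr (.of_forall fun x => ?_)
    simp only [Pi.add_apply]; ring
  rw [eq_sub_iff_add_eq, ← integral_add j1 j2]
  refine setIntegral_congr_fun isOpen_Q.measurableSet fun x hx => ?_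
  rw [hdφ _ x hx, hdφ _ x hx]
  push_cast
  ring

/-- The error term in the energy identity is controlled by the energy in a strip around the
slit. -/
theorem enorm_cutoff_error_le {v : Plane → ℂ} (hv : ContDiffOn ℝ 2 v Q)
    (ht : HasDirichletTrace v fun _ => 0) {C : ℝ} (hC : 0 ≤ C) {n : ℕ} (hn : 0 < n)
    {η : Plane → ℝ} (hη : ∀ x, x.2 ≠ 0 → ‖fderiv ℝ η x‖
      ≤ C * ((slitStrip (n : ℝ)⁻¹).indicator (fun _ => (n : ℝ)) x + (n : ℝ)⁻¹)) :
    ‖∫ x in Q, (starRingEnd ℂ) (v x) * (fderiv ℝ v x (1, 0) * (fderiv ℝ η x (1, 0) : ℂ)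
        + fderiv ℝ v x (0, 1) * (fderiv ℝ η x (0, 1) : ℂ))‖ₑ
      ≤ ENNReal.ofReal C * (9 * (∫⁻ x in slitStrip (n : ℝ)⁻¹,
          (‖fderiv ℝ v x (1, 0)‖ₑ ^ 2 + ‖fderiv ℝ v x (0, 1)‖ₑ ^ 2))
        + ENNReal.ofReal (n : ℝ)⁻¹ * ∫⁻ x in Q, (‖v x‖ₑ ^ 2 +
          (‖fderiv ℝ v x (1, 0)‖ₑ ^ 2 + ‖fderiv ℝ v x (0, 1)‖ₑ ^ 2))) := by
  have hn' : (0 : ℝ) < n := by exact_mod_cast hn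
  set g : Plane → ENNReal := fun x => ‖fderiv ℝ v x (1, 0)‖ₑ ^ 2 + ‖fderiv ℝ v x (0, 1)‖ₑ ^ 2
    with hg
  set S := slitStrip (n : ℝ)⁻¹ with hS
  have hSm : MeasurableSet S := measurableSet_slitStrip _
  have hG : ∀ e, ContDiffOn ℝ 1 (fun x => fderiv ℝ v x e) Q := fun e => by
    exact_mod_cast continuousOn_fderiv_apply (n := 1) (by exact_mod_cast hv) e
  have hvm : AEMeasurable (fun x => ‖v x‖ₑ ^ 2) (volume.restrict Q) :=
    ((hv.continuousOn.aestronglyMeasurable isOpen_Q.measurableSet).enorm).pow_const 2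
  have hpt : ∀ x : Plane, x.2 ≠ 0 →
      ‖(starRingEnd ℂ) (v x) * (fderiv ℝ v x (1, 0) * (fderiv ℝ η x (1, 0) : ℂ)
        + fderiv ℝ v x (0, 1) * (fderiv ℝ η x (0, 1) : ℂ))‖ₑ
      ≤ ENNReal.ofReal C * (S.indicator (fun x => ENNReal.ofReal n ^ 2 * ‖v x‖ₑ ^ 2 + g x) x
        + ENNReal.ofReal (n : ℝ)⁻¹ * (‖v x‖ₑ ^ 2 + g x)) := fun x hx => by
    set a := ‖v x‖
    set b := ‖fderiv ℝ v x (1, 0)‖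
    set c := ‖fderiv ℝ v x (0, 1)‖
    have e1 : ‖((1, 0) : Plane)‖ = 1 := by simp [Prod.norm_def]
    have e2 : ‖((0, 1) : Plane)‖ = 1 := by simp [Prod.norm_def]
    have l1 := (fderiv ℝ η x).le_opNorm (1, 0)
    have l2 := (fderiv ℝ η x).le_opNorm (0, 1)
    rw [e1, mul_one] at l1
    rw [e2, mul_one] at l2
    have h1 : ‖(starRingEnd ℂ) (v x) * (fderiv ℝ v x (1, 0) * (fderiv ℝ η x (1, 0) : ℂ)
        + fderiv ℝ v x (0, 1) * (fderiv ℝ η x (0, 1) : ℂ))‖ ≤ a * (b + c) * ‖fderiv ℝ η x‖ := by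
      rw [norm_mul, RCLike.norm_conj, mul_assoc]
      refine mul_le_mul_of_nonneg_left ((norm_add_le _ _).trans ?_) (norm_nonneg _)
      rw [norm_mul, norm_mul, Complex.norm_real, Complex.norm_real, add_mul]
      gcongr
    have ha : 0 ≤ a := norm_nonneg _
    have hb : 0 ≤ b := norm_nonneg _
    have hc : 0 ≤ c := norm_nonneg _
    -- The weight `n²` on `|v|²` is what the strip inequality with `ε = 1/n` cancels: it returns `8`
    -- times the gradient energy, and with the energy already present this gives the constant `9`.
    have hna : (n : ℝ) * (a * (b + c)) ≤ n ^ 2 * a ^ 2 + (b ^ 2 + c ^ 2) := by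
      nlinarith [sq_nonneg (n * a - b), sq_nonneg (n * a - c), sq_nonneg b, sq_nonneg c]
    have hab : a * (b + c) ≤ a ^ 2 + (b ^ 2 + c ^ 2) := by
      nlinarith [sq_nonneg (a - b), sq_nonneg (a - c), sq_nonneg b, sq_nonneg c]
    have hgx : g x = ENNReal.ofReal (b ^ 2 + c ^ 2) := by
      rw [ENNReal.ofReal_add (sq_nonneg _) (sq_nonneg _), ENNReal.ofReal_pow hb,
        ENNReal.ofReal_pow hc, ofReal_norm, ofReal_norm]
    have hax : ‖v x‖ₑ ^ 2 = ENNReal.ofReal (a ^ 2) := by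
      rw [ENNReal.ofReal_pow ha, ofReal_norm]
    rw [← ofReal_norm]
    refine (ENNReal.ofReal_le_ofReal (h1.trans
      (mul_le_mul_of_nonneg_left (hη x hx) (by positivity)))).trans ?_
    have hi : 0 ≤ (n : ℝ)⁻¹ := by positivity
    by_cases hxS : x ∈ S
    · rw [indicator_of_mem hxS, indicator_of_mem hxS, hgx, hax, ← ENNReal.ofReal_pow hn'.le,
        ← ENNReal.ofReal_mul (by positivity), ← ENNReal.ofReal_add (by positivity) (by positivity),
        ← ENNReal.ofReal_add (by positivity) (by positivity), ← ENNReal.ofReal_mul hi,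
        ← ENNReal.ofReal_add (by positivity) (by positivity), ← ENNReal.ofReal_mul hC]
      refine ENNReal.ofReal_le_ofReal ?_
      have := mul_le_mul_of_nonneg_left (add_le_add hna (mul_le_mul_of_nonneg_left hab hi)) hC
      linarith
    · rw [indicator_of_notMem hxS, indicator_of_notMem hxS, hgx, hax, zero_add, zero_add,
        ← ENNReal.ofReal_add (by positivity) (by positivity), ← ENNReal.ofReal_mul hi,
        ← ENNReal.ofReal_mul hC]
      refine ENNReal.ofReal_le_ofReal ?_
      have := mul_le_mul_of_nonneg_left (mul_le_mul_of_nonneg_left hab hi) hC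
      linarith
  have hind : ∫⁻ x in Q, S.indicator (fun x => ENNReal.ofReal n ^ 2 * ‖v x‖ₑ ^ 2 + g x) x
      ≤ 9 * ∫⁻ x in S, g x := by
    rw [setLIntegral_indicator hSm, inter_eq_left.2 (slitStrip_subset_Q _),
      lintegral_add_left' ((hvm.mono_measure
        (Measure.restrict_mono_set _ (slitStrip_subset_Q _))).const_mul _),
      lintegral_const_mul' _ _ (by simp)]
    have h := lintegral_slitStrip_le (hv.of_le (by norm_num)) ht (inv_pos.2 hn')
    calc _ ≤ ENNReal.ofReal n ^ 2 * (8 * ENNReal.ofReal (n : ℝ)⁻¹ ^ 2 * ∫⁻ x in S, g x)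
          + ∫⁻ x in S, g x := by gcongr
      _ = 8 * (ENNReal.ofReal n * ENNReal.ofReal (n : ℝ)⁻¹) ^ 2 * (∫⁻ x in S, g x)
          + ∫⁻ x in S, g x := by ring
      _ = _ := by
          rw [← ENNReal.ofReal_mul hn'.le, mul_inv_cancel₀ hn'.ne', ENNReal.ofReal_one]
          ring
  refine (enorm_integral_le_lintegral_enorm _).trans ?_
  calc _ ≤ ∫⁻ x in Q, ENNReal.ofReal C *
          (S.indicator (fun x => ENNReal.ofReal n ^ 2 * ‖v x‖ₑ ^ 2 + g x) x
          + ENNReal.ofReal (n : ℝ)⁻¹ * (‖v x‖ₑ ^ 2 + g x)) :=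
        lintegral_mono_ae ((ae_restrict_of_ae ae_snd_ne_zero).mono hpt)
    _ = ENNReal.ofReal C * ((∫⁻ x in Q, S.indicator
          (fun x => ENNReal.ofReal n ^ 2 * ‖v x‖ₑ ^ 2 + g x) x)
          + ENNReal.ofReal (n : ℝ)⁻¹ * ∫⁻ x in Q, (‖v x‖ₑ ^ 2 + g x)) := by
        have hgm : AEMeasurable g (volume.restrict Q) :=
          ((((hG _).continuousOn.aestronglyMeasurable isOpen_Q.measurableSet).enorm).pow_const
            2).add ((((hG _).continuousOn.aestronglyMeasurable
              isOpen_Q.measurableSet).enorm).pow_const 2)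
        rw [lintegral_const_mul' _ _ (by simp), lintegral_add_left', lintegral_const_mul' _ _
          (by simp)]
        exact ((hvm.const_mul _).add hgm).indicator hSm
    _ ≤ _ := by gcongr

theorem eventually_notMem_slitStrip {x : Plane} (hx : x.2 ≠ 0) :
    ∀ᶠ n : ℕ in atTop, x ∉ slitStrip (n : ℝ)⁻¹ := by
  have h1 : ∀ᶠ n : ℕ in atTop, (n : ℝ)⁻¹ < |x.2| :=
    (tendsto_inv_atTop_nhds_zero_nat (𝕜 := ℝ)).eventually (gt_mem_nhds (abs_pos.2 hx))
  filter_upwards [h1] with n hn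
  rintro (h | h)
  · rw [abs_of_pos h.2.1] at hn; linarith [h.2.2]
  · rw [abs_of_neg h.2.2] at hn; linarith [h.2.1]

/-- Uniqueness of the solution of the Dirichlet problem for the Helmholtz equation in `Q`. -/
theorem eqOn_zero_of_helmholtz {v : Plane → ℂ} (hv : ContDiffOn ℝ 2 v Q) (h1 : MemH1 v) {ω : ℂ}
    (hω : 0 < ω.im) (hH : ∀ x ∈ Q, planeLaplacian v x = -ω ^ 2 * v x)
    (ht : HasDirichletTrace v fun _ => 0) : EqOn v 0 Q := by
  obtain ⟨C, η, hC, hη⟩ := exists_slit_cutoffs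
  have hG1 := memLp_fderiv_of_memH1 (hv.of_le (by norm_num)) h1 (e := (1, 0)) (by simp)
  have hG2 := memLp_fderiv_of_memH1 (hv.of_le (by norm_num)) h1 (e := (0, 1)) (by simp)
  have iv := h1.1.integrable_norm_pow two_ne_zero
  have ig1 := hG1.integrable_norm_pow two_ne_zero
  have ig2 := hG2.integrable_norm_pow two_ne_zero
  have ig := ig1.add ig2
  have fin : ∀ {w : Plane → ℂ}, MemLp w 2 (volume.restrict Q) →
      ∫⁻ x in Q, ‖w x‖ₑ ^ 2 ≠ ⊤ := fun {w} hw => by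
    have := hw.eLpNorm_ne_top
    have e := eLpNorm_nnreal_pow_eq_lintegral (f := w) (μ := volume.restrict Q) (p := 2) two_ne_zero
    have e' : eLpNorm w 2 (volume.restrict Q) ^ 2 = ∫⁻ x in Q, ‖w x‖ₑ ^ 2 := by simpa using e
    rw [← e']
    exact ENNReal.pow_ne_top this
  have meas : ∀ {w : Plane → ℂ}, MemLp w 2 (volume.restrict Q) →
      AEMeasurable (fun x => ‖w x‖ₑ ^ 2) (volume.restrict Q) := fun hw =>
    (hw.1.enorm).pow_const 2
  set g : Plane → ENNReal := fun x => ‖fderiv ℝ v x (1, 0)‖ₑ ^ 2 + ‖fderiv ℝ v x (0, 1)‖ₑ ^ 2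
    with hg
  have hgm : AEMeasurable g (volume.restrict Q) := (meas hG1).add (meas hG2)
  have hgfin : ∫⁻ x in Q, g x ≠ ⊤ := by
    rw [lintegral_add_left' (meas hG1)]
    exact ENNReal.add_ne_top.2 ⟨fin hG1, fin hG2⟩
  have hgvfin : ∫⁻ x in Q, (‖v x‖ₑ ^ 2 + g x) ≠ ⊤ := by
    rw [lintegral_add_left' (meas h1.1)]
    exact ENNReal.add_ne_top.2 ⟨fin h1.1, hgfin⟩
  -- The strips shrink to a subset of the axis, a null set, and the gradient energy is finite.
  have hstrip : Tendsto (fun n : ℕ => ∫⁻ x in slitStrip (n : ℝ)⁻¹, g x) atTop (𝓝 0) := by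
    have e : ∀ n : ℕ, ∫⁻ x in slitStrip (n : ℝ)⁻¹, g x
        = ∫⁻ x in Q, (slitStrip (n : ℝ)⁻¹).indicator g x := fun n => by
      rw [setLIntegral_indicator (measurableSet_slitStrip _),
        inter_eq_left.2 (slitStrip_subset_Q _)]
    simp_rw [e]
    have := tendsto_lintegral_of_dominated_convergence' (μ := volume.restrict Q)
      (F := fun n : ℕ => (slitStrip (n : ℝ)⁻¹).indicator g) (f := fun _ => 0) g
      (fun n => hgm.indicator (measurableSet_slitStrip _))
      (fun n => .of_forall fun x => indicator_le_self _ _ x) hgfin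
      ((ae_restrict_of_ae ae_snd_ne_zero).mono fun x hx => by
        refine tendsto_const_nhds.congr' ?_
        filter_upwards [eventually_notMem_slitStrip hx] with n hn
        rw [indicator_of_notMem hn])
    simpa using this
  have herr : Tendsto (fun n : ℕ => ∫ x in Q, (starRingEnd ℂ) (v x) *
      (fderiv ℝ v x (1, 0) * (fderiv ℝ (η n) x (1, 0) : ℂ)
        + fderiv ℝ v x (0, 1) * (fderiv ℝ (η n) x (0, 1) : ℂ))) atTop (𝓝 0) := by
    rw [tendsto_zero_iff_enorm_tendsto_zero]
    have hb : Tendsto (fun n : ℕ => ENNReal.ofReal C * (9 * (∫⁻ x in slitStrip (n : ℝ)⁻¹, g x)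
        + ENNReal.ofReal (n : ℝ)⁻¹ * ∫⁻ x in Q, (‖v x‖ₑ ^ 2 + g x))) atTop (𝓝 0) := by
      have a1 := ENNReal.Tendsto.const_mul (a := 9) hstrip (Or.inr (by simp))
      have a2 : Tendsto (fun n : ℕ => ENNReal.ofReal (n : ℝ)⁻¹) atTop (𝓝 0) := by
        have := ENNReal.tendsto_ofReal (tendsto_inv_atTop_nhds_zero_nat (𝕜 := ℝ))
        rwa [ENNReal.ofReal_zero] at this
      have a3 := ENNReal.Tendsto.mul_const a2 (b := ∫⁻ x in Q, (‖v x‖ₑ ^ 2 + g x)) (Or.inr hgvfin)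
      have := ENNReal.Tendsto.const_mul (a := ENNReal.ofReal C) (a1.add a3) (Or.inr (by simp))
      simpa using this
    refine tendsto_of_tendsto_of_tendsto_of_le_of_le' tendsto_const_nhds hb
      (.of_forall fun _ => zero_le) ?_
    filter_upwards [eventually_gt_atTop 0] with n hn
    exact enorm_cutoff_error_le hv ht hC hn (hη n hn).2.2.2.2.2
  have hone : ∀ᵐ x ∂(volume.restrict Q), ∀ᶠ n : ℕ in atTop, η n x = 1 :=
    (ae_restrict_of_ae ae_snd_ne_zero).mono fun x hx => by
      have t : Tendsto (fun n : ℕ => (n : ℝ) * |x.2|) atTop atTop :=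
        tendsto_natCast_atTop_atTop.atTop_mul_const (abs_pos.2 hx)
      filter_upwards [t.eventually_ge_atTop 1, eventually_gt_atTop 0,
        tendsto_natCast_atTop_atTop.eventually_ge_atTop ‖x‖] with n h1 h2 h3
      exact (hη n h2).2.2.2.2.1 x hx h1 h3
  have hlim : ∀ k : Plane → ℝ, Integrable k (volume.restrict Q) →
      Tendsto (fun n : ℕ => ∫ x in Q, (η n x : ℂ) * (k x : ℂ)) atTop
        (𝓝 (∫ x in Q, (k x : ℂ))) := fun k hk => by
    refine tendsto_integral_filter_of_dominated_convergence (fun x => ‖k x‖) ?_ ?_ hk.norm ?_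
    · filter_upwards [eventually_gt_atTop 0] with n hn
      exact ((Complex.continuous_ofReal.comp (hη n hn).1.continuous).aestronglyMeasurable).mul
        (Complex.continuous_ofReal.comp_aestronglyMeasurable hk.1)
    · filter_upwards [eventually_gt_atTop 0] with n hn
      refine .of_forall fun x => ?_
      rw [norm_mul, Complex.norm_real, Complex.norm_real,
        Real.norm_of_nonneg ((hη n hn).2.2.2.1 x).1]
      exact mul_le_of_le_one_left (norm_nonneg _) ((hη n hn).2.2.2.1 x).2
    · filter_upwards [hone] with x hx
      refine tendsto_const_nhds.congr' ?_
      filter_upwards [hx] with n hn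
      rw [hn]; simp
  have hid : (∫ x in Q, ((‖fderiv ℝ v x (1, 0)‖ ^ 2 + ‖fderiv ℝ v x (0, 1)‖ ^ 2 : ℝ) : ℂ))
      = ω ^ 2 * ∫ x in Q, ((‖v x‖ ^ 2 : ℝ) : ℂ) := by
    have l1 := hlim _ ig
    have l2 := ((hlim _ iv).const_mul (ω ^ 2)).sub herr
    rw [sub_zero] at l2
    refine tendsto_nhds_unique l1 (l2.congr' ?_)
    filter_upwards [eventually_gt_atTop 0] with n hn
    exact (energy_identity hv hH (hη n hn).1 (hη n hn).2.1 (hη n hn).2.2.1).symm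
  rw [integral_complex_ofReal, integral_complex_ofReal] at hid
  set A := ∫ x in Q, (‖fderiv ℝ v x (1, 0)‖ ^ 2 + ‖fderiv ℝ v x (0, 1)‖ ^ 2)
  set B := ∫ x in Q, ‖v x‖ ^ 2 with hB
  have hA0 : 0 ≤ A := integral_nonneg fun x => by positivity
  have hB0 : 0 ≤ B := integral_nonneg fun x => by positivity
  -- If `B > 0`, the imaginary part `2 Re ω Im ω B = 0` forces `Re ω = 0`; the real part then reads
  -- `A = -(Im ω)² B < 0`, contradicting `A ≥ 0`.
  have hBz : B = 0 := by
    have hre := congrArg Complex.re hid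
    have him := congrArg Complex.im hid
    simp only [Complex.ofReal_re, Complex.ofReal_im, Complex.mul_re, Complex.mul_im, pow_two,
      mul_zero, sub_zero, zero_add] at hre him
    by_contra hne
    have hBp : 0 < B := lt_of_le_of_ne hB0 (Ne.symm hne)
    have h3 : ω.re = 0 := by
      have h4 : ω.re * (2 * ω.im * B) = 0 := by linarith
      exact (mul_eq_zero.1 h4).resolve_right (by positivity)
    rw [h3] at hre
    have : 0 < ω.im * ω.im * B := by positivity
    linarith
  have hae : v =ᵐ[volume.restrict Q] 0 := by
    have := (integral_eq_zero_iff_of_nonneg (fun x => by positivity) iv).1 hBz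
    filter_upwards [this] with x hx
    simpa using hx
  exact Measure.eqOn_open_of_ae_eq hae isOpen_Q hv.continuousOn continuousOn_const

/-! ### Uniqueness for the mixed problem -/

theorem memH1_of_contDiffOn {v : Plane → ℂ} (hv : ContDiffOn ℝ 1 v Q)
    (h0 : MemLp v 2 (volume.restrict Q))
    (h1 : ∀ e ∈ ({(1, 0), (0, 1)} : Set Plane),
      MemLp (fun x => fderiv ℝ v x e) 2 (volume.restrict Q)) : MemH1 v :=
  ⟨h0, fun e he => ⟨_, h1 e he, fun _ hφ hc hs =>
    integral_mul_fderiv hv (hφ.of_le (by exact_mod_cast le_top)) hc hs e⟩⟩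

theorem MemH1.sub_of_contDiffOn {v w : Plane → ℂ} (hv : ContDiffOn ℝ 1 v Q)
    (hw : ContDiffOn ℝ 1 w Q) (h1 : MemH1 v) (h2 : MemH1 w) : MemH1 fun x => v x - w x := by
  refine memH1_of_contDiffOn (hv.sub hw) (h1.1.sub h2.1) fun e he => ?_
  refine (memLp_congr_ae ?_).1
    ((memLp_fderiv_of_memH1 hv h1 he).sub (memLp_fderiv_of_memH1 hw h2 he))
  refine (ae_restrict_iff' isOpen_Q.measurableSet).2 (.of_forall fun x hx => ?_)
  simp only [Pi.sub_apply]
  rw [fderiv_fun_sub ((hv.contDiffAt (isOpen_Q.mem_nhds hx)).differentiableAt one_ne_zero)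
    ((hw.contDiffAt (isOpen_Q.mem_nhds hx)).differentiableAt one_ne_zero)]
  rfl

/-- The Fourier–Laplace transform of `τ ↦ e^{-iω₀τ} f(τ)`. -/
def profileTransform (ω₀ : ℝ) (f : ℝ → ℂ) (ω : ℂ) : ℂ :=
  ∫ τ in Ioi (0 : ℝ), Complex.exp (Complex.I * (ω - ω₀) * τ) * f τ

theorem setIntegral_delay {k : ℝ → ℂ} (hk : ∀ τ < 0, k τ = 0) {c : ℝ} (hc : 0 ≤ c) :
    ∫ t in Ioi (0 : ℝ), k (t - c) = ∫ τ in Ioi (0 : ℝ), k τ := by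
  have h : ∀ c : ℝ, 0 ≤ c → ∫ t in Ioi (0 : ℝ), k (t - c) = ∫ t, k (t - c) := fun c hc => by
    rw [← integral_Ici_eq_integral_Ioi]
    exact setIntegral_eq_integral_of_forall_compl_eq_zero fun t ht =>
      hk _ (by rw [mem_Ici, not_le] at ht; linarith)
  have h0 := h 0 le_rfl
  simp only [sub_zero] at h0
  rw [h c hc, h0, integral_sub_right_eq_self k c]

/-- On the slit the incident wave is the profile delayed by `cos(π+α) s`. The delay is positive
because `cos(π+α) > 0`, so the transform picks up only an exponential factor. -/
theorem fourierLaplaceFun_data {α ω₀ : ℝ} (h1 : 0 < Real.cos (Real.pi + α)) {f : ℝ → ℂ}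
    (hf : ∀ s < 0, f s = 0) (ω : ℂ) {s : ℝ} (hs : 0 < s) :
    fourierLaplaceFun (fun t => -incidentWave ω₀ α f (s, 0) t) ω
      = -(profileTransform ω₀ f ω
        * Complex.exp (Complex.I * ω * (Real.cos (Real.pi + α) * s : ℝ))) := by
  set c := Real.cos (Real.pi + α) * s with hc
  have hcp : 0 < c := mul_pos h1 hs
  have hph : phase α (s, 0) = c := by simp [phase, hc]
  have := setIntegral_delay (k := fun τ => Complex.exp (Complex.I * (ω - ω₀) * τ) * f τ)
    (fun τ hτ => by simp only [hf τ hτ, mul_zero]) hcp.le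
  rw [fourierLaplaceFun, profileTransform, ← this, ← integral_mul_const, ← integral_neg]
  refine integral_congr_ae (.of_forall fun t => ?_)
  simp only [incidentWave, hph]
  rw [mul_neg, neg_inj, ← mul_assoc, ← Complex.exp_add,
    mul_right_comm (Complex.exp _) (f _), ← Complex.exp_add]
  congr 2
  push_cast
  ring

theorem slice_mem_Q {s ε : ℝ} (hε : ε ≠ 0) : ((s, ε) : Plane) ∈ Q := fun h => hε h.1

theorem continuous_slice {v : Plane → ℂ} (hv : ContinuousOn v Q) {ε : ℝ} (hε : ε ≠ 0) :
    Continuous fun s : ℝ => v (s, ε) :=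
  hv.comp_continuous (by fun_prop) fun _ => slice_mem_Q hε

theorem HasDirichletTrace.sub {v w : Plane → ℂ} {g : ℝ → ℂ} (hv : ContinuousOn v Q)
    (hw : ContinuousOn w Q) (hg : AEStronglyMeasurable g (volume.restrict (Ioi 0)))
    (h1 : HasDirichletTrace v g) (h2 : HasDirichletTrace w g) :
    HasDirichletTrace (fun x => v x - w x) fun _ => 0 := by
  have key : ∀ δ : ℝ → ℝ, (∀ᶠ ε in 𝓝[>] (0 : ℝ), δ ε ≠ 0) →
      Tendsto (fun ε : ℝ => eLpNorm (fun s => v (s, δ ε) - g s) 2 (volume.restrict (Ioi 0)))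
        (𝓝[>] 0) (𝓝 0) →
      Tendsto (fun ε : ℝ => eLpNorm (fun s => w (s, δ ε) - g s) 2 (volume.restrict (Ioi 0)))
        (𝓝[>] 0) (𝓝 0) →
      Tendsto (fun ε : ℝ => eLpNorm (fun s => v (s, δ ε) - w (s, δ ε) - 0) 2
        (volume.restrict (Ioi 0))) (𝓝[>] 0) (𝓝 0) := fun δ hδ t1 t2 => by
    have t := t1.add t2
    rw [add_zero] at t
    refine tendsto_of_tendsto_of_tendsto_of_le_of_le' tendsto_const_nhds t
      (.of_forall fun _ => zero_le) ?_
    filter_upwards [hδ] with ε hε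
    have e : (fun s => v (s, δ ε) - w (s, δ ε) - 0)
        = (fun s => v (s, δ ε) - g s) - fun s => w (s, δ ε) - g s := by
      ext s; simp
    rw [e]
    exact eLpNorm_sub_le ((continuous_slice hv hε).aestronglyMeasurable.sub hg)
      ((continuous_slice hw hε).aestronglyMeasurable.sub hg) one_le_two
  exact ⟨key id (eventually_mem_nhdsWithin.mono fun _ hε => (ne_of_gt hε)) h1.1 h2.1,
    key (fun ε => -ε) (eventually_mem_nhdsWithin.mono fun _ hε => neg_ne_zero.2 (ne_of_gt hε))
      h1.2 h2.2⟩

theorem HasDirichletTrace.congr {v w : Plane → ℂ} {g : ℝ → ℂ} (h : EqOn v w Q)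
    (hv : HasDirichletTrace v g) : HasDirichletTrace w g := by
  refine ⟨hv.1.congr' ?_, hv.2.congr' ?_⟩
  · filter_upwards [self_mem_nhdsWithin] with ε hε
    simp only [h (slice_mem_Q (ne_of_gt hε))]
  · filter_upwards [self_mem_nhdsWithin] with ε hε
    simp only [h (slice_mem_Q (neg_ne_zero.2 (ne_of_gt hε)))]

/-- Membership in the class `𝓜` and the boundary condition each come with their own representative
of the transform; this identifies the two on `Q`. -/
theorem HasFourierLaplaceTransform.eqOn {u : 𝓢'(SpaceTime, ℂ)} {U V : ℂ → Plane → ℂ}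
    (hU : HasFourierLaplaceTransform u U) (hV : HasFourierLaplaceTransform u V) {ω : ℂ}
    (hω : 0 < ω.im) (hUc : ContinuousOn (U ω) Q) (hVc : ContinuousOn (V ω) Q) :
    EqOn (U ω) (V ω) Q := by
  have h := eqOn_zero_of_integral_eq_zero (hUc.sub hVc) fun φ hφ hc hs => by
    have h1 := hU ω hω (hc.toSchwartzMap hφ)
    have h2 := hV ω hω (hc.toSchwartzMap hφ)
    have h3 := h1.2.symm.trans h2.2
    rw [← sub_eq_zero, ← integral_sub h1.1 h2.1] at h3
    rw [← h3]
    refine integral_congr_ae (.of_forall fun x => ?_)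
    simp only [Pi.sub_apply, HasCompactSupport.toSchwartzMap_toFun]
    ring
  exact fun x hx => sub_eq_zero.1 (h hx)

theorem HasFourierLaplaceTransform.sub {u v : 𝓢'(SpaceTime, ℂ)} {U V : ℂ → Plane → ℂ}
    (hU : HasFourierLaplaceTransform u U) (hV : HasFourierLaplaceTransform v V) :
    HasFourierLaplaceTransform (u - v) fun ω x => U ω x - V ω x := fun ω hω φ => by
  have h1 := hU ω hω φ
  have h2 := hV ω hω φ
  have e : (fun x => (U ω x - V ω x) * φ x) = fun x => U ω x * φ x - V ω x * φ x := by
    ext x; ring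
  rw [e]
  refine ⟨h1.1.sub h2.1, ?_⟩
  rw [integral_sub h1.1 h2.1, ← h1.2, ← h2.2]
  rfl

theorem isVanishingOn_sub {u v : 𝓢'(SpaceTime, ℂ)} {s : Set SpaceTime} (hu : IsVanishingOn u s)
    (hv : IsVanishingOn v s) : IsVanishingOn (u - v) s := fun φ hφ => by
  have : (u - v) φ = u φ - v φ := rfl
  rw [this, hu φ hφ, hv φ hφ, sub_zero]

theorem dAlembert_sub (u v : 𝓢'(SpaceTime, ℂ)) :
    dAlembert (u - v) = dAlembert u - dAlembert v := by
  ext Φ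
  have h : ∀ (u v : 𝓢'(SpaceTime, ℂ)) Φ, (u - v) Φ = u Φ - v Φ := fun _ _ _ => rfl
  rw [h, dAlembert_apply, dAlembert_apply, dAlembert_apply, h, h, h]
  ring

theorem solution_unique {ω₀ α : ℝ} (h1 : 0 < Real.cos (Real.pi + α)) {f : ℝ → ℂ}
    (hf : ∀ s < 0, f s = 0) {u v : 𝓢'(SpaceTime, ℂ)} (hu : ClassM u) (hv : ClassM v)
    (hu' : SolvesScattering ω₀ α f u) (hv' : SolvesScattering ω₀ α f v) : u = v := by
  obtain ⟨hu0, U, hU, hUh, hU1⟩ := hu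
  obtain ⟨hv0, V, hV, hVh, hV1⟩ := hv
  obtain ⟨U', hU', hUb⟩ := hu'.boundary
  obtain ⟨V', hV', hVb⟩ := hv'.boundary
  have h0 : IsVanishingOn (u - v) {p : SpaceTime | p.2 < 0} := isVanishingOn_sub hu0 hv0
  have hW := hU.sub hV
  have hwave : IsVanishingOn (dAlembert (u - v)) (Q ×ˢ univ) := by
    rw [dAlembert_sub]; exact isVanishingOn_sub hu'.wave hv'.wave
  have hzero : ∀ ω : ℂ, 0 < ω.im → EqOn (fun x => U ω x - V ω x) 0 Q := fun ω hω => by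
    have hU2 := (hUh ω hω).1
    have hV2 := (hVh ω hω).1
    have tU := (hUb ω hω).2.congr (hU'.eqOn hU hω (hUb ω hω).1.continuousOn hU2.continuousOn)
    have tV := (hVb ω hω).2.congr (hV'.eqOn hV hω (hVb ω hω).1.continuousOn hV2.continuousOn)
    have hg : AEStronglyMeasurable (fun s : ℝ => fourierLaplaceFun
        (fun t => -incidentWave ω₀ α f (s, 0) t) ω) (volume.restrict (Ioi 0)) := by
      have hc : Continuous fun s : ℝ => -(profileTransform ω₀ f ω
        * Complex.exp (Complex.I * ω * (Real.cos (Real.pi + α) * s : ℝ))) := by fun_prop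
      refine hc.aestronglyMeasurable.congr ?_
      refine (ae_restrict_iff' measurableSet_Ioi).2 (.of_forall fun s hs => ?_)
      exact (fourierLaplaceFun_data h1 hf ω hs).symm
    exact eqOn_zero_of_helmholtz (hU2.sub hV2)
      (MemH1.sub_of_contDiffOn (hU2.of_le (by norm_num)) (hV2.of_le (by norm_num)) (hU1 ω hω)
        (hV1 ω hω)) hω
      (fun x hx => helmholtz_of_wave (u - v) h0 hW hwave ω hω (hU2.sub hV2) hx)
      (tU.sub hU2.continuousOn hV2.continuousOn hg tV)
  -- Injectivity is applied on the whole plane, not only on `Q`: the transform is a function and the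
  -- slit is null, so the difference has no part concentrated on the slit.
  have hvan := isVanishingOn_of_fourierLaplace_eq_zero (O := univ) (u - v) isOpen_univ h0
    fun ω hω φ _ _ => by
      rw [(hW ω hω φ).2, setIntegral_congr_fun isOpen_Q.measurableSet (g := fun _ => 0)
        fun x hx => ?_]
      · simp
      · have := hzero ω hω hx
        simp only [Pi.zero_apply] at this
        simp only [this, zero_mul]
  rw [← sub_eq_zero]
  ext Φ
  exact hvan Φ (by simp)

/-! ### The complementary error function -/

/-- An entire function has a primitive with prescribed value at `0`. The derivative and the value at
`0` are all that is used below; the limit at infinity is not. -/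
theorem exists_erfc : ∃ E : ℂ → ℂ, E 0 = 1 ∧
    ∀ z, HasDerivAt E (-(2 / (Real.sqrt Real.pi : ℂ)) * Complex.exp (-z ^ 2)) z := by
  have hd : Differentiable ℂ fun z : ℂ =>
      -(2 / (Real.sqrt Real.pi : ℂ)) * Complex.exp (-z ^ 2) := by fun_prop
  obtain ⟨E, h0, hE⟩ := hd.isExactOn_univ.with_val_at 0 1
  exact ⟨E, h0, fun z => hE z (mem_univ z)⟩

/-- The complementary error function. -/
def erfc : ℂ → ℂ := exists_erfc.choose

theorem erfc_zero : erfc 0 = 1 := exists_erfc.choose_spec.1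

theorem hasDerivAt_erfc (z : ℂ) :
    HasDerivAt erfc (-(2 / (Real.sqrt Real.pi : ℂ)) * Complex.exp (-z ^ 2)) z :=
  exists_erfc.choose_spec.2 z

theorem differentiable_erfc : Differentiable ℂ erfc := fun z => (hasDerivAt_erfc z).differentiableAt

/-- The derivative of `erfc` is even, so `erfc w + erfc(-w)` is constant. This identity produces the
boundary values of the scattered wave. -/
theorem erfc_neg (z : ℂ) : erfc (-z) = 2 - erfc z := by
  have h : ∀ w, HasDerivAt (fun w => erfc (-w) + erfc w) 0 w := fun w => by
    have h1 := (hasDerivAt_erfc (-w)).comp w (hasDerivAt_neg w)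
    have h2 := h1.add (hasDerivAt_erfc w)
    refine h2.congr_deriv ?_
    rw [neg_sq]; ring
  have h2 := is_const_of_deriv_eq_zero (fun w => (h w).differentiableAt) (fun w => (h w).deriv) z 0
  simp only [neg_zero, erfc_zero] at h2
  linear_combination h2

/-! ### The principal square root -/

/-- The principal branch of the complex square root. -/
def csqrt (z : ℂ) : ℂ := z ^ (1 / 2 : ℂ)

theorem csqrt_sq (z : ℂ) : csqrt z ^ 2 = z := by
  have := Complex.cpow_nat_inv_pow z two_ne_zero
  rw [csqrt, one_div]; exact_mod_cast this

theorem csqrt_ne_zero {z : ℂ} (hz : z ≠ 0) : csqrt z ≠ 0 := fun h => hz (by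
  rw [← csqrt_sq z, h]; simp)

theorem hasDerivAt_csqrt {z : ℂ} (hz : z ∈ Complex.slitPlane) :
    HasDerivAt csqrt (1 / (2 * csqrt z)) z := by
  have h : HasDerivAt csqrt (1 / 2 * z ^ (1 / 2 - 1 : ℂ)) z :=
    (Complex.hasStrictDerivAt_cpow_const hz).hasDerivAt
  refine h.congr_deriv ?_
  have h0 := Complex.slitPlane_ne_zero hz
  have h1 := csqrt_ne_zero h0
  rw [Complex.cpow_sub _ _ h0, Complex.cpow_one]
  change 1 / 2 * (csqrt z / z) = _
  nth_rewrite 2 [← csqrt_sq z]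
  field_simp

theorem csqrt_re_pos {z : ℂ} (hz : z ∈ Complex.slitPlane) : 0 < (csqrt z).re := by
  have h0 := Complex.slitPlane_ne_zero hz
  rw [csqrt, Complex.cpow_def_of_ne_zero h0, Complex.exp_re]
  refine mul_pos (Real.exp_pos _) (Real.cos_pos_of_mem_Ioo ?_)
  have h1 : (Complex.log z * (1 / 2)).im = z.arg / 2 := by
    simp [Complex.mul_im, Complex.log_im]; ring
  rw [h1]
  have h2 := Complex.mem_slitPlane_iff_arg.1 hz
  have h3 := Complex.neg_pi_lt_arg z
  have h4 := lt_of_le_of_ne (Complex.arg_le_pi z) h2.1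
  constructor <;> linarith

theorem csqrt_eq_of_sq_eq {z w : ℂ} (hz : z ∈ Complex.slitPlane) (hw : 0 < w.re)
    (h : w ^ 2 = z) : csqrt z = w := by
  have h1 := csqrt_re_pos hz
  rcases sq_eq_sq_iff_eq_or_eq_neg.1 ((csqrt_sq z).trans h.symm) with h2 | h2
  · exact h2
  · rw [h2, Complex.neg_re] at h1; linarith

theorem inv_re_pos {z : ℂ} (hz : 0 < z.re) : 0 < z⁻¹.re := by
  have h : z ≠ 0 := fun h => by simp [h] at hz
  rw [Complex.inv_re]
  exact div_pos hz (Complex.normSq_pos.2 h)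

theorem integral_gaussian_csqrt {A : ℂ} (hA : 0 < A.re) {q : ℝ} (hq : 0 < q) :
    ∫ v : ℝ, Complex.exp (-A * q ^ 2 * v ^ 2) = Real.sqrt Real.pi / (csqrt A * q) := by
  have hA' : A ∈ Complex.slitPlane := Or.inl hA
  have h1 := Measure.integral_comp_mul_left (fun v : ℝ => Complex.exp (-A * v ^ 2)) q
  rw [integral_gaussian_complex hA] at h1
  have h2 : ((Real.pi : ℂ) / A) ^ (1 / 2 : ℂ) = Real.sqrt Real.pi / csqrt A := by
    refine csqrt_eq_of_sq_eq (Or.inl ?_) ?_ ?_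
    · rw [div_eq_mul_inv, Complex.re_ofReal_mul]
      exact mul_pos Real.pi_pos (inv_re_pos hA)
    · rw [div_eq_mul_inv, Complex.re_ofReal_mul]
      exact mul_pos (Real.sqrt_pos.2 Real.pi_pos) (inv_re_pos (csqrt_re_pos hA'))
    · rw [div_pow, csqrt_sq]
      congr 1
      exact_mod_cast Real.sq_sqrt Real.pi_pos.le
  rw [h2] at h1
  have h3 : ∀ v : ℝ, Complex.exp (-A * q ^ 2 * v ^ 2) = Complex.exp (-A * ((q * v : ℝ) : ℂ) ^ 2) :=
    fun v => by congr 1; push_cast; ring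
  simp_rw [h3]
  rw [h1, abs_of_pos (inv_pos.2 hq), Complex.real_smul]
  push_cast
  field_simp

theorem norm_exp_neg_mul_sq (A : ℂ) (q v : ℝ) :
    ‖Complex.exp (-A * q ^ 2 * (1 + v ^ 2))‖ = Real.exp (-A.re * q ^ 2 * (1 + v ^ 2)) := by
  rw [Complex.norm_exp]
  have : (-A * q ^ 2 * (1 + v ^ 2)) = ((q ^ 2 * (1 + v ^ 2) : ℝ) : ℂ) * -A := by push_cast; ring
  rw [this, Complex.re_ofReal_mul]
  congr 1
  simp; ring

/-- Differentiation in `q` cancels the factor `1/(1+v²)` and leaves a Gaussian integral, so both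
sides have the same derivative for `q > 0`; at `q = 0` both equal `π`. -/
theorem integral_exp_mul_cauchy_aux {A : ℂ} (hA : 0 < A.re) {q : ℝ} (hq : 0 ≤ q) :
    ∫ v : ℝ, Complex.exp (-A * q ^ 2 * (1 + v ^ 2)) * ((1 + v ^ 2)⁻¹ : ℝ)
      = Real.pi * erfc (csqrt A * q) := by
  set J : ℝ → ℂ := fun q => ∫ v : ℝ, Complex.exp (-A * q ^ 2 * (1 + v ^ 2)) * ((1 + v ^ 2)⁻¹ : ℝ)
    with hJ
  have hpos : ∀ v : ℝ, 0 < 1 + v ^ 2 := fun v => by positivity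
  have hbd : ∀ q v : ℝ, ‖Complex.exp (-A * q ^ 2 * (1 + v ^ 2)) * ((1 + v ^ 2)⁻¹ : ℝ)‖
      ≤ (1 + v ^ 2)⁻¹ := fun q v => by
    rw [norm_mul, norm_exp_neg_mul_sq, Complex.norm_real,
      Real.norm_of_nonneg (inv_nonneg.2 (hpos v).le)]
    refine mul_le_of_le_one_left (inv_nonneg.2 (hpos v).le) (Real.exp_le_one_iff.2 ?_)
    have : 0 ≤ A.re * q ^ 2 * (1 + v ^ 2) := by positivity
    linarith
  have hm : ∀ q : ℝ, AEStronglyMeasurable (fun v : ℝ =>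
      Complex.exp (-A * q ^ 2 * (1 + v ^ 2)) * ((1 + v ^ 2)⁻¹ : ℝ)) volume := fun q => by
    refine Continuous.aestronglyMeasurable ?_
    refine Continuous.mul (by fun_prop) (Complex.continuous_ofReal.comp ?_)
    exact Continuous.inv₀ (by fun_prop) fun v => (hpos v).ne'
  have hJc : Continuous J := by
    refine continuous_of_dominated hm (fun q => .of_forall (hbd q)) integrable_inv_one_add_sq ?_
    exact .of_forall fun v => by fun_prop
  have hJd : ∀ q : ℝ, 0 < q → HasDerivAt J
      (-2 * Real.sqrt Real.pi * csqrt A * Complex.exp (-A * q ^ 2)) q := fun q hq => by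
    have hF' : ∀ v x : ℝ, HasDerivAt (fun x : ℝ =>
        Complex.exp (-A * x ^ 2 * (1 + v ^ 2)) * ((1 + v ^ 2)⁻¹ : ℝ))
        (-2 * A * x * Complex.exp (-A * x ^ 2 * (1 + v ^ 2))) x := fun v x => by
      have h1 : HasDerivAt (fun x : ℝ => -A * (x : ℂ) ^ 2 * (1 + v ^ 2))
          (-A * (2 * x) * (1 + v ^ 2)) x := by
        have := ((((Complex.ofRealCLM.hasDerivAt (x := x)).pow 2).const_mul (-A)).mul_const
          (1 + (v : ℂ) ^ 2))
        simpa using this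
      refine (h1.cexp.mul_const (((1 + v ^ 2)⁻¹ : ℝ) : ℂ)).congr_deriv ?_
      have : (1 + (v : ℂ) ^ 2) ≠ 0 := by exact_mod_cast (hpos v).ne'
      push_cast
      linear_combination (-2 * A * x * Complex.exp (-A * x ^ 2 * (1 + v ^ 2))) *
        mul_inv_cancel₀ this
    have key := hasDerivAt_integral_of_dominated_loc_of_deriv_le (μ := volume) (x₀ := q)
      (s := Ioo (q / 2) (2 * q)) (Ioo_mem_nhds (by linarith) (by linarith))
      (F := fun x v : ℝ => Complex.exp (-A * x ^ 2 * (1 + v ^ 2)) * ((1 + v ^ 2)⁻¹ : ℝ))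
      (F' := fun x v : ℝ => -2 * A * x * Complex.exp (-A * x ^ 2 * (1 + v ^ 2)))
      (bound := fun v => 2 * ‖A‖ * (2 * q) * Real.exp (-(A.re * (q / 2) ^ 2) * v ^ 2))
      (.of_forall hm) (integrable_inv_one_add_sq.mono' (hm q) (.of_forall (hbd q)))
      (Continuous.aestronglyMeasurable (by fun_prop))
      (.of_forall fun v x hx => by
        rw [norm_mul, norm_exp_neg_mul_sq, norm_mul, norm_mul, norm_neg, Complex.norm_ofNat,
          Complex.norm_real, Real.norm_of_nonneg (by linarith [hx.1] : 0 ≤ x)]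
        refine mul_le_mul (by gcongr; exact hx.2.le) (Real.exp_le_exp.2 ?_) (Real.exp_pos _).le
          (by positivity)
        · have h1 : (q / 2) ^ 2 ≤ x ^ 2 := pow_le_pow_left₀ (by positivity) hx.1.le 2
          have h2 : A.re * ((q / 2) ^ 2 * v ^ 2) ≤ A.re * (x ^ 2 * (1 + v ^ 2)) := by
            refine mul_le_mul_of_nonneg_left ?_ hA.le
            exact mul_le_mul h1 (by linarith) (sq_nonneg v) (sq_nonneg x)
          linarith)
      ((integrable_exp_neg_mul_sq (by positivity)).const_mul _)
      (.of_forall fun v x _ => hF' v x)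
    refine key.2.congr_deriv ?_
    have e : ∀ v : ℝ, -2 * A * q * Complex.exp (-A * q ^ 2 * (1 + v ^ 2))
        = -2 * A * q * Complex.exp (-A * q ^ 2) * Complex.exp (-A * q ^ 2 * v ^ 2) := fun v => by
      rw [mul_assoc _ (Complex.exp _) (Complex.exp _), ← Complex.exp_add]; congr 2; ring
    simp_rw [e]
    rw [integral_const_mul, integral_gaussian_csqrt hA hq]
    have h1 : csqrt A ≠ 0 := csqrt_ne_zero (Complex.slitPlane_ne_zero (Or.inl hA))
    have h2 : (q : ℂ) ≠ 0 := by exact_mod_cast hq.ne'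
    have h3 := csqrt_sq A
    field_simp
    rw [h3]
  have hR : ∀ q : ℝ, HasDerivAt (fun q : ℝ => (Real.pi : ℂ) * erfc (csqrt A * q))
      (-2 * Real.sqrt Real.pi * csqrt A * Complex.exp (-A * q ^ 2)) q := fun q => by
    have h1 : HasDerivAt (fun q : ℝ => csqrt A * (q : ℂ)) (csqrt A) q := by
      simpa using (Complex.ofRealCLM.hasDerivAt (x := q)).const_mul (csqrt A)
    have h2 := ((hasDerivAt_erfc (csqrt A * q)).comp q h1).const_mul (Real.pi : ℂ)
    refine h2.congr_deriv ?_
    rw [mul_pow, csqrt_sq]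
    have h3 : (Real.sqrt Real.pi : ℂ) ^ 2 = Real.pi := by
      exact_mod_cast Real.sq_sqrt Real.pi_pos.le
    have h4 : (Real.sqrt Real.pi : ℂ) ≠ 0 := by
      exact_mod_cast (Real.sqrt_pos.2 Real.pi_pos).ne'
    rw [← h3, neg_mul A]
    field_simp
  rcases hq.eq_or_lt with rfl | hq
  · simp only [Complex.ofReal_zero, mul_zero, erfc_zero, mul_one, ne_eq, OfNat.ofNat_ne_zero,
      not_false_eq_true, zero_pow, zero_mul, Complex.exp_zero, one_mul]
    rw [integral_complex_ofReal, integral_univ_inv_one_add_sq]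
  -- The derivative of `J` was computed only for `q > 0`. The difference is therefore constant on
  -- `[δ, q]`, and `δ → 0` by continuity.
  · have hc : ContinuousOn (fun t => J t - Real.pi * erfc (csqrt A * t)) (Icc 0 q) :=
      (hJc.sub (continuous_iff_continuousAt.2 fun t => (hR t).continuousAt)).continuousOn
    have h1 : ∀ δ ∈ Ioo 0 q, J δ - Real.pi * erfc (csqrt A * δ)
        = J q - Real.pi * erfc (csqrt A * q) := fun δ hδ => by
      refine (constant_of_has_deriv_right_zero (hc.mono (Icc_subset_Icc_left hδ.1.le))
        (fun x hx => ?_) q (right_mem_Icc.2 hδ.2.le)).symm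
      have := ((hJd x (hδ.1.trans_le hx.1)).sub (hR x)).hasDerivWithinAt (s := Ici x)
      rwa [sub_self] at this
    have h2 : Tendsto (fun t => J t - Real.pi * erfc (csqrt A * t)) (𝓝[>] 0)
        (𝓝 (J 0 - Real.pi * erfc (csqrt A * (0 : ℝ)))) :=
      ((hJc.sub (continuous_iff_continuousAt.2 fun t => (hR t).continuousAt)).tendsto 0).mono_left
        nhdsWithin_le_nhds
    have h3 := tendsto_nhds_unique h2 (tendsto_const_nhds.congr'
      (eventually_of_mem (Ioo_mem_nhdsGT hq) fun δ hδ => (h1 δ hδ).symm))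
    have h4 : J 0 = Real.pi := by
      simp only [hJ, Complex.ofReal_zero, mul_zero, ne_eq, OfNat.ofNat_ne_zero, not_false_eq_true,
        zero_pow, zero_mul, Complex.exp_zero, one_mul]
      rw [integral_complex_ofReal, integral_univ_inv_one_add_sq]
    rw [h4, Complex.ofReal_zero, mul_zero, erfc_zero, mul_one, sub_self] at h3
    exact sub_eq_zero.1 h3.symm

/-- This form shows at once that `e^{Aq²} erfc(√A q)` is bounded by `1` for `Re A > 0`, and that it
is an average of exponentials, that is, of time delays when `A` is proportional to `ω`. -/
theorem integral_exp_mul_cauchy {A : ℂ} (hA : 0 < A.re) {q : ℝ} (hq : 0 ≤ q) :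
    ∫ v : ℝ, Complex.exp (-A * q ^ 2 * v ^ 2) * ((1 + v ^ 2)⁻¹ : ℝ)
      = Real.pi * (Complex.exp (A * q ^ 2) * erfc (csqrt A * q)) := by
  rw [mul_left_comm, ← integral_exp_mul_cauchy_aux hA hq, ← integral_const_mul]
  refine integral_congr_ae (.of_forall fun v => ?_)
  simp only
  rw [← mul_assoc, ← Complex.exp_add]
  congr 2
  ring

/-! ### Parabolic coordinates in the slit plane -/

/-- The plane as the complex plane, with the slit turned onto the negative half-axis. -/
def slitMap : Plane →L[ℝ] ℂ := -((ContinuousLinearMap.fst ℝ ℝ ℝ).smulRight 1 +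
  (ContinuousLinearMap.snd ℝ ℝ ℝ).smulRight Complex.I)

theorem slitMap_re (x : Plane) : (slitMap x).re = -x.1 := by
  simp [slitMap]

theorem slitMap_im (x : Plane) : (slitMap x).im = -x.2 := by
  simp [slitMap]

theorem slitMap_mem {x : Plane} (hx : x ∈ Q) : slitMap x ∈ Complex.slitPlane := by
  rw [Complex.mem_slitPlane_iff, slitMap_re, slitMap_im]
  by_contra h
  push Not at h
  exact hx ⟨neg_eq_zero.1 h.2, by linarith [h.1]⟩

/-- The square root of `slitMap`. -/
def slitRoot (x : Plane) : ℂ := csqrt (slitMap x)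

theorem slitRoot_sq (x : Plane) : slitRoot x ^ 2 = slitMap x := csqrt_sq _

theorem slitRoot_ne_zero {x : Plane} (hx : x ∈ Q) : slitRoot x ≠ 0 :=
  csqrt_ne_zero (Complex.slitPlane_ne_zero (slitMap_mem hx))

theorem contDiffOn_csqrt : ContDiffOn ℝ (⊤ : ℕ∞) csqrt Complex.slitPlane := by
  have : DifferentiableOn ℂ csqrt Complex.slitPlane := fun z hz =>
    (hasDerivAt_csqrt hz).differentiableAt.differentiableWithinAt
  exact (this.contDiffOn (n := (⊤ : ℕ∞)) Complex.isOpen_slitPlane).restrict_scalars ℝ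

theorem contDiff_erfc : ContDiff ℝ (⊤ : ℕ∞) erfc :=
  (differentiable_erfc.contDiff (n := (⊤ : ℕ∞))).restrict_scalars ℝ

theorem contDiffOn_slitRoot : ContDiffOn ℝ (⊤ : ℕ∞) slitRoot Q :=
  contDiffOn_csqrt.comp slitMap.contDiff.contDiffOn fun _ hx => slitMap_mem hx

/-- The parabolic coordinate `Re (μ √(slitMap x))`. -/
def paraCoord (μ : ℂ) (x : Plane) : ℝ := (μ * slitRoot x).re

/-- The linear form `-Re (μ² slitMap x)`. -/
def linearPhase (μ : ℂ) (x : Plane) : ℝ := -(μ ^ 2 * slitMap x).re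

/-- For `w = μ√z` this is `2(Re w)² - Re(w²) = |w|²`. -/
theorem linearPhase_add_paraCoord {μ : ℂ} (hμ : ‖μ‖ = 1) (x : Plane) :
    linearPhase μ x + 2 * paraCoord μ x ^ 2 = ‖slitMap x‖ := by
  have h1 : ‖slitMap x‖ = ‖μ * slitRoot x‖ ^ 2 := by
    rw [norm_mul, hμ, one_mul, ← norm_pow, slitRoot_sq]
  have h2 : μ ^ 2 * slitMap x = (μ * slitRoot x) ^ 2 := by rw [mul_pow, slitRoot_sq]
  rw [linearPhase, paraCoord, h1, h2, Complex.sq_norm, Complex.normSq_apply, pow_two,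
    Complex.mul_re (μ * slitRoot x) (μ * slitRoot x)]
  ring

/-- Where `ℓ < 0`, the positive number `Re μ · Re √z` is smaller than `Im μ · Im √z`, hence `ℓ² ≤
(Im μ)² |z|`, and `N = |z| - 2ℓ²` inherits a lower bound. Thus the plane wave decays in the region
where `erfc` does not compensate it. -/
theorem linearPhase_ge {μ : ℂ} (hμ : ‖μ‖ = 1) (hre : 0 < μ.re) {x : Plane} (hx : x ∈ Q)
    (hl : paraCoord μ x < 0) : (μ.re ^ 2 - μ.im ^ 2) * ‖slitMap x‖ ≤ linearPhase μ x := by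
  have h1 := linearPhase_add_paraCoord hμ x
  have h2 : ‖slitMap x‖ = (slitRoot x).re ^ 2 + (slitRoot x).im ^ 2 := by
    rw [← slitRoot_sq, norm_pow, Complex.sq_norm, Complex.normSq_apply]; ring
  have h3 : μ.re ^ 2 + μ.im ^ 2 = 1 := by
    have := Complex.sq_norm μ
    rw [hμ, Complex.normSq_apply] at this
    linarith
  have h4 : 0 < (slitRoot x).re := csqrt_re_pos (slitMap_mem hx)
  have h5 : paraCoord μ x = μ.re * (slitRoot x).re - μ.im * (slitRoot x).im := by
    rw [paraCoord, Complex.mul_re]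
  have h6 : 0 < μ.re * (slitRoot x).re := mul_pos hre h4
  have h7 : paraCoord μ x ^ 2 ≤ (μ.im * (slitRoot x).im) ^ 2 := by
    nlinarith
  have h8 : paraCoord μ x ^ 2 ≤ μ.im ^ 2 * ‖slitMap x‖ := by
    rw [h2]; nlinarith [sq_nonneg (μ.im * (slitRoot x).re)]
  have h9 : (μ.re ^ 2 - μ.im ^ 2) = 1 - 2 * μ.im ^ 2 := by linarith
  rw [h9]
  linarith

/-! ### The diffracted wave -/

/-- The wave `e^{iωN} erfc (√(-2iω) ℓ)` with `N = linearPhase μ` and `ℓ = paraCoord μ`. -/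
def diffracted (μ ω : ℂ) (x : Plane) : ℂ :=
  Complex.exp (Complex.I * ω * linearPhase μ x)
    * erfc (csqrt (-2 * Complex.I * ω) * paraCoord μ x)

/-- The open upper half-plane of frequencies. -/
def UpperFrequencies : Set ℂ := {z | 0 < z.im}

theorem isOpen_UpperFrequencies : IsOpen UpperFrequencies :=
  isOpen_lt continuous_const Complex.continuous_im

theorem re_neg_two_I_mul (ω : ℂ) : (-2 * Complex.I * ω).re = 2 * ω.im := by simp

theorem neg_two_I_mul_mem {ω : ℂ} (hω : 0 < ω.im) : -2 * Complex.I * ω ∈ Complex.slitPlane :=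
  Or.inl (by rw [re_neg_two_I_mul]; linarith)

theorem contDiff_linearPhase (μ : ℂ) : ContDiff ℝ (⊤ : ℕ∞) (linearPhase μ) :=
  (Complex.reCLM.contDiff.comp (contDiff_const.mul slitMap.contDiff)).neg

theorem contDiffOn_paraCoord (μ : ℂ) : ContDiffOn ℝ (⊤ : ℕ∞) (paraCoord μ) Q :=
  Complex.reCLM.contDiff.comp_contDiffOn (contDiffOn_const.mul contDiffOn_slitRoot)

theorem contDiffOn_diffracted_joint (μ : ℂ) : ContDiffOn ℝ (⊤ : ℕ∞)
    (fun p : ℂ × Plane => diffracted μ p.1 p.2) (UpperFrequencies ×ˢ Q) := by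
  have h1 : ContDiffOn ℝ (⊤ : ℕ∞) (fun p : ℂ × Plane => (linearPhase μ p.2 : ℂ))
      (UpperFrequencies ×ˢ Q) :=
    (Complex.ofRealCLM.contDiff.comp ((contDiff_linearPhase μ).comp contDiff_snd)).contDiffOn
  have h2 : ContDiffOn ℝ (⊤ : ℕ∞) (fun p : ℂ × Plane => (paraCoord μ p.2 : ℂ))
      (UpperFrequencies ×ˢ Q) :=
    Complex.ofRealCLM.contDiff.comp_contDiffOn
      ((contDiffOn_paraCoord μ).comp contDiffOn_snd fun _ hp => hp.2)
  have h3 : ContDiffOn ℝ (⊤ : ℕ∞) (fun p : ℂ × Plane => csqrt (-2 * Complex.I * p.1))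
      (UpperFrequencies ×ˢ Q) :=
    contDiffOn_csqrt.comp (contDiff_const.mul contDiff_fst).contDiffOn
      fun _ hp => neg_two_I_mul_mem hp.1
  exact (((contDiff_const.mul contDiff_fst).contDiffOn.mul h1).cexp).mul
    (contDiff_erfc.comp_contDiffOn (h3.mul h2))

theorem contDiffOn_diffracted (μ : ℂ) {ω : ℂ} (hω : 0 < ω.im) :
    ContDiffOn ℝ (⊤ : ℕ∞) (diffracted μ ω) Q :=
  (contDiffOn_diffracted_joint μ).comp (f := fun x => (ω, x))
    (contDiff_const.prodMk contDiff_id).contDiffOn fun _ hx => ⟨hω, hx⟩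

theorem differentiableAt_diffracted_frequency (μ : ℂ) {ω : ℂ} (hω : 0 < ω.im) (x : Plane) :
    DifferentiableAt ℂ (fun z => diffracted μ z x) ω := by
  have h3 : DifferentiableAt ℂ (fun z : ℂ => csqrt (-2 * Complex.I * z)) ω :=
    (hasDerivAt_csqrt (neg_two_I_mul_mem hω)).differentiableAt.comp ω
      (f := fun z : ℂ => -2 * Complex.I * z) (by fun_prop)
  exact (DifferentiableAt.cexp (by fun_prop)).mul
    ((differentiable_erfc _).comp ω (h3.mul_const _))

/-- Derivative of `paraCoord` in the direction `e`. -/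
def paraCoordDeriv (μ : ℂ) (e x : Plane) : ℝ := (μ * (slitMap e / (2 * slitRoot x))).re

theorem hasDerivAt_linearPhase_line (x e : Plane) (μ : ℂ) :
    HasDerivAt (fun t : ℝ => linearPhase μ (x + t • e)) (linearPhase μ e) 0 := by
  have h : (fun t : ℝ => linearPhase μ (x + t • e))
      = fun t : ℝ => linearPhase μ x + t * linearPhase μ e := by
    ext t
    simp only [linearPhase, map_add, map_smul, Complex.real_smul]
    rw [mul_add, Complex.add_re, mul_left_comm, Complex.re_ofReal_mul]
    ring
  rw [h]
  simpa using ((hasDerivAt_id (0 : ℝ)).mul_const (linearPhase μ e)).const_add (linearPhase μ x)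

/-- The exponential `e^{iω(N + 2ℓ²)}`. -/
def circularWave (μ ω : ℂ) (x : Plane) : ℂ :=
  Complex.exp (Complex.I * ω * (linearPhase μ x + 2 * paraCoord μ x ^ 2 : ℝ))

/-! ### Directional derivatives in parabolic coordinates. -/

section LineDerivatives

variable {x : Plane} (hx : x ∈ Q) (e : Plane)

include hx

theorem hasDerivAt_slitRoot_line :
    HasDerivAt (fun t : ℝ => slitRoot (x + t • e)) (slitMap e / (2 * slitRoot x)) 0 := by
  have h1 : HasDerivAt (fun t : ℝ => slitMap (x + t • e)) (slitMap e) 0 := by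
    have : HasDerivAt (fun t : ℝ => x + t • e) e 0 := by
      simpa using ((hasDerivAt_id (0 : ℝ)).smul_const e).const_add x
    exact slitMap.hasFDerivAt.comp_hasDerivAt 0 this
  have h2 : HasDerivAt csqrt (1 / (2 * slitRoot x)) (slitMap (x + (0 : ℝ) • e)) := by
    rw [zero_smul, add_zero]; exact hasDerivAt_csqrt (slitMap_mem hx)
  refine (h2.comp (0 : ℝ) h1).congr_deriv ?_
  ring

theorem hasDerivAt_paraCoord_line (μ : ℂ) :
    HasDerivAt (fun t : ℝ => paraCoord μ (x + t • e)) (paraCoordDeriv μ e x) 0 :=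
  Complex.reCLM.hasFDerivAt.comp_hasDerivAt 0 ((hasDerivAt_slitRoot_line hx e).const_mul μ)

theorem hasDerivAt_paraCoordDeriv_line (μ : ℂ) :
    HasDerivAt (fun t : ℝ => paraCoordDeriv μ e (x + t • e))
      (-(μ * (slitMap e ^ 2 / (4 * slitRoot x ^ 3))).re) 0 := by
  have h0 := slitRoot_ne_zero hx
  have h1 := ((hasDerivAt_slitRoot_line hx e).const_mul 2).fun_inv (by simpa using h0)
  have h2 := (h1.const_mul (slitMap e)).const_mul μ
  have h3 := Complex.reCLM.hasFDerivAt.comp_hasDerivAt 0 h2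
  refine h3.congr_deriv ?_
  rw [← Complex.neg_re, Complex.reCLM_apply]
  congr 1
  simp only [zero_smul, add_zero]
  field_simp
  ring

theorem hasDerivAt_circularWave_line (μ ω : ℂ) :
    HasDerivAt (fun t : ℝ => circularWave μ ω (x + t • e))
      (Complex.I * ω * (linearPhase μ e + 4 * paraCoord μ x * paraCoordDeriv μ e x : ℝ)
        * circularWave μ ω x) 0 := by
  have h1 := (hasDerivAt_linearPhase_line x e μ).add
    (((hasDerivAt_paraCoord_line hx e μ).pow 2).const_mul 2)
  have h2 := (((h1.ofReal_comp).const_mul (Complex.I * ω)).cexp)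
  refine h2.congr_deriv ?_
  simp only [circularWave, Pi.add_apply, Pi.pow_apply, zero_smul, add_zero]
  rw [mul_comm]
  congr 3
  push_cast
  ring

/-- The Gaussian `e^{2iωℓ²}` from the derivative of `erfc` merges with `e^{iωN}` into the circular
wave, whose phase is `N + 2ℓ² = |x|` when `|μ| = 1`. -/
theorem hasDerivAt_diffracted_line (μ : ℂ) (ω : ℂ) :
    HasDerivAt (fun t : ℝ => diffracted μ ω (x + t • e))
      (Complex.I * ω * linearPhase μ e * diffracted μ ω x
        - 2 / (Real.sqrt Real.pi : ℂ) * csqrt (-2 * Complex.I * ω)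
          * (circularWave μ ω x * paraCoordDeriv μ e x)) 0 := by
  have h1 := (((hasDerivAt_linearPhase_line x e μ).ofReal_comp).const_mul (Complex.I * ω)).cexp
  have h2 := ((hasDerivAt_paraCoord_line hx e μ).ofReal_comp).const_mul
    (csqrt (-2 * Complex.I * ω))
  have h3 := (hasDerivAt_erfc _).comp (0 : ℝ) h2
  refine (h1.mul h3).congr_deriv ?_
  simp only [Function.comp_apply, zero_smul, add_zero, diffracted, circularWave]
  rw [mul_pow, csqrt_sq]
  have e1 : Complex.exp (Complex.I * ω * (linearPhase μ x + 2 * paraCoord μ x ^ 2 : ℝ))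
      = Complex.exp (Complex.I * ω * linearPhase μ x)
        * Complex.exp (-(-2 * Complex.I * ω * (paraCoord μ x : ℂ) ^ 2)) := by
    rw [← Complex.exp_add]; congr 1; push_cast; ring
  rw [e1]
  ring

theorem fderiv_diffracted (μ : ℂ) {ω : ℂ} (hω : 0 < ω.im) :
    fderiv ℝ (diffracted μ ω) x e = Complex.I * ω * linearPhase μ e * diffracted μ ω x
        - 2 / (Real.sqrt Real.pi : ℂ) * csqrt (-2 * Complex.I * ω)
          * (circularWave μ ω x * paraCoordDeriv μ e x) := by
  have hd : DifferentiableAt ℝ (diffracted μ ω) x :=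
    ((contDiffOn_diffracted μ hω).contDiffAt (isOpen_Q.mem_nhds hx)).differentiableAt (by simp)
  rw [← hd.lineDeriv_eq_fderiv]
  exact HasLineDerivAt.lineDeriv (hasDerivAt_diffracted_line hx e μ ω)

theorem fderiv_fderiv_diffracted (μ : ℂ) {ω : ℂ} (hω : 0 < ω.im) :
    fderiv ℝ (fun y => fderiv ℝ (diffracted μ ω) y e) x e
      = -ω ^ 2 * (linearPhase μ e ^ 2 : ℝ) * diffracted μ ω x
        - 2 / (Real.sqrt Real.pi : ℂ) * csqrt (-2 * Complex.I * ω) * circularWave μ ω x *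
          (Complex.I * ω * (2 * linearPhase μ e * paraCoordDeriv μ e x
            + 4 * paraCoord μ x * paraCoordDeriv μ e x ^ 2 : ℝ)
            - ((μ * (slitMap e ^ 2 / (4 * slitRoot x ^ 3))).re : ℂ)) := by
  have hd : DifferentiableAt ℝ (fun y => fderiv ℝ (diffracted μ ω) y e) x :=
    ((continuousOn_fderiv_apply (n := 1) ((contDiffOn_diffracted μ hω).of_le
      (by exact_mod_cast le_top)) e).contDiffAt (isOpen_Q.mem_nhds hx)).differentiableAt (by simp)
  rw [← hd.lineDeriv_eq_fderiv]
  refine HasLineDerivAt.lineDeriv ?_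
  have h1 := ((hasDerivAt_diffracted_line hx e μ ω).const_mul
    (Complex.I * ω * linearPhase μ e)).sub
    (((hasDerivAt_circularWave_line hx e μ ω).mul
      (hasDerivAt_paraCoordDeriv_line hx e μ).ofReal_comp).const_mul
        (2 / (Real.sqrt Real.pi : ℂ) * csqrt (-2 * Complex.I * ω)))
  have hev : ∀ᶠ t : ℝ in 𝓝 0, x + t • e ∈ Q := by
    have hc : Continuous fun t : ℝ => x + t • e := by fun_prop
    exact hc.continuousAt.eventually_mem (isOpen_Q.mem_nhds (by simpa using hx))
  refine (h1.congr_of_eventuallyEq (hev.mono fun t ht => ?_)).congr_deriv ?_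
  · simp only [fderiv_diffracted ht e μ hω]
    rfl
  · simp only [zero_smul, add_zero]
    push_cast
    linear_combination (linearPhase μ e) ^ 2 * diffracted μ ω x * ω ^ 2 * Complex.I_sq

end LineDerivatives

/-- Three facts suffice: `|∇N|² = 1`, the transport equation `2∇N·∇ℓ + 4ℓ|∇ℓ|² = 0`, and `Δℓ = 0`,
since `ℓ` is the real part of a holomorphic function of `z`. -/
theorem planeLaplacian_diffracted {μ : ℂ} (hμ : ‖μ‖ = 1) {ω : ℂ} (hω : 0 < ω.im) {x : Plane}
    (hx : x ∈ Q) : planeLaplacian (diffracted μ ω) x = -ω ^ 2 * diffracted μ ω x := by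
  have h0 := slitRoot_ne_zero hx
  have t1 : slitMap (1, 0) = -1 := Complex.ext (by simp [slitMap_re]) (by simp [slitMap_im])
  have t2 : slitMap (0, 1) = -Complex.I :=
    Complex.ext (by simp [slitMap_re]) (by simp [slitMap_im])
  have hN : linearPhase μ (1, 0) ^ 2 + linearPhase μ (0, 1) ^ 2 = 1 := by
    have h1 : ‖μ ^ 2‖ = 1 := by rw [norm_pow, hμ, one_pow]
    have h2 := Complex.sq_norm (μ ^ 2)
    rw [h1, Complex.normSq_apply] at h2
    rw [linearPhase, linearPhase, t1, t2]
    simp only [mul_neg, mul_one, Complex.neg_re, neg_neg, Complex.mul_I_re]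
    linarith
  -- `B` is the complex derivative of `μ√z`, so that `∇ℓ = (-Re B, Im B)`; the relation `μ² =
  -- 2(μ√z)B` then expresses `∇N` through `ℓ` and `B`.
  set B := μ / (2 * slitRoot x) with hB
  have d1 : paraCoordDeriv μ (1, 0) x = -B.re := by
    rw [paraCoordDeriv, t1, ← Complex.neg_re]; congr 1; rw [hB]; ring
  have d2 : paraCoordDeriv μ (0, 1) x = B.im := by
    rw [paraCoordDeriv, t2]
    have : μ * (-Complex.I / (2 * slitRoot x)) = -(B * Complex.I) := by rw [hB]; ring
    rw [this]; simp
  have hm : μ ^ 2 = 2 * (μ * slitRoot x) * B := by rw [hB]; field_simp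
  have hcross : (2 * linearPhase μ (1, 0) * paraCoordDeriv μ (1, 0) x
      + 4 * paraCoord μ x * paraCoordDeriv μ (1, 0) x ^ 2)
      + (2 * linearPhase μ (0, 1) * paraCoordDeriv μ (0, 1) x
      + 4 * paraCoord μ x * paraCoordDeriv μ (0, 1) x ^ 2) = 0 := by
    rw [d1, d2, linearPhase, linearPhase, t1, t2, hm, paraCoord]
    simp only [Complex.mul_re, Complex.mul_im, Complex.neg_re, Complex.neg_im, Complex.one_re,
      Complex.one_im, Complex.I_re, Complex.I_im, Complex.re_ofNat, Complex.im_ofNat]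
    ring
  have hharm : (μ * (slitMap (1, 0) ^ 2 / (4 * slitRoot x ^ 3))).re
      + (μ * (slitMap (0, 1) ^ 2 / (4 * slitRoot x ^ 3))).re = 0 := by
    rw [← Complex.add_re, t1, t2, neg_sq, neg_sq, Complex.I_sq]
    have : μ * (1 ^ 2 / (4 * slitRoot x ^ 3)) + μ * (-1 / (4 * slitRoot x ^ 3)) = 0 := by ring
    rw [this, Complex.zero_re]
  rw [planeLaplacian, fderiv_fderiv_diffracted hx _ μ hω, fderiv_fderiv_diffracted hx _ μ hω]
  have hN' : ((linearPhase μ (1, 0) ^ 2 : ℝ) : ℂ) + ((linearPhase μ (0, 1) ^ 2 : ℝ) : ℂ) = 1 := by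
    exact_mod_cast hN
  have hcross' := congrArg (fun t : ℝ => (t : ℂ)) hcross
  have hharm' := congrArg (fun t : ℝ => (t : ℂ)) hharm
  simp only [Complex.ofReal_add (_ + _) (_ + _), Complex.ofReal_zero] at hcross'
  simp only [Complex.ofReal_add (Complex.re _) (Complex.re _), Complex.ofReal_zero] at hharm'
  linear_combination (-ω ^ 2 * diffracted μ ω x) * hN'
    - 2 / (Real.sqrt Real.pi : ℂ) * csqrt (-2 * Complex.I * ω) * circularWave μ ω x
      * (Complex.I * ω * hcross' - hharm')

/-! ### Estimates for the diffracted wave -/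

/-- The superposition of circular waves that constitutes the diffracted wave. -/
def circularSuperposition (μ ω : ℂ) (x : Plane) : ℂ :=
  circularWave μ ω x * ((Real.pi : ℂ)⁻¹ * ∫ v : ℝ,
    Complex.exp (-(-2 * Complex.I * ω) * paraCoord μ x ^ 2 * v ^ 2) * ((1 + v ^ 2)⁻¹ : ℝ))

theorem circularSuperposition_eq (μ : ℂ) {ω : ℂ} (hω : 0 < ω.im) (x : Plane) :
    circularSuperposition μ ω x = Complex.exp (Complex.I * ω * linearPhase μ x)
      * erfc (csqrt (-2 * Complex.I * ω) * (|paraCoord μ x| : ℝ)) := by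
  have hA : 0 < (-2 * Complex.I * ω).re := by rw [re_neg_two_I_mul]; linarith
  have h := integral_exp_mul_cauchy hA (abs_nonneg (paraCoord μ x))
  have e : ((|paraCoord μ x| : ℝ) : ℂ) ^ 2 = (paraCoord μ x : ℂ) ^ 2 := by
    rw [← Complex.ofReal_pow, sq_abs, Complex.ofReal_pow]
  rw [e] at h
  rw [circularSuperposition, h, ← mul_assoc (Real.pi : ℂ)⁻¹, inv_mul_cancel₀
    (by exact_mod_cast Real.pi_ne_zero), one_mul, ← mul_assoc, circularWave, ← Complex.exp_add]
  congr 2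
  push_cast
  ring

theorem diffracted_of_nonneg {μ ω : ℂ} (hω : 0 < ω.im) {x : Plane} (hl : 0 ≤ paraCoord μ x) :
    diffracted μ ω x = circularSuperposition μ ω x := by
  rw [circularSuperposition_eq μ hω, abs_of_nonneg hl, diffracted]

/-- Reflecting the argument of `erfc` splits off the geometric plane wave and leaves a genuine
superposition of circular waves. -/
theorem diffracted_of_neg {μ ω : ℂ} (hω : 0 < ω.im) {x : Plane} (hl : paraCoord μ x < 0) :
    diffracted μ ω x = 2 * Complex.exp (Complex.I * ω * linearPhase μ x)
      - circularSuperposition μ ω x := by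
  rw [circularSuperposition_eq μ hω, abs_of_neg hl, diffracted, Complex.ofReal_neg, mul_neg,
    erfc_neg]
  ring

theorem norm_exp_I_mul (ω : ℂ) (t : ℝ) :
    ‖Complex.exp (Complex.I * ω * t)‖ = Real.exp (-(ω.im * t)) := by
  rw [Complex.norm_exp]; simp

theorem norm_circularWave {μ : ℂ} (hμ : ‖μ‖ = 1) (ω : ℂ) (x : Plane) :
    ‖circularWave μ ω x‖ = Real.exp (-(ω.im * ‖slitMap x‖)) := by
  rw [circularWave, norm_exp_I_mul, linearPhase_add_paraCoord hμ]

/-- The Gaussian factors have modulus at most `1` and the Cauchy density has total mass `π`. -/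
theorem norm_circularSuperposition_le {μ : ℂ} (hμ : ‖μ‖ = 1) {ω : ℂ} (hω : 0 < ω.im)
    (x : Plane) : ‖circularSuperposition μ ω x‖ ≤ Real.exp (-(ω.im * ‖slitMap x‖)) := by
  rw [circularSuperposition, norm_mul, norm_circularWave hμ]
  refine mul_le_of_le_one_right (Real.exp_pos _).le ?_
  have h : ‖∫ v : ℝ, Complex.exp (-(-2 * Complex.I * ω) * paraCoord μ x ^ 2 * v ^ 2)
      * ((1 + v ^ 2)⁻¹ : ℝ)‖ ≤ ∫ v : ℝ, (1 + v ^ 2)⁻¹ := by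
    refine norm_integral_le_of_norm_le integrable_inv_one_add_sq (.of_forall fun v => ?_)
    have e : -(-2 * Complex.I * ω) * (paraCoord μ x : ℂ) ^ 2 * (v : ℂ) ^ 2
        = Complex.I * ω * (2 * paraCoord μ x ^ 2 * v ^ 2 : ℝ) := by push_cast; ring
    rw [norm_mul, e, norm_exp_I_mul, Complex.norm_real, Real.norm_of_nonneg (by positivity)]
    refine mul_le_of_le_one_left (by positivity) (Real.exp_le_one_iff.2 ?_)
    have : 0 ≤ ω.im * (2 * paraCoord μ x ^ 2 * v ^ 2) := by positivity
    linarith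
  rw [integral_univ_inv_one_add_sq] at h
  rw [norm_mul, norm_inv, Complex.norm_real, Real.norm_of_nonneg Real.pi_pos.le]
  rwa [inv_mul_le_iff₀ Real.pi_pos, mul_one]

theorem decayRate_le_one {μ : ℂ} (hμ : ‖μ‖ = 1) : μ.re ^ 2 - μ.im ^ 2 ≤ 1 := by
  have := Complex.sq_norm μ
  rw [hμ, Complex.normSq_apply] at this
  nlinarith [sq_nonneg μ.im]

/-- The constant is `2 + 1`: the plane wave is present only for `ℓ < 0`, where `linearPhase_ge`
makes it decay, and the circular part decays at least as fast. -/
theorem norm_diffracted_le {μ : ℂ} (hμ : ‖μ‖ = 1) (hre : 0 < μ.re) {ω : ℂ} (hω : 0 < ω.im)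
    {x : Plane} (hx : x ∈ Q) : ‖diffracted μ ω x‖
      ≤ 3 * Real.exp (-((μ.re ^ 2 - μ.im ^ 2) * ω.im * ‖slitMap x‖)) := by
  have h1 : Real.exp (-(ω.im * ‖slitMap x‖))
      ≤ Real.exp (-((μ.re ^ 2 - μ.im ^ 2) * ω.im * ‖slitMap x‖)) := by
    refine Real.exp_le_exp.2 (neg_le_neg ?_)
    have := mul_le_mul_of_nonneg_right (decayRate_le_one hμ)
      (mul_nonneg hω.le (norm_nonneg (slitMap x)))
    linarith
  have h2 := norm_circularSuperposition_le hμ hω x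
  rcases le_or_gt 0 (paraCoord μ x) with hl | hl
  · rw [diffracted_of_nonneg hω hl]
    linarith [Real.exp_pos (-((μ.re ^ 2 - μ.im ^ 2) * ω.im * ‖slitMap x‖))]
  · rw [diffracted_of_neg hω hl]
    have h3 : ‖Complex.exp (Complex.I * ω * linearPhase μ x)‖
        ≤ Real.exp (-((μ.re ^ 2 - μ.im ^ 2) * ω.im * ‖slitMap x‖)) := by
      rw [norm_exp_I_mul]
      refine Real.exp_le_exp.2 (neg_le_neg ?_)
      have := mul_le_mul_of_nonneg_left (linearPhase_ge hμ hre hx hl) hω.le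
      linarith
    refine (norm_sub_le _ _).trans ?_
    rw [norm_mul, Complex.norm_ofNat]
    linarith

theorem norm_slitRoot (x : Plane) : ‖slitRoot x‖ = Real.sqrt ‖slitMap x‖ := by
  rw [← slitRoot_sq, norm_pow, Real.sqrt_sq (norm_nonneg _)]

/-- The gradient of `√z` contributes the singularity `|x|^{-1/2}` at the edge, which is square
integrable in the plane. -/
theorem norm_fderiv_diffracted_le {μ : ℂ} (hμ : ‖μ‖ = 1) (hre : 0 < μ.re) {ω : ℂ}
    (hω : 0 < ω.im) {x : Plane} (hx : x ∈ Q) {e : Plane} (he : ‖slitMap e‖ = 1) :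
    ‖fderiv ℝ (diffracted μ ω) x e‖ ≤
      (3 * ‖ω‖ + ‖2 / (Real.sqrt Real.pi : ℂ) * csqrt (-2 * Complex.I * ω)‖) *
        (Real.exp (-((μ.re ^ 2 - μ.im ^ 2) * ω.im * ‖slitMap x‖))
          * (1 + (Real.sqrt ‖slitMap x‖)⁻¹)) := by
  have h1 : Real.exp (-(ω.im * ‖slitMap x‖))
      ≤ Real.exp (-((μ.re ^ 2 - μ.im ^ 2) * ω.im * ‖slitMap x‖)) := by
    refine Real.exp_le_exp.2 (neg_le_neg ?_)
    have := mul_le_mul_of_nonneg_right (decayRate_le_one hμ)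
      (mul_nonneg hω.le (norm_nonneg (slitMap x)))
    linarith
  set E := Real.exp (-((μ.re ^ 2 - μ.im ^ 2) * ω.im * ‖slitMap x‖)) with hE
  have hE0 : 0 < E := Real.exp_pos _
  have h2 : |linearPhase μ e| ≤ 1 := by
    rw [linearPhase, abs_neg]
    refine (Complex.abs_re_le_norm _).trans ?_
    rw [norm_mul, norm_pow, hμ, he]; norm_num
  have h3 : |paraCoordDeriv μ e x| ≤ (Real.sqrt ‖slitMap x‖)⁻¹ := by
    refine (Complex.abs_re_le_norm _).trans ?_
    rw [norm_mul, norm_div, hμ, he, norm_mul, Complex.norm_ofNat, norm_slitRoot, one_mul,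
      one_div, mul_inv]
    exact mul_le_of_le_one_left (by positivity) (by norm_num)
  rw [fderiv_diffracted hx e μ hω]
  generalize 2 / (Real.sqrt Real.pi : ℂ) * csqrt (-2 * Complex.I * ω) = C
  have h4 : ‖Complex.I * ω * linearPhase μ e * diffracted μ ω x‖ ≤ 3 * ‖ω‖ * E := by
    rw [norm_mul, norm_mul, norm_mul, Complex.norm_I, one_mul, Complex.norm_real,
      Real.norm_eq_abs]
    calc ‖ω‖ * |linearPhase μ e| * ‖diffracted μ ω x‖ ≤ ‖ω‖ * 1 * (3 * E) := by
          gcongr; exact norm_diffracted_le hμ hre hω hx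
      _ = _ := by ring
  have h5 : ‖C * (circularWave μ ω x * paraCoordDeriv μ e x)‖
      ≤ ‖C‖ * (E * (Real.sqrt ‖slitMap x‖)⁻¹) := by
    rw [norm_mul, norm_mul, norm_circularWave hμ, Complex.norm_real, Real.norm_eq_abs]
    gcongr
  refine (norm_sub_le _ _).trans ((add_le_add h4 h5).trans ?_)
  have : 0 ≤ (Real.sqrt ‖slitMap x‖)⁻¹ := by positivity
  nlinarith [mul_nonneg (mul_nonneg (norm_nonneg ω) hE0.le) this, mul_nonneg (norm_nonneg C) hE0.le]

/-! ### Square integrability -/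

theorem integrable_exp_abs_mul_rpow {d : ℝ} (hd : 0 < d) :
    Integrable fun t : ℝ => Real.exp (-d * |t|) * (1 + |t| ^ (-1 / 2 : ℝ)) := by
  set p : ℝ → ℝ := fun t => Real.exp (-d * t) * (1 + t ^ (-1 / 2 : ℝ)) with hp
  have h1 : IntegrableOn p (Ioi 0) := by
    have a1 := integrableOn_rpow_mul_exp_neg_mul_rpow (s := 0) (by norm_num) one_pos hd
    have a2 := integrableOn_rpow_mul_exp_neg_mul_rpow (s := -1 / 2) (by norm_num) one_pos hd
    refine (a1.add a2).congr (.of_forall fun t => ?_)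
    simp only [Pi.add_apply, Real.rpow_zero, Real.rpow_one, hp]
    ring
  have h2 : IntegrableOn (fun t => p |t|) (Ioi 0) :=
    h1.congr_fun (fun t ht => by rw [abs_of_pos ht]) measurableSet_Ioi
  have h3 : IntegrableOn (fun t => p |t|) (Iic 0) := by
    rw [← Measure.map_neg_eq_self (volume : Measure ℝ)]
    have m : MeasurableEmbedding fun x : ℝ => -x := (Homeomorph.neg ℝ).measurableEmbedding
    rw [m.integrableOn_map_iff]
    simp_rw [Function.comp_def, abs_neg, neg_preimage, neg_Iic, neg_zero]
    rwa [integrableOn_Ici_iff_integrableOn_Ioi]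
  rw [← integrableOn_univ, ← Iic_union_Ioi (a := (0 : ℝ))]
  exact h3.union h2

theorem abs_fst_le_norm_slitMap (x : Plane) : |x.1| ≤ ‖slitMap x‖ := by
  have := Complex.abs_re_le_norm (slitMap x)
  rwa [slitMap_re, abs_neg] at this

theorem abs_snd_le_norm_slitMap (x : Plane) : |x.2| ≤ ‖slitMap x‖ := by
  have := Complex.abs_im_le_norm (slitMap x)
  rwa [slitMap_im, abs_neg] at this

theorem ae_fst_ne_zero : ∀ᵐ x : Plane, x.1 ≠ 0 := by
  have h : volume {x : Plane | x.1 = 0} = 0 := by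
    have : {x : Plane | x.1 = 0} = {0} ×ˢ univ := by ext x; simp
    rw [this, Measure.volume_eq_prod, Measure.prod_prod]; simp
  exact measure_eq_zero_iff_ae_notMem.1 h

/-- Since `r ≥ |x₁|` and `r ≥ |x₂|`, one has `r⁻¹ ≤ |x₁|^{-1/2} |x₂|^{-1/2}` and `e^{-2dr} ≤
e^{-d|x₁|} e^{-d|x₂|}`. The square is thus dominated by a product of integrable functions of one
variable, which avoids polar coordinates. -/
theorem memLp_of_norm_le_exp {v : Plane → ℂ} (hv : ContinuousOn v Q) {C d : ℝ} (hd : 0 < d)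
    (h : ∀ x ∈ Q, ‖v x‖ ≤ C * (Real.exp (-(d * ‖slitMap x‖))
      * (1 + (Real.sqrt ‖slitMap x‖)⁻¹))) : MemLp v 2 (volume.restrict Q) := by
  have hm := hv.aestronglyMeasurable (μ := volume) isOpen_Q.measurableSet
  rw [memLp_two_iff_integrable_sq_norm hm]
  have hP := integrable_exp_abs_mul_rpow hd
  have hPP : Integrable (fun x : Plane => 2 * C ^ 2 *
      ((Real.exp (-d * |x.1|) * (1 + |x.1| ^ (-1 / 2 : ℝ))) *
        (Real.exp (-d * |x.2|) * (1 + |x.2| ^ (-1 / 2 : ℝ))))) :=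
    (hP.mul_prod hP).const_mul _
  refine hPP.restrict.mono' (hm.norm.pow 2) ?_
  refine (ae_restrict_iff' isOpen_Q.measurableSet).2 ?_
  filter_upwards [ae_fst_ne_zero, ae_snd_ne_zero] with x h1 h2 hx
  rw [Real.norm_of_nonneg (by positivity)]
  set r := ‖slitMap x‖
  have ha : 0 < |x.1| := abs_pos.2 h1
  have hb : 0 < |x.2| := abs_pos.2 h2
  have har : |x.1| ≤ r := abs_fst_le_norm_slitMap x
  have hbr : |x.2| ≤ r := abs_snd_le_norm_slitMap x
  have hr : 0 < r := ha.trans_le har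
  have hpow : ∀ t : ℝ, 0 < t → t ^ (-1 / 2 : ℝ) = (Real.sqrt t)⁻¹ := fun t ht => by
    rw [Real.sqrt_eq_rpow, ← Real.rpow_neg ht.le]; norm_num
  rw [hpow _ ha, hpow _ hb]
  have e1 : Real.exp (-(d * r)) ^ 2 ≤ Real.exp (-d * |x.1|) * Real.exp (-d * |x.2|) := by
    rw [pow_two, ← Real.exp_add, ← Real.exp_add]
    refine Real.exp_le_exp.2 ?_
    have := mul_le_mul_of_nonneg_left (add_le_add har hbr) hd.le
    linarith
  have e2 : r⁻¹ ≤ (Real.sqrt |x.1|)⁻¹ * (Real.sqrt |x.2|)⁻¹ := by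
    rw [← mul_inv]
    refine inv_anti₀ (mul_pos (Real.sqrt_pos.2 ha) (Real.sqrt_pos.2 hb)) ?_
    calc _ ≤ Real.sqrt r * Real.sqrt r :=
          mul_le_mul (Real.sqrt_le_sqrt har) (Real.sqrt_le_sqrt hbr) (Real.sqrt_nonneg _)
            (Real.sqrt_nonneg _)
      _ = r := Real.mul_self_sqrt hr.le
  have e3 : (1 + (Real.sqrt r)⁻¹) ^ 2 ≤ 2 * ((1 + (Real.sqrt |x.1|)⁻¹) *
      (1 + (Real.sqrt |x.2|)⁻¹)) := by
    have h3 : (Real.sqrt r)⁻¹ ^ 2 = r⁻¹ := by rw [inv_pow, Real.sq_sqrt hr.le]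
    have h4 : 0 < (Real.sqrt |x.1|)⁻¹ := inv_pos.2 (Real.sqrt_pos.2 ha)
    have h5 : 0 < (Real.sqrt |x.2|)⁻¹ := inv_pos.2 (Real.sqrt_pos.2 hb)
    nlinarith [sq_nonneg (1 - (Real.sqrt r)⁻¹)]
  calc ‖v x‖ ^ 2 ≤ (C * (Real.exp (-(d * r)) * (1 + (Real.sqrt r)⁻¹))) ^ 2 :=
        pow_le_pow_left₀ (norm_nonneg _) (h x hx) 2
    _ = C ^ 2 * (Real.exp (-(d * r)) ^ 2 * (1 + (Real.sqrt r)⁻¹) ^ 2) := by ring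
    _ ≤ C ^ 2 * ((Real.exp (-d * |x.1|) * Real.exp (-d * |x.2|)) *
        (2 * ((1 + (Real.sqrt |x.1|)⁻¹) * (1 + (Real.sqrt |x.2|)⁻¹)))) := by
        gcongr
    _ = _ := by ring

theorem memH1_diffracted {μ : ℂ} (hμ : ‖μ‖ = 1) (hre : 0 < μ.re)
    (hd : 0 < μ.re ^ 2 - μ.im ^ 2) {ω : ℂ} (hω : 0 < ω.im) : MemH1 (diffracted μ ω) := by
  have hc : ContDiffOn ℝ 1 (diffracted μ ω) Q :=
    (contDiffOn_diffracted μ hω).of_le (by exact_mod_cast le_top)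
  refine memH1_of_contDiffOn hc ?_ fun e he => ?_
  · refine memLp_of_norm_le_exp (C := 3) hc.continuousOn (mul_pos hd hω) fun x hx => ?_
    refine (norm_diffracted_le hμ hre hω hx).trans ?_
    gcongr
    refine le_mul_of_one_le_right (Real.exp_pos _).le ?_
    have : 0 ≤ (Real.sqrt ‖slitMap x‖)⁻¹ := by positivity
    linarith
  · refine memLp_of_norm_le_exp
      (continuousOn_fderiv_apply (n := 0) (by exact_mod_cast hc) e).continuousOn (mul_pos hd hω)
      fun x hx => norm_fderiv_diffracted_le hμ hre hω hx ?_
    rcases he with rfl | rfl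
    · rw [show slitMap (1, 0) = -1 from
        Complex.ext (by simp [slitMap_re]) (by simp [slitMap_im])]; simp
    · rw [show slitMap (0, 1) = -Complex.I from
        Complex.ext (by simp [slitMap_re]) (by simp [slitMap_im])]; simp

/-! ### Boundary values on the slit -/

theorem two_mul_csqrt_re_mul_im (z : ℂ) :
    2 * (csqrt z).re * (csqrt z).im = z.im := by
  have := congrArg Complex.im (csqrt_sq z)
  rw [pow_two, Complex.mul_im] at this
  linarith

/-- Above the slit the principal root of `s + iε` has positive imaginary part, so multiplication by
`-i` yields the root of `-(s + iε)` with positive real part. Below the slit the signs are reversed,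
and the two one-sided limits are `∓i√s`. -/
theorem slitRoot_of_pos {s ε : ℝ} (hε : 0 < ε) :
    slitRoot (s, ε) = -Complex.I * csqrt (s + ε * Complex.I) := by
  have hz : (s + ε * Complex.I : ℂ) ∈ Complex.slitPlane := Or.inr (by simpa using hε.ne')
  have h2 := csqrt_re_pos hz
  have h1 : _ = ε := (two_mul_csqrt_re_mul_im (s + ε * Complex.I)).trans (by simp)
  refine csqrt_eq_of_sq_eq (slitMap_mem (slice_mem_Q hε.ne')) ?_ ?_
  · have : (-Complex.I * csqrt (s + ε * Complex.I)).re = (csqrt (s + ε * Complex.I)).im := by simp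
    rw [this]
    by_contra h
    rw [not_lt] at h
    nlinarith
  · rw [mul_pow, csqrt_sq, neg_sq, Complex.I_sq]
    exact Complex.ext (by simp [slitMap_re]) (by simp [slitMap_im])

theorem slitRoot_of_neg {s ε : ℝ} (hε : 0 < ε) :
    slitRoot (s, -ε) = Complex.I * csqrt (s - ε * Complex.I) := by
  have hz : (s - ε * Complex.I : ℂ) ∈ Complex.slitPlane := Or.inr (by simpa using hε.ne')
  have h2 := csqrt_re_pos hz
  have h1 : _ = -ε := (two_mul_csqrt_re_mul_im (s - ε * Complex.I)).trans (by simp)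
  refine csqrt_eq_of_sq_eq (slitMap_mem (slice_mem_Q (neg_ne_zero.2 hε.ne'))) ?_ ?_
  · have : (Complex.I * csqrt (s - ε * Complex.I)).re = -(csqrt (s - ε * Complex.I)).im := by simp
    rw [this]
    by_contra h
    rw [not_lt] at h
    nlinarith
  · rw [mul_pow, csqrt_sq, Complex.I_sq]
    exact Complex.ext (by simp [slitMap_re]) (by simp [slitMap_im])

theorem tendsto_slitRoot_pos {s : ℝ} (hs : 0 < s) :
    Tendsto (fun ε : ℝ => slitRoot (s, ε)) (𝓝[>] 0) (𝓝 (-Complex.I * Real.sqrt s)) := by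
  have h0 : csqrt (s : ℂ) = Real.sqrt s := csqrt_eq_of_sq_eq (Or.inl (by simpa using hs))
    (by simpa using hs) (by exact_mod_cast Real.sq_sqrt hs.le)
  have h1 : Tendsto (fun ε : ℝ => (s + ε * Complex.I : ℂ)) (𝓝[>] 0) (𝓝 (s : ℂ)) := by
    have : Continuous fun ε : ℝ => (s + ε * Complex.I : ℂ) := by fun_prop
    simpa using (this.tendsto 0).mono_left nhdsWithin_le_nhds
  have h2 := ((hasDerivAt_csqrt (z := s) (Or.inl (by simpa using hs))).continuousAt.tendsto.comp
    h1).const_mul (-Complex.I)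
  rw [h0] at h2
  refine h2.congr' ?_
  filter_upwards [self_mem_nhdsWithin] with ε hε
  exact (slitRoot_of_pos hε).symm

theorem tendsto_slitRoot_neg {s : ℝ} (hs : 0 < s) :
    Tendsto (fun ε : ℝ => slitRoot (s, -ε)) (𝓝[>] 0) (𝓝 (Complex.I * Real.sqrt s)) := by
  have h0 : csqrt (s : ℂ) = Real.sqrt s := csqrt_eq_of_sq_eq (Or.inl (by simpa using hs))
    (by simpa using hs) (by exact_mod_cast Real.sq_sqrt hs.le)
  have h1 : Tendsto (fun ε : ℝ => (s - ε * Complex.I : ℂ)) (𝓝[>] 0) (𝓝 (s : ℂ)) := by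
    have : Continuous fun ε : ℝ => (s - ε * Complex.I : ℂ) := by fun_prop
    simpa using (this.tendsto 0).mono_left nhdsWithin_le_nhds
  have h2 := ((hasDerivAt_csqrt (z := s) (Or.inl (by simpa using hs))).continuousAt.tendsto.comp
    h1).const_mul Complex.I
  rw [h0] at h2
  refine h2.congr' ?_
  filter_upwards [self_mem_nhdsWithin] with ε hε
  exact (slitRoot_of_neg hε).symm

theorem tendsto_diffracted {μ ω z : ℂ} {s : ℝ} {δ : ℝ → ℝ} (hδ : Tendsto δ (𝓝[>] 0) (𝓝 0))
    (h : Tendsto (fun ε : ℝ => slitRoot (s, δ ε)) (𝓝[>] 0) (𝓝 z)) :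
    Tendsto (fun ε : ℝ => diffracted μ ω (s, δ ε)) (𝓝[>] 0)
      (𝓝 (Complex.exp (Complex.I * ω * ((μ ^ 2).re * s : ℝ))
        * erfc (csqrt (-2 * Complex.I * ω) * ((μ * z).re : ℝ)))) := by
  have h1 : Tendsto (fun ε => linearPhase μ (s, δ ε)) (𝓝[>] 0) (𝓝 ((μ ^ 2).re * s)) := by
    have hc : Continuous fun t : ℝ => linearPhase μ (s, t) :=
      (contDiff_linearPhase μ).continuous.comp (by fun_prop)
    have h2 := (hc.tendsto 0).comp hδ
    have h3 : linearPhase μ (s, 0) = (μ ^ 2).re * s := by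
      have : slitMap (s, 0) = -(s : ℂ) :=
        Complex.ext (by simp [slitMap_re]) (by simp [slitMap_im])
      rw [linearPhase, this, mul_neg, Complex.neg_re, neg_neg, Complex.re_mul_ofReal]
    rwa [h3] at h2
  have h2 : Tendsto (fun ε => paraCoord μ (s, δ ε)) (𝓝[>] 0) (𝓝 (μ * z).re) :=
    (Complex.continuous_re.tendsto _).comp (h.const_mul μ)
  have h3 := ((Complex.continuous_ofReal.tendsto _).comp h1).const_mul (Complex.I * ω)
  have h4 := ((Complex.continuous_ofReal.tendsto _).comp h2).const_mul
    (csqrt (-2 * Complex.I * ω))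
  exact ((Complex.continuous_exp.tendsto _).comp h3).mul
    ((differentiable_erfc.continuous.tendsto _).comp h4)

/-- The Fourier–Laplace transform of the scattered wave, for an incident wave whose profile has the
transform `F`. -/
def scatteredTransform (μ : ℂ) (F : ℂ → ℂ) (ω : ℂ) (x : Plane) : ℂ :=
  -(F ω / 2) * (diffracted μ ω x + diffracted ((starRingEnd ℂ) μ) ω x)

/-- Dominated convergence: the exponential in `s` is a square integrable majorant independent of
`ε`. -/
theorem tendsto_eLpNorm_slice {V : Plane → ℂ} (hV : ContinuousOn V Q) {g : ℝ → ℂ}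
    (hg : Continuous g) {δ : ℝ → ℝ} (hδ : ∀ᶠ ε in 𝓝[>] (0 : ℝ), δ ε ≠ 0) {C d : ℝ} (hd : 0 < d)
    (hb : ∀ᶠ ε in 𝓝[>] (0 : ℝ), ∀ s > 0, ‖V (s, δ ε) - g s‖ ≤ C * Real.exp (-(d * s)))
    (hl : ∀ s > 0, Tendsto (fun ε => V (s, δ ε)) (𝓝[>] 0) (𝓝 (g s))) :
    Tendsto (fun ε : ℝ => eLpNorm (fun s => V (s, δ ε) - g s) 2 (volume.restrict (Ioi (0 : ℝ))))
      (𝓝[>] 0) (𝓝 0) := by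
  have h1 : Tendsto (fun ε : ℝ => ∫⁻ s in Ioi (0 : ℝ), ‖V (s, δ ε) - g s‖ₑ ^ (2 : ℝ)) (𝓝[>] 0)
      (𝓝 (∫⁻ _ in Ioi (0 : ℝ), 0)) := by
    refine tendsto_lintegral_filter_of_dominated_convergence
      (fun s => ENNReal.ofReal (C * Real.exp (-(d * s))) ^ (2 : ℝ)) ?_ ?_ ?_ ?_
    · filter_upwards [hδ] with ε hε
      exact (((continuous_slice hV hε).sub hg).enorm.measurable).pow_const 2
    · filter_upwards [hb] with ε hε
      refine (ae_restrict_iff' measurableSet_Ioi).2 (.of_forall fun s hs => ?_)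
      rw [← ofReal_norm]
      exact ENNReal.rpow_le_rpow (ENNReal.ofReal_le_ofReal (hε s hs)) (by norm_num)
    · have hi : IntegrableOn (fun s => C ^ 2 * Real.exp (-(2 * d) * s)) (Ioi 0) :=
        (exp_neg_integrableOn_Ioi 0 (by linarith)).const_mul _
      have e : ∀ s, ENNReal.ofReal (C * Real.exp (-(d * s))) ^ (2 : ℝ)
          ≤ ‖C ^ 2 * Real.exp (-(2 * d) * s)‖ₑ := fun s => by
        rw [ENNReal.rpow_two]
        calc _ ≤ ‖C * Real.exp (-(d * s))‖ₑ ^ 2 := by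
              gcongr; exact Real.ofReal_le_enorm _
          _ = _ := by
              rw [← enorm_pow, mul_pow, ← Real.exp_nat_mul]
              congr 3; push_cast; ring
      exact ((lintegral_mono e).trans_lt hi.2).ne
    · refine (ae_restrict_iff' measurableSet_Ioi).2 (.of_forall fun s hs => ?_)
      have := ((hl s hs).sub_const (g s))
      rw [sub_self] at this
      have h2 := (this.enorm).ennrpow_const 2
      simpa using h2
  rw [lintegral_zero] at h1
  have h2 := h1.ennrpow_const (1 / 2)
  rw [ENNReal.zero_rpow_of_pos (by norm_num)] at h2
  refine h2.congr fun ε => ?_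
  rw [eLpNorm_eq_lintegral_rpow_enorm_toReal two_ne_zero (by simp)]
  simp

theorem hasDirichletTrace_scatteredTransform {μ : ℂ} (hμ : ‖μ‖ = 1) (hre : 0 < μ.re)
    (hd : 0 < μ.re ^ 2 - μ.im ^ 2) (F : ℂ → ℂ) {ω : ℂ} (hω : 0 < ω.im) :
    HasDirichletTrace (scatteredTransform μ F ω)
      fun s => -(F ω * Complex.exp (Complex.I * ω * ((μ.re ^ 2 - μ.im ^ 2) * s : ℝ))) := by
  have hμ' : ‖(starRingEnd ℂ) μ‖ = 1 := by rw [RCLike.norm_conj, hμ]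
  have hre' : 0 < ((starRingEnd ℂ) μ).re := by simpa using hre
  have hV : ContinuousOn (scatteredTransform μ F ω) Q :=
    continuousOn_const.mul ((contDiffOn_diffracted μ hω).continuousOn.add
      (contDiffOn_diffracted _ hω).continuousOn)
  have hb : ∀ s > 0, ∀ t : ℝ, t ≠ 0 → ‖scatteredTransform μ F ω (s, t)
      - -(F ω * Complex.exp (Complex.I * ω * ((μ.re ^ 2 - μ.im ^ 2) * s : ℝ)))‖
      ≤ 4 * ‖F ω‖ * Real.exp (-((μ.re ^ 2 - μ.im ^ 2) * ω.im * s)) := fun s hs t ht => by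
    have hx : ((s, t) : Plane) ∈ Q := slice_mem_Q ht
    have hr : s ≤ ‖slitMap (s, t)‖ := (le_abs_self s).trans (abs_fst_le_norm_slitMap (s, t))
    have hE : Real.exp (-((μ.re ^ 2 - μ.im ^ 2) * ω.im * ‖slitMap (s, t)‖))
        ≤ Real.exp (-((μ.re ^ 2 - μ.im ^ 2) * ω.im * s)) := by
      refine Real.exp_le_exp.2 (neg_le_neg ?_)
      gcongr
    have h1 := norm_diffracted_le hμ hre hω hx
    have h2 := norm_diffracted_le hμ' hre' hω hx
    simp only [Complex.conj_re, Complex.conj_im, neg_sq] at h2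
    refine (norm_sub_le _ _).trans ?_
    rw [scatteredTransform, norm_mul, norm_neg, norm_neg, norm_mul, norm_exp_I_mul, norm_div,
      Complex.norm_ofNat]
    have h3 : Real.exp (-(ω.im * ((μ.re ^ 2 - μ.im ^ 2) * s)))
        = Real.exp (-((μ.re ^ 2 - μ.im ^ 2) * ω.im * s)) := by congr 1; ring
    rw [h3]
    have h4 := norm_add_le (diffracted μ ω (s, t)) (diffracted ((starRingEnd ℂ) μ) ω (s, t))
    have h5 : ‖diffracted μ ω (s, t) + diffracted ((starRingEnd ℂ) μ) ω (s, t)‖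
      ≤ 6 * Real.exp (-((μ.re ^ 2 - μ.im ^ 2) * ω.im * s)) := by linarith
    have := mul_le_mul_of_nonneg_left h5 (by positivity : 0 ≤ ‖F ω‖ / 2)
    linarith
  have hl : ∀ {δ : ℝ → ℝ} {s : ℝ} {z : ℂ}, Tendsto δ (𝓝[>] 0) (𝓝 0) → z.re = 0 →
      Tendsto (fun ε : ℝ => slitRoot (s, δ ε)) (𝓝[>] 0) (𝓝 z) →
      Tendsto (fun ε => scatteredTransform μ F ω (s, δ ε)) (𝓝[>] 0)
        (𝓝 (-(F ω * Complex.exp (Complex.I * ω * ((μ.re ^ 2 - μ.im ^ 2) * s : ℝ))))) :=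
    fun {δ s z} hδ hz h => by
      have h1 := ((tendsto_diffracted (μ := μ) (ω := ω) hδ h).add
        (tendsto_diffracted (μ := (starRingEnd ℂ) μ) (ω := ω) hδ h)).const_mul (-(F ω / 2))
      -- For imaginary `z` the two parabolic coordinates are opposite, so the values of `erfc` add
      -- up to `2`, whichever side of the slit is approached.
      have e1 : ((starRingEnd ℂ) μ * z).re = -(μ * z).re := by simp [hz]
      have e2 : (((starRingEnd ℂ) μ) ^ 2).re = μ.re ^ 2 - μ.im ^ 2 := by
        rw [pow_two, Complex.mul_re]; simp; ring
      have e3 : (μ ^ 2).re = μ.re ^ 2 - μ.im ^ 2 := by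
        rw [pow_two, Complex.mul_re]; ring
      rw [e1, e2, e3, Complex.ofReal_neg, mul_neg, erfc_neg] at h1
      refine (h1.trans (le_of_eq (congrArg 𝓝 ?_)))
      ring
  have hg : Continuous fun s : ℝ =>
      -(F ω * Complex.exp (Complex.I * ω * ((μ.re ^ 2 - μ.im ^ 2) * s : ℝ))) := by fun_prop
  have hid : Tendsto (fun ε : ℝ => ε) (𝓝[>] 0) (𝓝 0) := nhdsWithin_le_nhds
  have hneg : Tendsto (fun ε : ℝ => -ε) (𝓝[>] 0) (𝓝 0) := by simpa using hid.neg
  have p1 : ∀ᶠ ε in 𝓝[>] (0 : ℝ), ε ≠ 0 := by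
    filter_upwards [self_mem_nhdsWithin] with ε hε using ne_of_gt hε
  have p2 : ∀ᶠ ε in 𝓝[>] (0 : ℝ), -ε ≠ 0 := p1.mono fun _ h => neg_ne_zero.2 h
  exact ⟨tendsto_eLpNorm_slice hV hg (δ := fun ε => ε) p1 (mul_pos hd hω)
      (p1.mono fun ε hε s hs => hb s hs ε hε)
      fun s hs => hl hid (by simp) (tendsto_slitRoot_pos hs),
    tendsto_eLpNorm_slice hV hg (δ := fun ε => -ε) p2 (mul_pos hd hω)
      (p2.mono fun ε hε s hs => hb s hs (-ε) hε)
      fun s hs => hl hneg (by simp) (tendsto_slitRoot_neg hs)⟩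

/-! ### The scattered wave in the time domain -/

instance isAddHaarMeasure_spaceTime : (volume : Measure SpaceTime).IsAddHaarMeasure :=
  Measure.prod.instIsAddHaarMeasure _ _

theorem exists_distribution_of_bounded {h : SpaceTime → ℂ} (hm : StronglyMeasurable h) {B : ℝ}
    (hb : ∀ p, ‖h p‖ ≤ B) (h0 : ∀ p, p.2 < 0 → h p = 0) :
    ∃ u : 𝓢'(SpaceTime, ℂ), IsVanishingOn u {p : SpaceTime | p.2 < 0} ∧
      ∀ (ω : ℂ) (hω : 0 < ω.im) (φ : 𝓢(Plane, ℂ)), fourierLaplace u ω hω φ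
        = ∫ x, φ x * ∫ t in Ioi (0 : ℝ), Complex.exp (Complex.I * ω * t) * h (x, t) := by
  have hL : MemLp h ⊤ (volume : Measure SpaceTime) :=
    memLp_top_of_bound hm.aestronglyMeasurable B (.of_forall hb)
  have hu : ∀ g : 𝓢(SpaceTime, ℂ), Lp.toTemperedDistribution hL.toLp g = ∫ p, g p * h p := by
    intro g
    rw [Lp.toTemperedDistribution_apply]
    refine integral_congr_ae ?_
    filter_upwards [hL.coeFn_toLp] with p hp
    rw [hp, smul_eq_mul]
  refine ⟨Lp.toTemperedDistribution hL.toLp, fun g hg => ?_, fun ω hω φ => ?_⟩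
  · rw [hu]
    refine integral_eq_zero_of_ae (.of_forall fun p => ?_)
    by_cases hp : p ∈ tsupport g
    · simp only [h0 p (hg hp), mul_zero, Pi.zero_apply]
    · simp only [image_eq_zero_of_notMem_tsupport hp, zero_mul, Pi.zero_apply]
  · rw [fourierLaplace, hu]
    have hi : Integrable (fun p : SpaceTime => tensor φ (timeKernel ω hω) p * h p) :=
      (tensor φ (timeKernel ω hω)).integrable.mul_bdd hm.aestronglyMeasurable (.of_forall hb)
    rw [Measure.volume_eq_prod] at hi ⊢
    rw [integral_prod _ hi]
    refine integral_congr_ae (.of_forall fun x => ?_)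
    simp only [tensor_apply]
    simp_rw [mul_assoc]
    rw [integral_const_mul, ← integral_Ici_eq_integral_Ioi]
    congr 1
    rw [← setIntegral_eq_integral_of_forall_compl_eq_zero (s := Ici (0 : ℝ))
      fun t ht => by rw [h0 (x, t) (not_le.1 ht), mul_zero]]
    refine setIntegral_congr_fun measurableSet_Ici fun t ht => ?_
    change expCutoff ω t * _ = _
    rw [expCutoff_eq_exp ω (by linarith [mem_Ici.1 ht]), mul_assoc Complex.I]

theorem measurable_csqrt : Measurable csqrt := measurable_id.pow_const _

theorem measurable_paraCoord (μ : ℂ) : Measurable (paraCoord μ) :=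
  Complex.measurable_re.comp
    ((measurable_csqrt.comp slitMap.continuous.measurable).const_mul μ)

/-- The signal `k`, superposed with the delays `‖slitMap x‖ + 2 ℓ² v²`. -/
def delayedSuperposition (μ : ℂ) (k : ℝ → ℂ) (p : SpaceTime) : ℂ :=
  (Real.pi : ℂ)⁻¹ * ∫ v : ℝ, k (p.2 - (linearPhase μ p.1 + 2 * paraCoord μ p.1 ^ 2
    + 2 * paraCoord μ p.1 ^ 2 * v ^ 2)) * ((1 + v ^ 2)⁻¹ : ℝ)

open Classical in
/-- The diffracted wave in the time domain. -/
def diffractedSignal (μ : ℂ) (k : ℝ → ℂ) (p : SpaceTime) : ℂ :=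
  if 0 ≤ paraCoord μ p.1 then delayedSuperposition μ k p
  else 2 * k (p.2 - |linearPhase μ p.1|) - delayedSuperposition μ k p

/-! ### Bounds and Fourier–Laplace transforms of the delayed signals. -/

section Signal

variable {k : ℝ → ℂ} (hk : StronglyMeasurable k) {B : ℝ} (hB : ∀ τ, ‖k τ‖ ≤ B)
  (hk0 : ∀ τ < 0, k τ = 0)

include hk in
theorem stronglyMeasurable_delayedSuperposition (μ : ℂ) :
    StronglyMeasurable (delayedSuperposition μ k) := by
  refine (StronglyMeasurable.integral_prod_right (f := fun (p : SpaceTime) (v : ℝ) =>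
    k (p.2 - (linearPhase μ p.1 + 2 * paraCoord μ p.1 ^ 2
      + 2 * paraCoord μ p.1 ^ 2 * v ^ 2)) * ((1 + v ^ 2)⁻¹ : ℝ)) ?_).const_mul _
  have h1 : Measurable fun q : SpaceTime × ℝ => paraCoord μ q.1.1 :=
    (measurable_paraCoord μ).comp (measurable_fst.comp measurable_fst)
  have h2 : Measurable fun q : SpaceTime × ℝ => linearPhase μ q.1.1 :=
    (contDiff_linearPhase μ).continuous.measurable.comp (measurable_fst.comp measurable_fst)
  refine StronglyMeasurable.mul (hk.comp_measurable (by fun_prop)) ?_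
  exact (Complex.measurable_ofReal.comp (by fun_prop)).stronglyMeasurable

include hk in
theorem stronglyMeasurable_diffractedSignal (μ : ℂ) :
    StronglyMeasurable (diffractedSignal μ k) := by
  have h1 : Measurable fun p : SpaceTime => paraCoord μ p.1 :=
    (measurable_paraCoord μ).comp measurable_fst
  have h2 : Measurable fun p : SpaceTime => |linearPhase μ p.1| :=
    ((contDiff_linearPhase μ).continuous.comp continuous_fst).abs.measurable
  have h3 := stronglyMeasurable_delayedSuperposition hk μ
  exact StronglyMeasurable.ite (measurableSet_le measurable_const h1) h3
    (((hk.comp_measurable (measurable_snd.sub h2)).const_mul 2).sub h3)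

include hB in
theorem norm_delayedSuperposition_le (μ : ℂ) (p : SpaceTime) :
    ‖delayedSuperposition μ k p‖ ≤ B := by
  have h : ‖∫ v : ℝ, k (p.2 - (linearPhase μ p.1 + 2 * paraCoord μ p.1 ^ 2
      + 2 * paraCoord μ p.1 ^ 2 * v ^ 2)) * ((1 + v ^ 2)⁻¹ : ℝ)‖ ≤ ∫ v : ℝ, B * (1 + v ^ 2)⁻¹ := by
    refine norm_integral_le_of_norm_le (integrable_inv_one_add_sq.const_mul B)
      (.of_forall fun v => ?_)
    rw [norm_mul, Complex.norm_real, Real.norm_of_nonneg (by positivity)]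
    gcongr
    exact hB _
  rw [integral_const_mul, integral_univ_inv_one_add_sq] at h
  rw [delayedSuperposition, norm_mul, norm_inv, Complex.norm_real,
    Real.norm_of_nonneg Real.pi_pos.le]
  rw [inv_mul_le_iff₀ Real.pi_pos]
  linarith

include hB in
theorem norm_diffractedSignal_le (μ : ℂ) (p : SpaceTime) : ‖diffractedSignal μ k p‖ ≤ 3 * B := by
  have h1 := norm_delayedSuperposition_le hB μ p
  have h2 := (norm_nonneg _).trans h1
  unfold diffractedSignal
  split_ifs
  · linarith
  · refine (norm_sub_le _ _).trans ?_
    rw [norm_mul, Complex.norm_ofNat]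
    linarith [hB (p.2 - |linearPhase μ p.1|)]

include hk0 in
theorem delayedSuperposition_of_neg {μ : ℂ} (hμ : ‖μ‖ = 1) {p : SpaceTime} (hp : p.2 < 0) :
    delayedSuperposition μ k p = 0 := by
  rw [delayedSuperposition, integral_eq_zero_of_ae, mul_zero]
  refine .of_forall fun v => ?_
  have h1 := linearPhase_add_paraCoord hμ p.1
  have h2 : 0 ≤ 2 * paraCoord μ p.1 ^ 2 * v ^ 2 := by positivity
  simp only [Pi.zero_apply]
  rw [hk0 _ (by linarith [norm_nonneg (slitMap p.1)]), zero_mul]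

include hk0 in
-- The absolute value in the geometric term makes every delay nonnegative at all points of the
-- plane. It changes nothing on the relevant part of `Q`, where `N ≥ 0` as soon as `ℓ < 0`.
theorem diffractedSignal_of_neg {μ : ℂ} (hμ : ‖μ‖ = 1) {p : SpaceTime} (hp : p.2 < 0) :
    diffractedSignal μ k p = 0 := by
  unfold diffractedSignal
  rw [delayedSuperposition_of_neg hk0 hμ hp, hk0 _ (by linarith [abs_nonneg (linearPhase μ p.1)])]
  simp

include hk0 in
theorem fourierLaplaceFun_delay (ω : ℂ) {c : ℝ} (hc : 0 ≤ c) :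
    fourierLaplaceFun (fun t => k (t - c)) ω
      = Complex.exp (Complex.I * ω * c) * fourierLaplaceFun k ω := by
  have := setIntegral_delay (k := fun τ => Complex.exp (Complex.I * ω * τ) * k τ)
    (fun τ hτ => by simp only [hk0 τ hτ, mul_zero]) hc
  rw [fourierLaplaceFun, fourierLaplaceFun, ← this, ← integral_const_mul]
  refine integral_congr_ae (.of_forall fun t => ?_)
  simp only
  rw [← mul_assoc, ← Complex.exp_add]
  congr 2
  push_cast
  ring

theorem integrableOn_exp_frequency {ω : ℂ} (hω : 0 < ω.im) :
    IntegrableOn (fun t : ℝ => Complex.exp (Complex.I * ω * t)) (Ioi 0) := by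
  have h := exp_neg_integrableOn_Ioi 0 hω
  refine h.mono' (Continuous.aestronglyMeasurable (by fun_prop)) (.of_forall fun t => ?_)
  rw [norm_exp_I_mul, neg_mul]

include hk hB in
theorem integrableOn_exp_mul {ω : ℂ} (hω : 0 < ω.im) :
    IntegrableOn (fun t : ℝ => Complex.exp (Complex.I * ω * t) * k t) (Ioi 0) :=
  (integrableOn_exp_frequency hω).mul_bdd hk.aestronglyMeasurable (.of_forall hB)

include hk hB hk0 in
-- By Fubini the transform is taken for each `v` separately; the nonnegative delay `|x| + 2ℓ²v²`
-- becomes the factor `e^{iω|x|} e^{2iωℓ²v²}`, which is the integrand of `circularSuperposition`.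
theorem fourierLaplaceFun_delayedSuperposition {μ : ℂ} (hμ : ‖μ‖ = 1) {ω : ℂ} (hω : 0 < ω.im)
    (x : Plane) : fourierLaplaceFun (fun t => delayedSuperposition μ k (x, t)) ω
      = fourierLaplaceFun k ω * circularSuperposition μ ω x := by
  set θ : ℝ → ℝ := fun v => linearPhase μ x + 2 * paraCoord μ x ^ 2
    + 2 * paraCoord μ x ^ 2 * v ^ 2 with hθ
  have hθ0 : ∀ v, 0 ≤ θ v := fun v => by
    simp only [hθ]
    rw [linearPhase_add_paraCoord hμ]
    positivity
  have hint : Integrable (Function.uncurry fun (t v : ℝ) => Complex.exp (Complex.I * ω * t) *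
      (k (t - θ v) * ((1 + v ^ 2)⁻¹ : ℝ))) ((volume.restrict (Ioi 0)).prod volume) := by
    have h1 := (integrableOn_exp_frequency hω).mul_prod
      (integrable_inv_one_add_sq.ofReal (𝕜 := ℂ))
    have h2 : StronglyMeasurable fun q : ℝ × ℝ => k (q.1 - θ q.2) :=
      hk.comp_measurable (by fun_prop)
    refine (h1.mul_bdd (c := B) h2.aestronglyMeasurable (.of_forall fun q => hB _)).congr
      (.of_forall fun q => ?_)
    simp only [Function.uncurry]
    rw [mul_assoc, mul_comm (k _)]
    rfl
  rw [fourierLaplaceFun]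
  have e1 : ∀ t : ℝ, Complex.exp (Complex.I * ω * t) * delayedSuperposition μ k (x, t)
      = (Real.pi : ℂ)⁻¹ * ∫ v : ℝ, Complex.exp (Complex.I * ω * t) *
        (k (t - θ v) * ((1 + v ^ 2)⁻¹ : ℝ)) := fun t => by
    rw [integral_const_mul, delayedSuperposition]
    ring
  simp_rw [e1]
  have e3 : (∫ v : ℝ, ∫ t : ℝ in Ioi (0 : ℝ), Complex.exp (Complex.I * ω * t) *
      (k (t - θ v) * ((1 + v ^ 2)⁻¹ : ℝ)))
      = (fourierLaplaceFun k ω * circularWave μ ω x) * ∫ v : ℝ,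
        Complex.exp (-(-2 * Complex.I * ω) * paraCoord μ x ^ 2 * v ^ 2) * ((1 + v ^ 2)⁻¹ : ℝ) := by
    rw [← integral_const_mul]
    refine integral_congr_ae (.of_forall fun v => ?_)
    have h1 := fourierLaplaceFun_delay hk0 ω (hθ0 v)
    rw [fourierLaplaceFun] at h1
    simp only
    simp_rw [← mul_assoc]
    rw [integral_mul_const, h1, circularWave]
    have e2 : Complex.exp (Complex.I * ω * θ v)
        = Complex.exp (Complex.I * ω * (linearPhase μ x + 2 * paraCoord μ x ^ 2 : ℝ))
          * Complex.exp (-(-2 * Complex.I * ω) * paraCoord μ x ^ 2 * v ^ 2) := by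
      rw [← Complex.exp_add]
      congr 1
      simp only [hθ]
      push_cast
      ring
    rw [e2]
    ring
  rw [integral_const_mul, integral_integral_swap hint, e3, circularSuperposition]
  ring

include hk hB in
theorem integrableOn_exp_mul_delayedSuperposition (μ : ℂ) {ω : ℂ} (hω : 0 < ω.im) (x : Plane) :
    IntegrableOn (fun t : ℝ => Complex.exp (Complex.I * ω * t) * delayedSuperposition μ k (x, t))
      (Ioi 0) :=
  (integrableOn_exp_frequency hω).mul_bdd (c := B)
    ((stronglyMeasurable_delayedSuperposition hk μ).comp_measurable
      measurable_prodMk_left).aestronglyMeasurable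
    (.of_forall fun _ => norm_delayedSuperposition_le hB μ _)

include hk hB in
theorem integrableOn_exp_mul_diffractedSignal (μ : ℂ) {ω : ℂ} (hω : 0 < ω.im) (x : Plane) :
    IntegrableOn (fun t : ℝ => Complex.exp (Complex.I * ω * t) * diffractedSignal μ k (x, t))
      (Ioi 0) :=
  (integrableOn_exp_frequency hω).mul_bdd (c := 3 * B)
    ((stronglyMeasurable_diffractedSignal hk μ).comp_measurable
      measurable_prodMk_left).aestronglyMeasurable
    (.of_forall fun _ => norm_diffractedSignal_le hB μ _)

include hk hB hk0 in
theorem fourierLaplaceFun_diffractedSignal {μ : ℂ} (hμ : ‖μ‖ = 1) (hre : 0 < μ.re)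
    (hd : 0 < μ.re ^ 2 - μ.im ^ 2) {ω : ℂ} (hω : 0 < ω.im) {x : Plane} (hx : x ∈ Q) :
    fourierLaplaceFun (fun t => diffractedSignal μ k (x, t)) ω
      = fourierLaplaceFun k ω * diffracted μ ω x := by
  have h1 := fourierLaplaceFun_delayedSuperposition hk hB hk0 hμ hω x
  rcases le_or_gt 0 (paraCoord μ x) with hl | hl
  · rw [diffracted_of_nonneg hω hl, ← h1]
    simp only [diffractedSignal, if_pos hl]
  · have hN : 0 ≤ linearPhase μ x :=
      (mul_nonneg hd.le (norm_nonneg _)).trans (linearPhase_ge hμ hre hx hl)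
    have h2 := fourierLaplaceFun_delay hk0 ω hN
    rw [fourierLaplaceFun] at h1 h2
    simp only [diffractedSignal, if_neg (not_le.2 hl), abs_of_nonneg hN]
    have hi : IntegrableOn (fun t : ℝ => Complex.exp (Complex.I * ω * t) *
        k (t - linearPhase μ x)) (Ioi 0) :=
      (integrableOn_exp_frequency hω).mul_bdd
        (hk.comp_measurable (by fun_prop)).aestronglyMeasurable (.of_forall fun _ => hB _)
    have e : ∀ t : ℝ, Complex.exp (Complex.I * ω * t) * (2 * k (t - linearPhase μ x)
        - delayedSuperposition μ k (x, t)) = 2 * (Complex.exp (Complex.I * ω * t) *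
          k (t - linearPhase μ x)) - Complex.exp (Complex.I * ω * t) *
          delayedSuperposition μ k (x, t) := fun t => by ring
    rw [fourierLaplaceFun]
    simp_rw [e]
    rw [integral_sub (hi.const_mul 2) (integrableOn_exp_mul_delayedSuperposition hk hB μ hω x),
      integral_const_mul, h2, h1, diffracted_of_neg hω hl]
    ring

end Signal

theorem ae_mem_Q : ∀ᵐ x : Plane, x ∈ Q := ae_snd_ne_zero.mono fun _ hx h => hx h.1

theorem contDiffOn_scatteredTransform (μ : ℂ) (F : ℂ → ℂ) {ω : ℂ} (hω : 0 < ω.im) :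
    ContDiffOn ℝ (⊤ : ℕ∞) (scatteredTransform μ F ω) Q :=
  contDiffOn_const.mul ((contDiffOn_diffracted μ hω).add (contDiffOn_diffracted _ hω))

/-- The frequency-domain solution is realised by a bounded measurable function in the time domain,
so no inversion of the Fourier–Laplace transform is required. -/
theorem exists_scattered_distribution {k : ℝ → ℂ} (hk : StronglyMeasurable k) {B : ℝ}
    (hB : ∀ τ, ‖k τ‖ ≤ B) (hk0 : ∀ τ < 0, k τ = 0) {μ : ℂ} (hμ : ‖μ‖ = 1) (hre : 0 < μ.re)
    (hd : 0 < μ.re ^ 2 - μ.im ^ 2) :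
    ∃ u : 𝓢'(SpaceTime, ℂ), IsVanishingOn u {p : SpaceTime | p.2 < 0} ∧
      HasFourierLaplaceTransform u (scatteredTransform μ (fourierLaplaceFun k)) := by
  have hμ' : ‖(starRingEnd ℂ) μ‖ = 1 := by rw [RCLike.norm_conj, hμ]
  have hre' : 0 < ((starRingEnd ℂ) μ).re := by simpa using hre
  have hd' : 0 < ((starRingEnd ℂ) μ).re ^ 2 - ((starRingEnd ℂ) μ).im ^ 2 := by simpa using hd
  obtain ⟨u, hu0, hu⟩ := exists_distribution_of_bounded (B := 3 * B)
    (h := fun p => -(1 / 2) * (diffractedSignal μ k p + diffractedSignal ((starRingEnd ℂ) μ) k p))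
    (((stronglyMeasurable_diffractedSignal hk μ).add
      (stronglyMeasurable_diffractedSignal hk _)).const_mul _)
    (fun p => by
      rw [norm_mul]
      have h1 := norm_diffractedSignal_le hB μ p
      have h2 := norm_diffractedSignal_le hB ((starRingEnd ℂ) μ) p
      have h3 := norm_add_le (diffractedSignal μ k p) (diffractedSignal ((starRingEnd ℂ) μ) k p)
      have h4 : ‖(-(1 / 2) : ℂ)‖ = 1 / 2 := by simp
      rw [h4]
      linarith)
    (fun p hp => by
      rw [diffractedSignal_of_neg hk0 hμ hp, diffractedSignal_of_neg hk0 hμ' hp]; simp)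
  refine ⟨u, hu0, fun ω hω φ => ⟨?_, ?_⟩⟩
  · have hb : ∀ x ∈ Q, ‖scatteredTransform μ (fourierLaplaceFun k) ω x‖
        ≤ ‖fourierLaplaceFun k ω / 2‖ * 6 := fun x hx => by
      have h1 := norm_diffracted_le hμ hre hω hx
      have h2 := norm_diffracted_le hμ' hre' hω hx
      have h3 : ∀ {d : ℝ}, 0 < d → Real.exp (-(d * ω.im * ‖slitMap x‖)) ≤ 1 := fun {d} hd =>
        Real.exp_le_one_iff.2 (neg_nonpos.2 (by positivity))
      rw [scatteredTransform, norm_mul, norm_neg]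
      refine mul_le_mul_of_nonneg_left ((norm_add_le _ _).trans ?_) (norm_nonneg _)
      linarith [h3 hd, h3 hd']
    have hm : AEStronglyMeasurable (scatteredTransform μ (fourierLaplaceFun k) ω)
        (volume.restrict Q) :=
      (contDiffOn_scatteredTransform μ _ hω).continuousOn.aestronglyMeasurable
        isOpen_Q.measurableSet
    exact φ.integrable.restrict.bdd_mul hm
      ((ae_restrict_iff' isOpen_Q.measurableSet).2 (.of_forall hb))
  · rw [hu ω hω φ, Measure.restrict_eq_self_of_ae_mem ae_mem_Q]
    refine integral_congr_ae ?_
    filter_upwards [ae_mem_Q] with x hx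
    have h1 := fourierLaplaceFun_diffractedSignal hk hB hk0 hμ hre hd hω hx
    have h2 := fourierLaplaceFun_diffractedSignal hk hB hk0 hμ' hre' hd' hω hx
    rw [fourierLaplaceFun] at h1 h2
    have e : ∀ t : ℝ, Complex.exp (Complex.I * ω * t) * (-(1 / 2) *
        (diffractedSignal μ k (x, t) + diffractedSignal ((starRingEnd ℂ) μ) k (x, t)))
        = -(1 / 2) * (Complex.exp (Complex.I * ω * t) * diffractedSignal μ k (x, t)
          + Complex.exp (Complex.I * ω * t) * diffractedSignal ((starRingEnd ℂ) μ) k (x, t)) :=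
      fun t => by ring
    simp_rw [e]
    rw [integral_const_mul, integral_add (integrableOn_exp_mul_diffractedSignal hk hB μ hω x)
      (integrableOn_exp_mul_diffractedSignal hk hB _ hω x), h1, h2, scatteredTransform]
    ring

/-! ### Holomorphic families of smooth functions -/

theorem two_le_smooth : (2 : WithTop ℕ∞) ≤ ((⊤ : ℕ∞) : WithTop ℕ∞) := by
  have h : ((2 : ℕ∞) : WithTop ℕ∞) ≤ ((⊤ : ℕ∞) : WithTop ℕ∞) := WithTop.coe_le_coe.2 le_top
  exact h

/-- `U` is a family of functions on `Q`, jointly smooth and holomorphic in the parameter, with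
derivative `U'` with respect to the parameter. -/
structure HolomorphicFamily {E : Type} [NormedAddCommGroup E] [NormedSpace ℝ E] [NormedSpace ℂ E]
    (U U' : ℂ → Plane → E) : Prop where
  smooth : ContDiffOn ℝ (⊤ : ℕ∞) (Function.uncurry U) (UpperFrequencies ×ˢ Q)
  smooth_deriv : ContDiffOn ℝ (⊤ : ℕ∞) (Function.uncurry U') (UpperFrequencies ×ˢ Q)
  hasDerivAt : ∀ z ∈ UpperFrequencies, ∀ x ∈ Q, HasDerivAt (fun z => U z x) (U' z x) z

theorem isOpen_frequencies_prod_Q : IsOpen (UpperFrequencies ×ˢ Q) :=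
  isOpen_UpperFrequencies.prod isOpen_Q

/-! ### Difference quotients and plane derivatives of holomorphic families. -/

section Families

variable {E : Type} [NormedAddCommGroup E] [NormedSpace ℝ E]

/-- The partial derivative in the plane. -/
def planeFDeriv (U : ℂ → Plane → E) (z : ℂ) (x : Plane) : Plane →L[ℝ] E :=
  (fderiv ℝ (Function.uncurry U) (z, x)).comp (ContinuousLinearMap.inr ℝ ℂ Plane)

theorem contDiffOn_planeFDeriv {U : ℂ → Plane → E}
    (hU : ContDiffOn ℝ (⊤ : ℕ∞) (Function.uncurry U) (UpperFrequencies ×ˢ Q)) :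
    ContDiffOn ℝ (⊤ : ℕ∞) (Function.uncurry (planeFDeriv U)) (UpperFrequencies ×ˢ Q) :=
  (hU.fderiv_of_isOpen (m := (⊤ : ℕ∞)) isOpen_frequencies_prod_Q
    (by exact_mod_cast le_top)).clm_comp contDiffOn_const

theorem hasFDerivAt_slice {U : ℂ → Plane → E}
    (hU : ContDiffOn ℝ (⊤ : ℕ∞) (Function.uncurry U) (UpperFrequencies ×ˢ Q)) {z : ℂ}
    (hz : z ∈ UpperFrequencies) {x : Plane} (hx : x ∈ Q) :
    HasFDerivAt (U z) (planeFDeriv U z x) x := by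
  have h1 : DifferentiableAt ℝ (Function.uncurry U) (z, x) :=
    (hU.contDiffAt (isOpen_frequencies_prod_Q.mem_nhds ⟨hz, hx⟩)).differentiableAt (by simp)
  exact h1.hasFDerivAt.comp x (hasFDerivAt_prodMk_right z x)

theorem hasFDerivAt_frequency {U : ℂ → Plane → E}
    (hU : ContDiffOn ℝ (⊤ : ℕ∞) (Function.uncurry U) (UpperFrequencies ×ˢ Q)) {z : ℂ}
    (hz : z ∈ UpperFrequencies) {x : Plane} (hx : x ∈ Q) :
    HasFDerivAt (fun z => U z x) ((fderiv ℝ (Function.uncurry U) (z, x)).comp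
      (ContinuousLinearMap.inl ℝ ℂ Plane)) z := by
  have h1 : DifferentiableAt ℝ (Function.uncurry U) (z, x) :=
    (hU.contDiffAt (isOpen_frequencies_prod_Q.mem_nhds ⟨hz, hx⟩)).differentiableAt (by simp)
  exact h1.hasFDerivAt.comp (f := fun z => (z, x)) z (hasFDerivAt_prodMk_left z x)

variable [NormedSpace ℂ E]

/-- Mean value inequality on a disc for `U ζ x - ζ • U' ω x`, whose derivative `U' ζ x - U' ω x` is
small uniformly in `x ∈ K` by compactness. -/
theorem HolomorphicFamily.eventually_norm_sub_lt {U U' : ℂ → Plane → E}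
    (h : HolomorphicFamily U U') {ω : ℂ} (hω : ω ∈ UpperFrequencies) {K : Set Plane} (hKQ : K ⊆ Q)
    (hK : IsCompact K) {ε : ℝ} (hε : 0 < ε) :
    ∀ᶠ z in 𝓝[≠] ω, ∀ x ∈ K, ‖U' ω x - (z - ω)⁻¹ • (U z x - U ω x)‖ < ε := by
  obtain ⟨v, hv, hvK⟩ := hK.mem_uniformity_of_prod (f := U') (s := UpperFrequencies) (q := ω)
    (h.smooth_deriv.continuousOn.mono (prod_mono le_rfl hKQ)) hω
    (Metric.dist_mem_uniformity (half_pos hε))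
  rw [isOpen_UpperFrequencies.nhdsWithin_eq hω] at hv
  obtain ⟨δ, hδ, hball⟩ := Metric.mem_nhds_iff.1
    (Filter.inter_mem hv (isOpen_UpperFrequencies.mem_nhds hω))
  filter_upwards [nhdsWithin_le_nhds (Metric.ball_mem_nhds ω hδ), self_mem_nhdsWithin]
    with z hz hne x hx
  have hd : ∀ ζ ∈ Metric.ball ω δ, HasDerivWithinAt (fun ζ => U ζ x - ζ • U' ω x)
      (U' ζ x - U' ω x) (Metric.ball ω δ) ζ := fun ζ hζ => by
    have h1 := (h.hasDerivAt ζ (hball hζ).2 x (hKQ hx)).sub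
      ((hasDerivAt_id ζ).smul_const (U' ω x))
    rw [one_smul] at h1
    exact h1.hasDerivWithinAt
  have h2 := (convex_ball ω δ).norm_image_sub_le_of_norm_hasDerivWithin_le hd
    (fun ζ hζ => by
      have := hvK ζ (hball hζ).1 x hx
      rw [← dist_eq_norm]
      exact (le_of_lt this)) (Metric.mem_ball_self hδ) hz
  have hzω : z - ω ≠ 0 := sub_ne_zero.2 hne
  have e : U' ω x - (z - ω)⁻¹ • (U z x - U ω x)
      = -((z - ω)⁻¹ • (U z x - z • U' ω x - (U ω x - ω • U' ω x))) := by
    have : U z x - z • U' ω x - (U ω x - ω • U' ω x)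
        = (U z x - U ω x) - (z - ω) • U' ω x := by rw [sub_smul]; abel
    rw [this, smul_sub _ (U z x - U ω x), smul_smul, inv_mul_cancel₀ hzω, one_smul, neg_sub]
  rw [e, norm_neg, norm_smul, norm_inv]
  have hpos : 0 < ‖z - ω‖ := norm_pos_iff.2 hzω
  calc ‖z - ω‖⁻¹ * _ ≤ ‖z - ω‖⁻¹ * (ε / 2 * ‖z - ω‖) := by gcongr
    _ = ε / 2 := by field_simp
    _ < ε := half_lt_self hε

variable [IsScalarTower ℝ ℂ E]

theorem HolomorphicFamily.fderiv_apply {U U' : ℂ → Plane → E} (h : HolomorphicFamily U U') {z : ℂ}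
    (hz : z ∈ UpperFrequencies) {x : Plane} (hx : x ∈ Q) (ζ : ℂ) :
    fderiv ℝ (Function.uncurry U) (z, x) (ζ, 0) = ζ • U' z x := by
  have h1 := hasFDerivAt_frequency h.smooth hz hx
  have h2 := (h.hasDerivAt z hz x hx).hasFDerivAt.restrictScalars ℝ
  have h3 := congrArg (fun L : ℂ →L[ℝ] E => L ζ) (h1.unique h2)
  simpa using h3

/-- Symmetry of the second real derivative exchanges the derivatives in the frequency and in the
plane. The frequency derivative of the plane derivative is therefore complex linear, with the plane
derivative of `U'` as its value. -/
theorem HolomorphicFamily.planeFDeriv [SMulCommClass ℝ ℂ E] {U U' : ℂ → Plane → E}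
    (h : HolomorphicFamily U U') : HolomorphicFamily (planeFDeriv U) (planeFDeriv U') where
  smooth := contDiffOn_planeFDeriv h.smooth
  smooth_deriv := contDiffOn_planeFDeriv h.smooth_deriv
  hasDerivAt z hz x hx := by
    have h1 := hasFDerivAt_frequency (contDiffOn_planeFDeriv h.smooth) hz hx
    refine hasFDerivAt_of_restrictScalars ℝ h1 ?_
    have hmem := isOpen_frequencies_prod_Q.mem_nhds (show (z, x) ∈ UpperFrequencies ×ˢ Q
      from ⟨hz, hx⟩)
    have hV := h.smooth.contDiffAt hmem
    have hV' : DifferentiableAt ℝ (Function.uncurry U') (z, x) :=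
      (h.smooth_deriv.contDiffAt hmem).differentiableAt (by simp)
    have hD : DifferentiableAt ℝ (fderiv ℝ (Function.uncurry U)) (z, x) :=
      (hV.fderiv_right (m := 1)
        (one_add_one_eq_two.trans_le two_le_smooth)).differentiableAt one_ne_zero
    have hsymm : IsSymmSndFDerivAt ℝ (Function.uncurry U) (z, x) :=
      hV.isSymmSndFDerivAt (by simpa using two_le_smooth)
    refine ContinuousLinearMap.ext fun ζ => ContinuousLinearMap.ext fun e => ?_
    have e1 : fderiv ℝ (Function.uncurry (HalfPlaneDiffraction.planeFDeriv U)) (z, x) (ζ, 0) e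
        = fderiv ℝ (fderiv ℝ (Function.uncurry U)) (z, x) (ζ, 0) (0, e) := by
      have := (hD.hasFDerivAt.clm_comp (hasFDerivAt_const (ContinuousLinearMap.inr ℝ ℂ Plane)
        (z, x))).fderiv
      have e2 : Function.uncurry (HalfPlaneDiffraction.planeFDeriv U)
        = fun p => (fderiv ℝ (Function.uncurry U) p).comp (ContinuousLinearMap.inr ℝ ℂ Plane) := rfl
      rw [e2, this]
      simp
    have e3 : fderiv ℝ (fderiv ℝ (Function.uncurry U)) (z, x) (0, e) (ζ, 0)
        = ζ • fderiv ℝ (Function.uncurry U') (z, x) (0, e) := by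
      have a1 := (hD.hasFDerivAt.clm_apply (hasFDerivAt_const ((ζ, 0) : ℂ × Plane) (z, x)))
      have a2 : HasFDerivAt (fun p : ℂ × Plane => ζ • Function.uncurry U' p)
          (ζ • fderiv ℝ (Function.uncurry U') (z, x)) (z, x) := hV'.hasFDerivAt.const_smul ζ
      have a3 : (fun p : ℂ × Plane => fderiv ℝ (Function.uncurry U) p (ζ, 0))
          =ᶠ[𝓝 (z, x)] fun p => ζ • Function.uncurry U' p := by
        filter_upwards [hmem] with p hp
        exact h.fderiv_apply hp.1 hp.2 ζ
      have a4 := congrArg (fun L : ℂ × Plane →L[ℝ] E => L (0, e))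
        (a1.unique (a2.congr_of_eventuallyEq a3))
      simpa using a4
    have e4 := hsymm (ζ, 0) (0, e)
    have goal : fderiv ℝ (Function.uncurry (HalfPlaneDiffraction.planeFDeriv U)) (z, x) (ζ, 0) e
        = ζ • fderiv ℝ (Function.uncurry U') (z, x) (0, e) := by
      rw [e1, e4, e3]
    simpa [HalfPlaneDiffraction.planeFDeriv] using goal.symm

end Families

/-- Induction on the order, replacing the family by its plane derivative. The target space changes
at each step, which is why the statement is general in `E`. -/
theorem HolomorphicFamily.tendstoUniformlyOn : ∀ (k : ℕ) {E : Type} [NormedAddCommGroup E]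
    [NormedSpace ℝ E] [NormedSpace ℂ E] [IsScalarTower ℝ ℂ E] [SMulCommClass ℝ ℂ E]
    {U U' : ℂ → Plane → E}, HolomorphicFamily U U' → ∀ {ω : ℂ}, ω ∈ UpperFrequencies →
    ∀ {K : Set Plane}, K ⊆ Q → IsCompact K →
    TendstoUniformlyOn (fun z => iteratedFDeriv ℝ k (fun x => (z - ω)⁻¹ • (U z x - U ω x)))
      (iteratedFDeriv ℝ k (U' ω)) (𝓝[≠] ω) K
  | 0, E, _, _, _, _, _, U, U', h, ω, hω, K, hKQ, hK => by
    rw [Metric.tendstoUniformlyOn_iff]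
    intro ε hε
    filter_upwards [h.eventually_norm_sub_lt hω hKQ hK hε] with z hz x hx
    rw [iteratedFDeriv_zero_eq_comp, iteratedFDeriv_zero_eq_comp, Function.comp_apply,
      Function.comp_apply, LinearIsometryEquiv.dist_map, dist_eq_norm]
    exact hz x hx
  | k + 1, E, _, _, _, _, _, U, U', h, ω, hω, K, hKQ, hK => by
    have ih := HolomorphicFamily.tendstoUniformlyOn k h.planeFDeriv hω hKQ hK
    rw [Metric.tendstoUniformlyOn_iff] at ih ⊢
    intro ε hε
    filter_upwards [ih ε hε, nhdsWithin_le_nhds (isOpen_UpperFrequencies.mem_nhds hω)]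
      with z hz hzU x hx
    rw [iteratedFDeriv_succ_eq_comp_right, iteratedFDeriv_succ_eq_comp_right, Function.comp_apply,
      Function.comp_apply, LinearIsometryEquiv.dist_map]
    have hQ := isOpen_Q.mem_nhds (hKQ hx)
    have e1 : (fun y => fderiv ℝ (U' ω) y) =ᶠ[𝓝 x] HalfPlaneDiffraction.planeFDeriv U' ω := by
      filter_upwards [hQ] with y hy
      exact (hasFDerivAt_slice h.smooth_deriv hω hy).fderiv
    have e2 : (fun y => fderiv ℝ (fun x => (z - ω)⁻¹ • (U z x - U ω x)) y) =ᶠ[𝓝 x]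
        fun y => (z - ω)⁻¹ • (HalfPlaneDiffraction.planeFDeriv U z y
          - HalfPlaneDiffraction.planeFDeriv U ω y) := by
      filter_upwards [hQ] with y hy
      exact (((hasFDerivAt_slice h.smooth hzU hy).sub
        (hasFDerivAt_slice h.smooth hω hy)).const_smul ((z - ω)⁻¹)).fderiv
    rw [(e1.iteratedFDeriv ℝ k).eq_of_nhds, (e2.iteratedFDeriv ℝ k).eq_of_nhds]
    exact hz x hx

theorem isHolomorphicC2_of_joint {U : ℂ → Plane → ℂ}
    (hU : ContDiffOn ℝ (⊤ : ℕ∞) (Function.uncurry U) (UpperFrequencies ×ˢ Q))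
    (hd : ∀ z ∈ UpperFrequencies, ∀ x ∈ Q, DifferentiableAt ℂ (fun z => U z x) z) :
    IsHolomorphicC2 U := by
  have hslice : ∀ {V : ℂ → Plane → ℂ},
      ContDiffOn ℝ (⊤ : ℕ∞) (Function.uncurry V) (UpperFrequencies ×ˢ Q) →
      ∀ ω ∈ UpperFrequencies, ContDiffOn ℝ 2 (V ω) Q := fun {V} hV ω hω =>
    (hV.comp (f := fun x => (ω, x)) (contDiff_const.prodMk contDiff_id).contDiffOn
      fun _ hx => ⟨hω, hx⟩).of_le two_le_smooth
  have hU' : ContDiffOn ℝ (⊤ : ℕ∞) (Function.uncurry fun z x =>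
      fderiv ℝ (Function.uncurry U) (z, x) (1, 0)) (UpperFrequencies ×ˢ Q) :=
    (hU.fderiv_of_isOpen (m := (⊤ : ℕ∞)) isOpen_frequencies_prod_Q
      (by exact_mod_cast le_top)).clm_apply contDiffOn_const
  have hF : HolomorphicFamily U fun z x => fderiv ℝ (Function.uncurry U) (z, x) (1, 0) := by
    refine ⟨hU, hU', fun z hz x hx => ?_⟩
    have h1 := (hd z hz x hx).hasDerivAt
    have h2 := (hasFDerivAt_frequency hU hz hx).unique (h1.hasFDerivAt.restrictScalars ℝ)
    have h3 := congrArg (fun L : ℂ →L[ℝ] ℂ => L 1) h2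
    have h4 : fderiv ℝ (Function.uncurry U) (z, x) (1, 0) = deriv (fun z => U z x) z := by
      simpa using h3
    rw [h4]
    exact h1
  exact fun ω hω => ⟨hslice hU ω hω, _, hslice hU' ω hω, fun k _ K hKQ hK =>
    hF.tendstoUniformlyOn k hω hKQ hK⟩

theorem isHolomorphicC2_scatteredTransform (μ : ℂ) {F : ℂ → ℂ}
    (hF : DifferentiableOn ℂ F UpperFrequencies) : IsHolomorphicC2 (scatteredTransform μ F) := by
  have hF' : ContDiffOn ℝ (⊤ : ℕ∞) F UpperFrequencies :=
    (hF.contDiffOn (n := (⊤ : ℕ∞)) isOpen_UpperFrequencies).restrict_scalars ℝ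
  refine isHolomorphicC2_of_joint ?_ fun z hz x _ => ?_
  · exact ((hF'.comp contDiffOn_fst fun _ hp => hp.1).div_const 2).neg.mul
      ((contDiffOn_diffracted_joint μ).add (contDiffOn_diffracted_joint _))
  · exact (((hF z hz).differentiableAt (isOpen_UpperFrequencies.mem_nhds hz)).div_const 2).neg.mul
      ((differentiableAt_diffracted_frequency μ hz x).add
        (differentiableAt_diffracted_frequency _ hz x))

theorem differentiableOn_fourierLaplaceFun {k : ℝ → ℂ} (hk : StronglyMeasurable k) {B : ℝ}
    (hB : ∀ τ, ‖k τ‖ ≤ B) : DifferentiableOn ℂ (fourierLaplaceFun k) UpperFrequencies := by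
  intro ω hω
  have hω' : 0 < ω.im := hω
  have hm : ∀ z : ℂ, AEStronglyMeasurable (fun t : ℝ => Complex.exp (Complex.I * z * t) * k t)
      (volume.restrict (Ioi 0)) := fun z =>
    (Continuous.aestronglyMeasurable (by fun_prop)).mul hk.aestronglyMeasurable
  have h := hasDerivAt_integral_of_dominated_loc_of_deriv_le (μ := volume.restrict (Ioi (0 : ℝ)))
    (F := fun (z : ℂ) (t : ℝ) => Complex.exp (Complex.I * z * t) * k t)
    (F' := fun (z : ℂ) (t : ℝ) => Complex.exp (Complex.I * z * t) * (Complex.I * t) * k t)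
    -- On this half-plane all exponentials are dominated by the one with rate `Im ω / 2`.
    (x₀ := ω) (s := {z | ω.im / 2 < z.im})
    (bound := fun t => t ^ (1 : ℝ) * Real.exp (-(ω.im / 2) * t ^ (1 : ℝ)) * B)
    ((isOpen_lt continuous_const Complex.continuous_im).mem_nhds (half_lt_self hω'))
    (.of_forall hm) (integrableOn_exp_mul hk hB hω')
    ((Continuous.aestronglyMeasurable (by fun_prop)).mul hk.aestronglyMeasurable)
    ((ae_restrict_iff' measurableSet_Ioi).2 (.of_forall fun t ht z hz => by
      have ht' : 0 < t := ht
      have hz' : ω.im / 2 < z.im := hz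
      rw [norm_mul, norm_mul, norm_exp_I_mul, norm_mul, Complex.norm_I, one_mul, Complex.norm_real,
        Real.norm_of_nonneg ht'.le, Real.rpow_one, mul_comm t]
      gcongr
      · nlinarith
      · exact hB t))
    ((integrableOn_rpow_mul_exp_neg_mul_rpow (by norm_num) one_pos (half_pos hω')).mul_const B)
    (.of_forall fun t z _ => by
      have h1 : HasDerivAt (fun z : ℂ => Complex.I * z * t) (Complex.I * t) z := by
        simpa using ((hasDerivAt_id z).const_mul Complex.I).mul_const (t : ℂ)
      exact h1.cexp.mul_const (k t))
  exact h.2.differentiableAt.differentiableWithinAt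

/-! ### Existence for the mixed problem -/

/-- Beyond some `T` the limit `1` bounds `f`; on `[0, T]` the weight `(1 + |s|)^p` is bounded away
from zero, whatever the sign of `p`. -/
theorem IsProfile.exists_norm_le {f : ℝ → ℂ} (hf : IsProfile f) : ∃ B, ∀ s, ‖f s‖ ≤ B := by
  obtain ⟨p, C, hC⟩ := hf.bounded
  obtain ⟨T, hT⟩ := eventually_atTop.1
    (hf.tendsto_one.norm.eventually (gt_mem_nhds (norm_one.trans_lt one_lt_two)))
  obtain ⟨M, hM⟩ := (isCompact_Icc (a := (0 : ℝ)) (b := T)).bddAbove_image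
    (f := fun s : ℝ => (1 + |s|) ^ (-p)) (Continuous.continuousOn <|
      (by fun_prop : Continuous fun s : ℝ => 1 + |s|).rpow_const fun s => .inl (by positivity))
  refine ⟨max 2 (M * |C|), fun s => ?_⟩
  rcases lt_or_ge s 0 with h0 | h0
  · rw [hf.eq_zero s h0, norm_zero]
    exact zero_le_two.trans (le_max_left _ _)
  · rcases le_or_gt T s with h | h
    · exact (hT s h).le.trans (le_max_left _ _)
    · refine le_trans ?_ (le_max_right _ _)
      have hp : 0 < 1 + |s| := by positivity
      have e : ‖f s‖ = (1 + |s|) ^ (-p) * ((1 + |s|) ^ p * ‖f s‖) := by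
        rw [← mul_assoc, ← Real.rpow_add hp, neg_add_cancel, Real.rpow_zero, one_mul]
      rw [e]
      have h1 : (1 + |s|) ^ (-p) ≤ M := hM (mem_image_of_mem _ ⟨h0, h.le⟩)
      have h2 := (hC s).trans (le_abs_self C)
      have h3 : 0 ≤ (1 + |s|) ^ (-p) := by positivity
      exact mul_le_mul h1 h2 (by positivity) (h3.trans h1)

/-- The profile is only almost everywhere strongly measurable. A measurable representative, cut off
for negative times and where it exceeds the bound, satisfies all the conditions pointwise and has
the same transform. -/
theorem IsProfile.exists_signal {f : ℝ → ℂ} (hf : IsProfile f) (ω₀ : ℝ) :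
    ∃ (k : ℝ → ℂ) (B : ℝ), StronglyMeasurable k ∧ (∀ τ, ‖k τ‖ ≤ B) ∧ (∀ τ < 0, k τ = 0) ∧
      ∀ ω, fourierLaplaceFun k ω = profileTransform ω₀ f ω := by
  obtain ⟨B, hB⟩ := hf.exists_norm_le
  have hm := hf.locallyIntegrable.aestronglyMeasurable
  set S : Set ℝ := Ici 0 ∩ {τ | ‖hm.mk f τ‖ ≤ B} with hS
  have hSm : MeasurableSet S :=
    measurableSet_Ici.inter (hm.stronglyMeasurable_mk.norm.measurable measurableSet_Iic)
  refine ⟨fun τ => Complex.exp (-Complex.I * ω₀ * τ) * S.indicator (hm.mk f) τ, B,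
    (Continuous.stronglyMeasurable (by fun_prop)).mul (hm.stronglyMeasurable_mk.indicator hSm),
    fun τ => ?_, fun τ hτ => ?_, fun ω => ?_⟩
  · have h1 : ‖Complex.exp (-Complex.I * ω₀ * τ)‖ = 1 := by
      rw [Complex.norm_exp]; simp
    rw [norm_mul, h1, one_mul]
    by_cases h : τ ∈ S
    · rw [indicator_of_mem h]; exact h.2
    · rw [indicator_of_notMem h, norm_zero]; exact (norm_nonneg _).trans (hB 0)
  · have h : τ ∉ S := fun h => (not_le.2 hτ) h.1
    simp only [indicator_of_notMem h, mul_zero]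
  · refine integral_congr_ae ?_
    filter_upwards [ae_restrict_mem measurableSet_Ioi, ae_restrict_of_ae hm.ae_eq_mk] with τ hτ he
    have h : τ ∈ S := ⟨mem_Ici.2 (le_of_lt hτ), by rw [mem_ofPred_eq, ← he]; exact hB τ⟩
    simp only [indicator_of_mem h]
    rw [← he, ← mul_assoc, ← Complex.exp_add]
    congr 2
    ring

theorem fderiv_const_mul_add_apply {v w : Plane → ℂ} {x : Plane} (hv : DifferentiableAt ℝ v x)
    (hw : DifferentiableAt ℝ w x) (c : ℂ) (e : Plane) :
    fderiv ℝ (fun x => c * (v x + w x)) x e = c * (fderiv ℝ v x e + fderiv ℝ w x e) := by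
  rw [fderiv_const_mul (hv.fun_add hw), fderiv_fun_add hv hw]
  rfl

theorem memH1_const_mul_add {v w : Plane → ℂ} (hv : ContDiffOn ℝ 1 v Q)
    (hw : ContDiffOn ℝ 1 w Q) (h1 : MemH1 v) (h2 : MemH1 w) (c : ℂ) :
    MemH1 fun x => c * (v x + w x) := by
  refine memH1_of_contDiffOn (contDiffOn_const.mul (hv.add hw)) ((h1.1.add h2.1).const_mul c)
    fun e he => ?_
  refine (memLp_congr_ae ?_).1
    (((memLp_fderiv_of_memH1 hv h1 he).add (memLp_fderiv_of_memH1 hw h2 he)).const_mul c)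
  refine (ae_restrict_iff' isOpen_Q.measurableSet).2 (.of_forall fun x hx => ?_)
  have d1 := (hv.contDiffAt (isOpen_Q.mem_nhds hx)).differentiableAt one_ne_zero
  have d2 := (hw.contDiffAt (isOpen_Q.mem_nhds hx)).differentiableAt one_ne_zero
  exact (fderiv_const_mul_add_apply d1 d2 c e).symm

theorem planeLaplacian_const_mul_add {v w : Plane → ℂ} (hv : ContDiffOn ℝ 2 v Q)
    (hw : ContDiffOn ℝ 2 w Q) (c : ℂ) {x : Plane} (hx : x ∈ Q) :
    planeLaplacian (fun x => c * (v x + w x)) x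
      = c * (planeLaplacian v x + planeLaplacian w x) := by
  have d : ∀ {v : Plane → ℂ}, ContDiffOn ℝ 2 v Q → ∀ y ∈ Q, DifferentiableAt ℝ v y :=
    fun hv y hy => (hv.contDiffAt (isOpen_Q.mem_nhds hy)).differentiableAt two_ne_zero
  have d' : ∀ {v : Plane → ℂ}, ContDiffOn ℝ 2 v Q → ∀ e : Plane,
      DifferentiableAt ℝ (fun y => fderiv ℝ v y e) x := fun hv e =>
    (((hv.contDiffAt (isOpen_Q.mem_nhds hx)).fderiv_right (m := 1)
      one_add_one_eq_two.le).differentiableAt one_ne_zero).clm_apply (differentiableAt_const e)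
  have key : ∀ e : Plane,
      fderiv ℝ (fun y => fderiv ℝ (fun x => c * (v x + w x)) y e) x e
        = c * (fderiv ℝ (fun y => fderiv ℝ v y e) x e
          + fderiv ℝ (fun y => fderiv ℝ w y e) x e) := fun e => by
    have he : (fun y => fderiv ℝ (fun x => c * (v x + w x)) y e)
        =ᶠ[𝓝 x] fun y => c * (fderiv ℝ v y e + fderiv ℝ w y e) := by
      filter_upwards [isOpen_Q.mem_nhds hx] with y hy
      exact fderiv_const_mul_add_apply (d hv y hy) (d hw y hy) c e
    rw [he.fderiv_eq, fderiv_const_mul_add_apply (d' hv e) (d' hw e)]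
  simp only [planeLaplacian, key]
  ring

theorem HasDirichletTrace.congr_data {v : Plane → ℂ} {g h : ℝ → ℂ} (hgh : EqOn g h (Ioi 0))
    (hv : HasDirichletTrace v g) : HasDirichletTrace v h := by
  have key : ∀ ε : ℝ, eLpNorm (fun s => v (s, ε) - g s) 2 (volume.restrict (Ioi (0 : ℝ)))
      = eLpNorm (fun s => v (s, ε) - h s) 2 (volume.restrict (Ioi (0 : ℝ))) := fun ε =>
    eLpNorm_congr_ae ((ae_restrict_iff' measurableSet_Ioi).2 (.of_forall fun s hs => by
      simp only [hgh hs]))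
  exact ⟨by simpa only [key] using hv.1, by simpa only [key] using hv.2⟩

theorem exists_solution (ω₀ : ℝ) {α : ℝ} (hα : Real.pi / 2 < α) (hα' : α < Real.pi)
    (h1 : 0 < Real.cos (Real.pi + α)) {f : ℝ → ℂ} (hf : IsProfile f) :
    ∃ u : 𝓢'(SpaceTime, ℂ), ClassM u ∧ SolvesScattering ω₀ α f u := by
  obtain ⟨k, B, hk, hB, hk0, hkF⟩ := hf.exists_signal ω₀
  set β := (Real.pi + α) / 2 with hβ
  -- `μ = -e^{-iβ}`, so `μ² = e^{-i(π+α)}` and `linearPhase μ` is `n·x`. The sign is chosen so that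
  -- `Re μ > 0`, because `β` lies between `3π/4` and `π`.
  set μ : ℂ := ⟨-Real.cos β, Real.sin β⟩ with hμdef
  have hμ : ‖μ‖ = 1 := by
    rw [← sq_eq_sq₀ (norm_nonneg _) zero_le_one, ← Complex.normSq_eq_norm_sq, Complex.normSq_apply]
    have := Real.sin_sq_add_cos_sq β
    simp only [hμdef]
    linarith
  have hre : 0 < μ.re :=
    neg_pos.2 (Real.cos_neg_of_pi_div_two_lt_of_lt (by rw [hβ]; linarith [Real.pi_pos])
      (by rw [hβ]; linarith [Real.pi_pos]))
  -- The decay rate of the diffracted wave is also the phase speed `cos(π+α)` of the boundary data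
  -- along the slit.
  have hcos : μ.re ^ 2 - μ.im ^ 2 = Real.cos (Real.pi + α) := by
    have : Real.pi + α = 2 * β := by rw [hβ]; ring
    rw [this, Real.cos_two_mul']
    simp only [hμdef]
    ring
  have hd : 0 < μ.re ^ 2 - μ.im ^ 2 := hcos ▸ h1
  have hμ' : ‖(starRingEnd ℂ) μ‖ = 1 := by rw [RCLike.norm_conj, hμ]
  have hre' : 0 < ((starRingEnd ℂ) μ).re := by simpa using hre
  have hd' : 0 < ((starRingEnd ℂ) μ).re ^ 2 - ((starRingEnd ℂ) μ).im ^ 2 := by simpa using hd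
  obtain ⟨u, hu0, hu⟩ := exists_scattered_distribution hk hB hk0 hμ hre hd
  have hsm : ∀ ω : ℂ, 0 < ω.im →
      ContDiffOn ℝ 2 (scatteredTransform μ (fourierLaplaceFun k) ω) Q := fun ω hω =>
    (contDiffOn_scatteredTransform μ _ hω).of_le two_le_smooth
  refine ⟨u, ⟨hu0, _, hu, isHolomorphicC2_scatteredTransform μ
    (differentiableOn_fourierLaplaceFun hk hB), fun ω hω => ?_⟩, ?_, ?_, _, hu, fun ω hω =>
    ⟨hsm ω hω, ?_⟩⟩
  · exact memH1_const_mul_add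
      ((contDiffOn_diffracted μ hω).of_le (by exact_mod_cast le_top))
      ((contDiffOn_diffracted _ hω).of_le (by exact_mod_cast le_top))
      (memH1_diffracted hμ hre hd hω) (memH1_diffracted hμ' hre' hd' hω) _
  · refine wave_of_helmholtz u hu0 hu hsm fun ω hω x hx => ?_
    have := planeLaplacian_const_mul_add ((contDiffOn_diffracted μ hω).of_le two_le_smooth)
      ((contDiffOn_diffracted ((starRingEnd ℂ) μ) hω).of_le two_le_smooth)
      (-(fourierLaplaceFun k ω / 2)) hx
    refine this.trans ?_
    rw [planeLaplacian_diffracted hμ hω hx, planeLaplacian_diffracted hμ' hω hx,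
      scatteredTransform]
    ring
  · exact fun φ hφ => hu0 φ (hφ.trans fun p hp => hp.2)
  · refine (hasDirichletTrace_scatteredTransform hμ hre hd _ hω).congr_data fun s hs => ?_
    rw [fourierLaplaceFun_data h1 hf.eq_zero ω hs, hcos, hkF]

end

end HalfPlaneDiffraction

theorem mainTheorem1 (ω₀ α : ℝ) (hω₀ : 0 < ω₀) (hα : Real.pi / 2 < α) (hα' : α < Real.pi)
    (f : ℝ → ℂ) (hf : HalfPlaneDiffraction.IsProfile f) :
    ∃! u : TemperedDistribution HalfPlaneDiffraction.SpaceTime ℂ,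
      HalfPlaneDiffraction.ClassM u ∧ HalfPlaneDiffraction.SolvesScattering ω₀ α f u := by
  have h1 : 0 < Real.cos (Real.pi + α) := by
    rw [add_comm, Real.cos_add_pi, neg_pos]
    exact Real.cos_neg_of_pi_div_two_lt_of_lt hα (by linarith [Real.pi_pos])
  obtain ⟨u, hu, hu'⟩ := HalfPlaneDiffraction.exists_solution ω₀ hα hα' h1 hf
  exact ⟨u, ⟨hu, hu'⟩, fun v hv =>
    HalfPlaneDiffraction.solution_unique h1 hf.eq_zero hv.1 hu hv.2 hu'⟩
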